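/- **Theorem 6.1.** Let $K$ be a field of characteristic different from $2$, and let $\mathrm{SAlg}_K$ be the category of ($\mathbb Z/2$-graded, supercommutative) $K$-superalgebras with even morphisms. A $K$-functor is a functor from $\mathrm{SAlg}_K$ to sets, and $SSp\,A=\mathrm{Hom}_{\mathrm{SAlg}_K}(A,-)$. An affine supergroup $G$ is a group $K$-functor $SSp\,K[G]$ with $K[G]$ a commutative Hopf superalgebra; it is algebraic if $K[G]$ is finitely generated. A finite family $R\to R_1,\dots,R\to R_n$ in $\mathrm{SAlg}_K$ is an ff-covering of $R$ if $R_1\times\dots\times R_n$ is a faithfully flat $R$-supermodule, and an fppf-covering if moreover every $R_i$ is a finitely presented $R$-superalgebra. A $K$-functor $X$ is a dur $K$-sheaf (respectively a $K$-sheaf) if $X(R)\to\prod_i X(R_i)\rightrightarrows\prod_{i,j}X(R_i\otimes_R R_j)$ is exact for all ff-coverings (respectively all fppf-coverings). For a normal closed supersubgroup $N$ of $G$, the quotients $\tilde{\tilde{G/N}}$ and $\tilde{G/N}$ are the dur $K$-sheaf and the $K$-sheaf associated with the naive quotient $R\mapsto G(R)/N(R)$, that is, the universal dur $K$-sheaf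 and the universal $K$-sheaf under this functor. $N$ is called faithfully exact in $G$ if $K[G]$ is a faithfully coflat right $K[N]$-supercomodule, that is, a sequence $V'\to V\to V''$ of left $K[N]$-supercomodules with even morphisms is exact if and only if $K[G]\square_{K[N]}V'\to K[G]\square_{K[N]}V\to K[G]\square_{K[N]}V''$ is exact. Let $\phi:G\to H$ be a morphism of affine supergroups with comorphism $\phi^*:K[H]\to K[G]$. Let $N$ be its kernel, the normal closed supersubgroup of $G$ with defining ideal $K[G]\,\phi^*(\ker\epsilon_H)$, and let $\mathrm{Im}\,\phi$ be the closed supersubgroup of $H$ with defining ideal $\ker\phi^*$. Then: 1. restriction along $K[H]\to\mathrm{Im}\,\phi^*$ identifies $SSp(\mathrm{Im}\,\phi^*)$ with $\mathrm{Im}\,\phi$; 2. there is a morphism of group $K$-functors $\alpha:\bigl(R\mapsto G(R)/N(R)\bigr)\to\mathrm{Im}\,\phi$ whose composite with the projection from $G$ and the inclusion of $\mathrm{Im}\,\phi$ into $H$ is $\phi$, and $\alpha$ exhibits $\mathrm{Im}\,\phi$ as the associated dur $K$-sheaf; thus $\tilde{\tilde{G/N}}\simeq\mathrm{Im}\,\phi$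 as supergroups; 3. $N$ is faithfully exact in $G$; 4. if $G$ and $H$ are algebraic, then the same $\alpha$ also exhibits $\mathrm{Im}\,\phi$ as the associated $K$-sheaf; thus $\tilde{G/N}=\tilde{\tilde{G/N}}$. -/

import Mathlib

open CategoryTheory TensorProduct

universe u

namespace Super

noncomputable section

/-! ### Commutative superalgebras -/

/-- A commutative superalgebra over `K`: a `ZMod 2`-graded associative unital algebra in which
homogeneous elements satisfy `a b = (-1)^{|a||b|} b a`. -/
structure SAlg (K : Type u) [Field K] : Type (u + 1) where
  carrier : Type u
  [ring : Ring carrier]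
  [algebra : Algebra K carrier]
  gr : ZMod 2 → Submodule K carrier
  [graded : GradedAlgebra gr]
  supercomm : ∀ (i j : ZMod 2) (a b : carrier), a ∈ gr i → b ∈ gr j →
    a * b = ((-1 : ℤˣ) ^ (i * j)) • (b * a)

attribute [instance] SAlg.ring SAlg.algebra SAlg.graded

variable {K : Type u} [Field K]

/-- Even homomorphisms of superalgebras. -/
@[ext]
structure SAlg.Hom (A B : SAlg K) : Type u where
  toAlgHom : A.carrier →ₐ[K] B.carrier
  even : ∀ (i : ZMod 2) (a : A.carrier), a ∈ A.gr i → toAlgHom a ∈ B.gr i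

/-- The category `SAlg_K` of commutative superalgebras with even morphisms. -/
instance : Category (SAlg K) where
  Hom A B := SAlg.Hom A B
  id A := ⟨AlgHom.id K A.carrier, fun _ _ h => h⟩
  comp f g := ⟨g.toAlgHom.comp f.toAlgHom, fun i a h => g.even i _ (f.even i a h)⟩

@[ext]
theorem SAlg.hom_ext {A B : SAlg K} {f g : A ⟶ B} (h : ∀ a, f.toAlgHom a = g.toAlgHom a) :
    f = g :=
  SAlg.Hom.ext (AlgHom.ext h)

@[simp]
theorem SAlg.id_apply (A : SAlg K) (a : A.carrier) : SAlg.Hom.toAlgHom (𝟙 A) a = a := rfl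

@[simp]
theorem SAlg.comp_apply {A B C : SAlg K} (f : A ⟶ B) (g : B ⟶ C) (a : A.carrier) :
    SAlg.Hom.toAlgHom (f ≫ g) a = g.toAlgHom (f.toAlgHom a) := rfl

/-- Even morphisms commute with taking homogeneous components. -/
theorem SAlg.decompose_map {A B : SAlg K} (f : A ⟶ B) (a : A.carrier) (i : ZMod 2) :
    (DirectSum.decompose B.gr (f.toAlgHom a) i : B.carrier) =
      f.toAlgHom (DirectSum.decompose A.gr a i : A.carrier) := by
  induction a using DirectSum.Decomposition.inductionOn A.gr with
  | zero => simp
  | add a b ha hb => simp [DirectSum.decompose_add, ha, hb]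
  | @homogeneous j a =>
    by_cases h : j = i
    · subst h
      rw [DirectSum.decompose_of_mem_same _ (f.even j _ a.2),
        DirectSum.decompose_of_mem_same _ a.2]
    · rw [DirectSum.decompose_of_mem_ne _ (f.even j _ a.2) h,
        DirectSum.decompose_of_mem_ne _ a.2 h, map_zero]

/-- An element is the sum of its even and odd components. -/
theorem SAlg.even_add_odd (A : SAlg K) (a : A.carrier) :
    (DirectSum.decompose A.gr a 0 : A.carrier) + DirectSum.decompose A.gr a 1 = a := by
  induction a using DirectSum.Decomposition.inductionOn A.gr with
  | zero => simp
  | add a b ha hb =>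
    conv_rhs => rw [← ha, ← hb]
    simp only [DirectSum.decompose_add, DirectSum.add_apply, Submodule.coe_add]
    abel
  | @homogeneous j a =>
    obtain rfl | rfl : j = 0 ∨ j = 1 := by
      clear a; revert j; decide
    · rw [DirectSum.decompose_of_mem_same _ a.2,
        DirectSum.decompose_of_mem_ne _ a.2 zero_ne_one, add_zero]
    · rw [DirectSum.decompose_of_mem_same _ a.2,
        DirectSum.decompose_of_mem_ne _ a.2 one_ne_zero, zero_add]

/-- The homogeneous components of the image of a morphism of superalgebras. -/
def SAlg.rangeGr {A B : SAlg K} (f : A ⟶ B) (i : ZMod 2) :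
    Submodule K f.toAlgHom.range :=
  (B.gr i).comap f.toAlgHom.range.val.toLinearMap

theorem SAlg.rangeGr_isInternal {A B : SAlg K} (f : A ⟶ B) :
    DirectSum.IsInternal (SAlg.rangeGr f) := by
  refine (DirectSum.isInternal_submodule_iff_isCompl (SAlg.rangeGr f) (i := 0) (j := 1)
    zero_ne_one (by ext i; revert i; decide)).2 ⟨?_, ?_⟩
  · rw [Submodule.disjoint_def]
    intro x h0 h1
    ext
    have e0 := DirectSum.decompose_of_mem_same B.gr (x := x.1) h0
    have e1 := DirectSum.decompose_of_mem_ne B.gr (x := x.1) h1 one_ne_zero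
    exact e0.symm.trans e1
  · rw [codisjoint_iff, Submodule.eq_top_iff']
    rintro ⟨_, a, rfl⟩
    refine Submodule.mem_sup.2
      ⟨⟨f.toAlgHom (DirectSum.decompose A.gr a 0 : A.carrier), _, rfl⟩,
        f.even 0 _ (SetLike.coe_mem _),
        ⟨f.toAlgHom (DirectSum.decompose A.gr a 1 : A.carrier), _, rfl⟩,
        f.even 1 _ (SetLike.coe_mem _), ?_⟩
    ext
    change f.toAlgHom _ + f.toAlgHom _ = f.toAlgHom a
    rw [← map_add, SAlg.even_add_odd]

/-- The image of a morphism of superalgebras, as a supersubalgebra. -/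
def SAlg.range {A B : SAlg K} (f : A ⟶ B) : SAlg K where
  carrier := f.toAlgHom.range
  gr := SAlg.rangeGr f
  graded :=
    { one_mem := SetLike.GradedOne.one_mem (A := B.gr)
      mul_mem := fun _ _ _ _ hx hy => SetLike.GradedMul.mul_mem (A := B.gr) hx hy
      toDecomposition := (SAlg.rangeGr_isInternal f).chooseDecomposition }
  supercomm i j a b ha hb := by
    have h := B.supercomm i j a.1 b.1 ha hb
    ext
    rw [Subalgebra.coe_mul, h]
    rcases Int.units_eq_one_or ((-1 : ℤˣ) ^ (i * j)) with e | e <;> rw [e] <;>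
      simp [Units.smul_def]

/-- A morphism of superalgebras, as a morphism onto its image. -/
def SAlg.toRange {A B : SAlg K} (f : A ⟶ B) : A ⟶ SAlg.range f where
  toAlgHom := f.toAlgHom.rangeRestrict
  even i a ha := f.even i a ha

/-- The affine superscheme `SSp A`, as a `K`-functor. -/
def SSp (A : SAlg K) : SAlg K ⥤ Type u := coyoneda.obj (Opposite.op A)

/-! ### Affine supergroups -/

/-- The degree `i` part of the tensor product of two superspaces. -/
def tensorGr {V W : Type u} [AddCommGroup V] [Module K V] [AddCommGroup W] [Module K W]
    (gV : ZMod 2 → Submodule K V) (gW : ZMod 2 → Submodule K W) (i : ZMod 2) :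
    Submodule K (V ⊗[K] W) :=
  ⨆ j : ZMod 2, Submodule.map₂ (TensorProduct.mk K V W) (gV j) (gW (i - j))

/-- An affine supergroup `G`, given by its coordinate superalgebra `K[G] = G.alg`, a commutative
Hopf superalgebra. Multiplicativity of the comultiplication refers to the product
`(a ⊗ b)(c ⊗ d) = (-1)^{|b||c|} ac ⊗ bd` on `K[G] ⊗ K[G]`. -/
structure AffineSupergroup (K : Type u) [Field K] : Type (u + 1) where
  alg : SAlg K
  [coalgebra : Coalgebra K alg.carrier]
  counit_one : Coalgebra.counit (R := K) (1 : alg.carrier) = 1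
  counit_mul : ∀ a b : alg.carrier, Coalgebra.counit (R := K) (a * b) =
    Coalgebra.counit (R := K) a * Coalgebra.counit (R := K) b
  counit_odd : ∀ a ∈ alg.gr 1, Coalgebra.counit (R := K) a = 0
  comul_one : GradedTensorProduct.of K alg.gr alg.gr
    (Coalgebra.comul (R := K) (1 : alg.carrier)) = 1
  comul_mul : ∀ a b : alg.carrier,
    GradedTensorProduct.of K alg.gr alg.gr (Coalgebra.comul (R := K) (a * b)) =
      GradedTensorProduct.of K alg.gr alg.gr (Coalgebra.comul (R := K) a) *
      GradedTensorProduct.of K alg.gr alg.gr (Coalgebra.comul (R := K) b)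
  comul_even : ∀ (i : ZMod 2) (a : alg.carrier), a ∈ alg.gr i →
    Coalgebra.comul (R := K) a ∈ tensorGr alg.gr alg.gr i
  antipode : alg ⟶ alg
  antipode_left : ∀ a : alg.carrier, LinearMap.mul' K alg.carrier
    (antipode.toAlgHom.toLinearMap.rTensor alg.carrier (Coalgebra.comul (R := K) a)) =
      algebraMap K alg.carrier (Coalgebra.counit (R := K) a)
  antipode_right : ∀ a : alg.carrier, LinearMap.mul' K alg.carrier
    (antipode.toAlgHom.toLinearMap.lTensor alg.carrier (Coalgebra.comul (R := K) a)) =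
      algebraMap K alg.carrier (Coalgebra.counit (R := K) a)

attribute [instance] AffineSupergroup.coalgebra

namespace AffineSupergroup

/-- The set `G(R)` of `R`-points. -/
def Pt (G : AffineSupergroup K) (R : SAlg K) : Type u := G.alg ⟶ R

variable (G : AffineSupergroup K) {R S T : SAlg K}

/-- The linear map underlying a point. -/
def Pt.lin {G : AffineSupergroup K} {R : SAlg K} (g : G.Pt R) : G.alg.carrier →ₗ[K] R.carrier :=
  (SAlg.Hom.toAlgHom g).toLinearMap

variable {G}

@[ext]
theorem Pt.ext {g h : G.Pt R} (e : g.lin = h.lin) : g = h :=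
  SAlg.hom_ext (fun a => LinearMap.congr_fun e a)

theorem Pt.lin_mul (g : G.Pt R) (a b : G.alg.carrier) : g.lin (a * b) = g.lin a * g.lin b :=
  map_mul (SAlg.Hom.toAlgHom g) a b

theorem Pt.lin_one (g : G.Pt R) : g.lin 1 = 1 := map_one (SAlg.Hom.toAlgHom g)

/-- The linear map `a ⊗ b ↦ g(a) h(b)`, as an algebra map on the graded tensor product. -/
def Pt.pair (g h : G.Pt R) : GradedTensorProduct K G.alg.gr G.alg.gr →ₐ[K] R.carrier :=
  GradedTensorProduct.lift G.alg.gr G.alg.gr (SAlg.Hom.toAlgHom g) (SAlg.Hom.toAlgHom h)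
    (fun i j a b => by
      rw [mul_comm j i]
      exact R.supercomm i j _ _ (SAlg.Hom.even g i _ a.2) (SAlg.Hom.even h j _ b.2))

/-- The linear map `f ↦ ∑ g(f₁) h(f₂)`. -/
def Pt.conv (g h : G.Pt R) : G.alg.carrier →ₗ[K] R.carrier :=
  LinearMap.mul' K R.carrier ∘ₗ TensorProduct.map g.lin h.lin ∘ₗ Coalgebra.comul

theorem Pt.conv_eq_pair (g h : G.Pt R) (a : G.alg.carrier) :
    g.conv h a = g.pair h (GradedTensorProduct.of K G.alg.gr G.alg.gr (Coalgebra.comul a)) := rfl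

/-- The product of points: `(g h)(f) = ∑ g(f₁) h(f₂)`. -/
instance : Mul (G.Pt R) where
  mul g h :=
    { toAlgHom := AlgHom.ofLinearMap (g.conv h)
        (by rw [Pt.conv_eq_pair, G.comul_one, map_one])
        (fun a b => by rw [Pt.conv_eq_pair, G.comul_mul, map_mul]; rfl)
      even := fun i a ha => by
        have key : tensorGr G.alg.gr G.alg.gr i ≤
            (R.gr i).comap (LinearMap.mul' K R.carrier ∘ₗ TensorProduct.map g.lin h.lin) := by
          refine iSup_le fun j => Submodule.map₂_le.2 fun x hx y hy => ?_
          have := SetLike.GradedMul.mul_mem (A := R.gr)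
            (SAlg.Hom.even g j x hx) (SAlg.Hom.even h _ y hy)
          rw [add_sub_cancel] at this
          exact this
        exact key (G.comul_even i a ha) }

theorem Pt.mul_lin (g h : G.Pt R) : (g * h).lin = g.conv h := rfl

/-- The unit point `f ↦ ε(f)`. -/
instance : One (G.Pt R) where
  one :=
    { toAlgHom := AlgHom.ofLinearMap (Algebra.linearMap K R.carrier ∘ₗ Coalgebra.counit)
        (by
          change algebraMap K R.carrier (Coalgebra.counit (R := K) (1 : G.alg.carrier)) = 1
          rw [G.counit_one, map_one])
        (fun a b => by
          change algebraMap K R.carrier (Coalgebra.counit (R := K) (a * b)) = _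
          rw [G.counit_mul, map_mul]; rfl)
      even := fun i a ha => by
        obtain rfl | rfl : i = 0 ∨ i = 1 := by
          clear ha; revert i; decide
        · exact SetLike.algebraMap_mem_graded R.gr _
        · have : Coalgebra.counit (R := K) a = 0 := G.counit_odd a ha
          simp [this] }

theorem Pt.one_lin : (1 : G.Pt R).lin = Algebra.linearMap K R.carrier ∘ₗ Coalgebra.counit := rfl

/-- The inverse of a point: `g⁻¹(f) = g(s(f))`. -/
instance : Inv (G.Pt R) where
  inv g := G.antipode ≫ (show G.alg ⟶ R from g)

theorem Pt.inv_lin (g : G.Pt R) :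
    (g⁻¹).lin = g.lin ∘ₗ G.antipode.toAlgHom.toLinearMap := rfl

theorem Pt.conv_eq (g h : G.Pt R) :
    g.conv h = (WithConv.toConv g.lin * WithConv.toConv h.lin).ofConv := rfl

/-- The group `G(R)`. -/
instance : Group (G.Pt R) where
  mul_assoc g h k := by
    ext1
    simp only [Pt.mul_lin, Pt.conv_eq, WithConv.toConv_ofConv, mul_assoc]
  one_mul g := by
    ext1
    have : WithConv.toConv (1 : G.Pt R).lin = 1 := rfl
    rw [Pt.mul_lin, Pt.conv_eq, this, one_mul]
  mul_one g := by
    ext1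
    have : WithConv.toConv (1 : G.Pt R).lin = 1 := rfl
    rw [Pt.mul_lin, Pt.conv_eq, this, mul_one]
  inv_mul_cancel g := by
    ext a
    have h1 := congrArg g.lin (G.antipode_left a)
    have h2 : ∀ t : G.alg.carrier ⊗[K] G.alg.carrier,
        g.lin (LinearMap.mul' K _ (G.antipode.toAlgHom.toLinearMap.rTensor _ t)) =
        LinearMap.mul' K R.carrier (TensorProduct.map (g⁻¹).lin g.lin t) := by
      intro t
      induction t with
      | zero => simp
      | add x y hx hy => simp only [map_add, hx, hy]
      | tmul x y => simp [Pt.lin_mul, Pt.inv_lin]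
    rw [h2] at h1
    refine h1.trans ?_
    exact (SAlg.Hom.toAlgHom g).commutes _

/-- The group `K`-functor of points of `G`. -/
def points (G : AffineSupergroup K) : SAlg K ⥤ GrpCat.{u} where
  obj R := GrpCat.of (G.Pt R)
  map {R S} f := GrpCat.ofHom
    { toFun := fun g => (show G.alg ⟶ R from g) ≫ f
      map_one' := by
        ext a
        exact f.toAlgHom.commutes _
      map_mul' := fun g h => by
        ext a
        have h2 : ∀ t : G.alg.carrier ⊗[K] G.alg.carrier,
            f.toAlgHom (LinearMap.mul' K R.carrier (TensorProduct.map g.lin h.lin t)) =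
            LinearMap.mul' K S.carrier (TensorProduct.map
              (Pt.lin (G := G) ((show G.alg ⟶ R from g) ≫ f))
              (Pt.lin (G := G) ((show G.alg ⟶ R from h) ≫ f)) t) := by
          intro t
          induction t with
          | zero => simp
          | add x y hx hy => simp only [map_add, hx, hy]
          | tmul x y => exact map_mul f.toAlgHom _ _
        exact h2 _ }

/-- A morphism `φ : G → H` of affine supergroups, given by its comorphism
`φ^* : K[H] → K[G]`, a morphism of Hopf superalgebras. -/
structure Mor (G H : AffineSupergroup K) : Type u where
  comorphism : H.alg ⟶ G.alg
  counit_comp : ∀ f : H.alg.carrier, Coalgebra.counit (R := K) (comorphism.toAlgHom f) =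
    Coalgebra.counit (R := K) f
  comul_comp : ∀ f : H.alg.carrier, Coalgebra.comul (R := K) (comorphism.toAlgHom f) =
    TensorProduct.map comorphism.toAlgHom.toLinearMap comorphism.toAlgHom.toLinearMap
      (Coalgebra.comul (R := K) f)

/-- The group homomorphism `G(R) → H(R)`, `g ↦ g ∘ φ^*`. -/
def Mor.onPt {G H : AffineSupergroup K} (φ : Mor G H) (R : SAlg K) : G.Pt R →* H.Pt R where
  toFun g := φ.comorphism ≫ (show G.alg ⟶ R from g)
  map_one' := by
    ext a
    exact congrArg (algebraMap K R.carrier) (φ.counit_comp a)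
  map_mul' g h := by
    ext a
    have h1 := congrArg (fun t => LinearMap.mul' K R.carrier (TensorProduct.map g.lin h.lin t))
      (φ.comul_comp a)
    refine h1.trans ?_
    change LinearMap.mul' K R.carrier ((TensorProduct.map g.lin h.lin ∘ₗ
      TensorProduct.map _ _) _) = _
    rw [← TensorProduct.map_comp]
    rfl

/-- The morphism of group `K`-functors given by `φ`. -/
def Mor.points {G H : AffineSupergroup K} (φ : Mor G H) : G.points ⟶ H.points where
  app R := GrpCat.ofHom (φ.onPt R)
  naturality _ _ _ := rfl

/-- The comorphism commutes with antipodes. -/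
theorem Mor.antipode_comp {G H : AffineSupergroup K} (φ : Mor G H) (f : H.alg.carrier) :
    G.antipode.toAlgHom (φ.comorphism.toAlgHom f) =
      φ.comorphism.toAlgHom (H.antipode.toAlgHom f) := by
  have h := map_inv (φ.onPt G.alg) (show G.Pt G.alg from 𝟙 G.alg)
  exact LinearMap.congr_fun (congrArg Pt.lin h) f

/-- `G` is algebraic if `K[G]` is a finitely generated superalgebra. -/
def IsAlgebraic (G : AffineSupergroup K) : Prop := Algebra.FiniteType K G.alg.carrier

/-! ### Closed supersubgroups -/

/-- A closed supersubgroup of `G`, given by its defining Hopf superideal `I` of `K[G]`. (A left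
superideal of a commutative superalgebra is two-sided. The condition `comul_mem` says that
`δ(I) ⊆ I ⊗ K[G] + K[G] ⊗ I`, the kernel of `K[G] ⊗ K[G] → K[G]/I ⊗ K[G]/I`.) -/
structure ClosedSub (G : AffineSupergroup K) : Type u where
  ideal : Ideal G.alg.carrier
  homogeneous : ideal.IsHomogeneous G.alg.gr
  counit_mem : ∀ a ∈ ideal, Coalgebra.counit (R := K) a = 0
  comul_mem : ∀ a ∈ ideal, TensorProduct.map (ideal.restrictScalars K).mkQ
    (ideal.restrictScalars K).mkQ (Coalgebra.comul (R := K) a) = 0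
  antipode_mem : ∀ a ∈ ideal, G.antipode.toAlgHom a ∈ ideal

namespace ClosedSub

variable {G : AffineSupergroup K} (N : ClosedSub G)

/-- The subgroup `N(R) = {g ∈ G(R) | g(I_N) = 0}` of `G(R)`. -/
def pt (R : SAlg K) : Subgroup (G.Pt R) where
  carrier := {g | ∀ a ∈ N.ideal, g.lin a = 0}
  one_mem' a ha := by
    rw [Pt.one_lin, LinearMap.comp_apply, N.counit_mem a ha, map_zero]
  inv_mem' {g} hg a ha := hg _ (N.antipode_mem a ha)
  mul_mem' {g h} hg hh a ha := by
    let p := (N.ideal.restrictScalars K).mkQ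
    let g' := (N.ideal.restrictScalars K).liftQ g.lin (fun x hx => hg x hx)
    let h' := (N.ideal.restrictScalars K).liftQ h.lin (fun x hx => hh x hx)
    have e : TensorProduct.map g.lin h.lin =
        TensorProduct.map g' h' ∘ₗ TensorProduct.map p p := by
      rw [← TensorProduct.map_comp]
      congr 1
    change LinearMap.mul' K R.carrier (TensorProduct.map g.lin h.lin (Coalgebra.comul a)) = 0
    rw [e, LinearMap.comp_apply, N.comul_mem a ha, map_zero, map_zero]

theorem map_mem {R S : SAlg K} (f : R ⟶ S) (g : G.Pt R) (hg : g ∈ N.pt R) :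
    (G.points.map f).hom g ∈ N.pt S := fun a ha => by
  have h : f.toAlgHom (g.lin a) = f.toAlgHom 0 := congrArg f.toAlgHom (hg a ha)
  rw [map_zero] at h
  exact h

/-- The group `K`-functor `R ↦ N(R)`. -/
def points : SAlg K ⥤ GrpCat.{u} where
  obj R := GrpCat.of (N.pt R)
  map {R S} f := GrpCat.ofHom
    (((G.points.map f).hom.comp (N.pt R).subtype).codRestrict (N.pt S)
      (fun g => N.map_mem f g.1 g.2))

/-- The inclusion of `N` into `G`. -/
def incl : N.points ⟶ G.points where
  app R := GrpCat.ofHom (N.pt R).subtype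
  naturality _ _ _ := rfl

/-- `N` is normal in `G` if `N(R)` is normal in `G(R)` for all `R`. -/
class IsNormal : Prop where
  normal : ∀ R : SAlg K, (N.pt R).Normal

instance [N.IsNormal] (R : SAlg K) : (N.pt R).Normal := IsNormal.normal R

/-- The naive quotient `R ↦ G(R)/N(R)` of `G` by a normal closed supersubgroup. -/
def naiveQuotient [N.IsNormal] : SAlg K ⥤ GrpCat.{u} where
  obj R := GrpCat.of (G.Pt R ⧸ N.pt R)
  map {R S} f := GrpCat.ofHom
    (QuotientGroup.map (N.pt R) (N.pt S) (G.points.map f).hom (fun g hg => N.map_mem f g hg))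
  map_id R := by
    ext x
    rfl
  map_comp f g := by
    ext x
    rfl

/-- The projection of `G` onto its naive quotient by `N`. -/
def proj [N.IsNormal] : G.points ⟶ N.naiveQuotient where
  app R := GrpCat.ofHom (QuotientGroup.mk' (N.pt R))
  naturality _ _ _ := rfl

end ClosedSub

/-- Left multiplication in `A ⊗ A` preserves the kernel of `A ⊗ A → A/I ⊗ A/I`, for a left
superideal `I`. -/
theorem mkQ_mul_eq_zero (A : SAlg K) (I : Ideal A.carrier) (hI : I.IsHomogeneous A.gr)
    (t u : A.carrier ⊗[K] A.carrier)
    (hu : TensorProduct.map (I.restrictScalars K).mkQ (I.restrictScalars K).mkQ u = 0) :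
    TensorProduct.map (I.restrictScalars K).mkQ (I.restrictScalars K).mkQ
      ((GradedTensorProduct.of K A.gr A.gr).symm
        (GradedTensorProduct.of K A.gr A.gr t * GradedTensorProduct.of K A.gr A.gr u)) = 0 := by
  set p := (I.restrictScalars K).mkQ with hp
  set o := GradedTensorProduct.of K A.gr A.gr with ho
  have hp0 : ∀ a ∈ I, p a = 0 := fun a ha => by
    rw [hp, Submodule.mkQ_apply, Submodule.Quotient.mk_eq_zero]; exact ha
  have sgn : ∀ (j k : ZMod 2) (x y a b : A.carrier), y ∈ A.gr j → a ∈ A.gr k →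
      TensorProduct.map p p (o.symm (o (x ⊗ₜ y) * o (a ⊗ₜ b))) =
        ((-1 : ℤˣ) ^ (j * k)) • (p (x * a) ⊗ₜ[K] p (y * b)) := by
    intro j k x y a b hy ha
    have h := GradedTensorProduct.tmul_coe_mul_coe_tmul (R := K) A.gr A.gr x ⟨y, hy⟩ ⟨a, ha⟩ b
    have h' : o (x ⊗ₜ y) * o (a ⊗ₜ b) = ((-1 : ℤˣ) ^ (j * k)) • o ((x * a) ⊗ₜ (y * b)) := h
    rw [h']
    rcases Int.units_eq_one_or ((-1 : ℤˣ) ^ (j * k)) with e | e <;> rw [e] <;>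
      simp [Units.smul_def]
  have e2 : ∀ (x y a b : A.carrier), (a ∈ I ∨ b ∈ I) →
      TensorProduct.map p p (o.symm (o (x ⊗ₜ y) * o (a ⊗ₜ b))) = 0 := by
    intro x y a b hab
    induction y using DirectSum.Decomposition.inductionOn A.gr with
    | zero => simp
    | add y y' hy hy' => simp only [TensorProduct.tmul_add, map_add, add_mul, hy, hy', add_zero]
    | @homogeneous j y =>
      classical
      rw [← DirectSum.sum_support_decompose A.gr a]
      simp only [TensorProduct.sum_tmul, map_sum, Finset.mul_sum]
      refine Finset.sum_eq_zero fun k _ => ?_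
      rw [sgn j k _ _ _ _ y.2 (SetLike.coe_mem _)]
      rcases hab with h | h
      · rw [hp0 _ (I.mul_mem_left x (hI k h)), TensorProduct.zero_tmul, smul_zero]
      · rw [hp0 _ (I.mul_mem_left _ h), TensorProduct.tmul_zero, smul_zero]
  have hs : Function.Surjective p := Submodule.mkQ_surjective _
  have hu' : u ∈ LinearMap.ker (TensorProduct.map p p) := hu
  rw [TensorProduct.map_ker (f := (I.restrictScalars K).subtype) (g := p)
    (f' := (I.restrictScalars K).subtype) (g' := p)
    (LinearMap.exact_subtype_mkQ _) hs (LinearMap.exact_subtype_mkQ _) hs] at hu'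
  obtain ⟨_, ⟨v, rfl⟩, _, ⟨w, rfl⟩, rfl⟩ := Submodule.mem_sup.1 hu'
  clear hu hu'
  induction t with
  | zero => simp
  | add t t' ht ht' => simp only [map_add, add_mul] at ht ht' ⊢; rw [ht, ht', add_zero]
  | tmul x y =>
    rw [map_add, mul_add, map_add, map_add]
    have h1 : TensorProduct.map p p (o.symm (o (x ⊗ₜ y) *
        o (LinearMap.lTensor A.carrier (I.restrictScalars K).subtype v))) = 0 := by
      induction v with
      | zero => simp
      | add v v' hv hv' => simp only [map_add, mul_add]; rw [hv, hv', add_zero]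
      | tmul a b => exact e2 _ _ _ _ (Or.inr b.2)
    have h2 : TensorProduct.map p p (o.symm (o (x ⊗ₜ y) *
        o (LinearMap.rTensor A.carrier (I.restrictScalars K).subtype w))) = 0 := by
      induction w with
      | zero => simp
      | add v v' hv hv' => simp only [map_add, mul_add]; rw [hv, hv', add_zero]
      | tmul a b => exact e2 _ _ _ _ (Or.inl a.2)
    rw [h1, h2, add_zero]

theorem kernel_homogeneous {G H : AffineSupergroup K} (φ : Mor G H) :
    (Ideal.span (φ.comorphism.toAlgHom '' {f | Coalgebra.counit (R := K) f = 0})).IsHomogeneous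
      G.alg.gr := by
  have hc : ∀ (f : H.alg.carrier), Coalgebra.counit (R := K) f = 0 → ∀ i : ZMod 2,
      Coalgebra.counit (R := K) (DirectSum.decompose H.alg.gr f i : H.alg.carrier) = 0 := by
    intro f hf i
    have h0 : ∀ x : H.alg.carrier,
        Coalgebra.counit (R := K) (DirectSum.decompose H.alg.gr x 0 : H.alg.carrier) =
          Coalgebra.counit (R := K) x := by
      intro x
      induction x using DirectSum.Decomposition.inductionOn H.alg.gr with
      | zero => simp
      | add a b ha hb => simp [DirectSum.decompose_add, ha, hb]
      | @homogeneous j a =>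
        obtain rfl | rfl : j = 0 ∨ j = 1 := by
          clear a; revert j; decide
        · rw [DirectSum.decompose_of_mem_same _ a.2]
        · rw [DirectSum.decompose_of_mem_ne _ a.2 one_ne_zero, map_zero, H.counit_odd _ a.2]
    obtain rfl | rfl : i = 0 ∨ i = 1 := by
      revert i; decide
    · rw [h0, hf]
    · exact H.counit_odd _ (SetLike.coe_mem _)
  have e : Ideal.span (φ.comorphism.toAlgHom '' {f | Coalgebra.counit (R := K) f = 0}) =
      Ideal.span (φ.comorphism.toAlgHom '' {f | Coalgebra.counit (R := K) f = 0 ∧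
        SetLike.IsHomogeneousElem H.alg.gr f}) := by
    refine le_antisymm (Ideal.span_le.2 ?_) (Ideal.span_mono (Set.image_mono fun f hf => hf.1))
    rintro _ ⟨f, hf, rfl⟩
    classical
    rw [← DirectSum.sum_support_decompose H.alg.gr f, map_sum]
    exact sum_mem fun i _ => Ideal.subset_span
      ⟨_, ⟨hc f hf i, ⟨i, SetLike.coe_mem _⟩⟩, rfl⟩
  rw [e]
  refine Ideal.homogeneous_span _ _ ?_
  rintro _ ⟨f, ⟨_, i, hi⟩, rfl⟩
  exact ⟨i, φ.comorphism.even i f hi⟩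

/-- The kernel of `φ : G → H`, with defining ideal `K[G] φ^*(ker ε_H)`. -/
def kernel {G H : AffineSupergroup K} (φ : Mor G H) : ClosedSub G where
  ideal := Ideal.span (φ.comorphism.toAlgHom '' {f | Coalgebra.counit (R := K) f = 0})
  homogeneous := kernel_homogeneous φ
  counit_mem a ha := by
    induction ha using Submodule.span_induction with
    | mem x hx =>
      obtain ⟨f, hf, rfl⟩ := hx
      rw [φ.counit_comp]; exact hf
    | zero => exact map_zero _
    | add x y _ _ hx hy => rw [map_add, hx, hy, add_zero]
    | smul b x _ hx => rw [smul_eq_mul, G.counit_mul, hx, mul_zero]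
  comul_mem a ha := by
    induction ha using Submodule.span_induction with
    | mem x hx =>
      obtain ⟨f, hf, rfl⟩ := hx
      set I := Ideal.span (φ.comorphism.toAlgHom '' {f | Coalgebra.counit (R := K) f = 0}) with hI
      set p := (I.restrictScalars K).mkQ with hp
      have e : p ∘ₗ φ.comorphism.toAlgHom.toLinearMap =
          LinearMap.toSpanSingleton K _ (p 1) ∘ₗ Coalgebra.counit := by
        ext x
        have h : p (φ.comorphism.toAlgHom (x - algebraMap K _ (Coalgebra.counit (R := K) x))) = 0 := by
          rw [hp, Submodule.mkQ_apply, Submodule.Quotient.mk_eq_zero]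
          refine Ideal.subset_span ⟨_, ?_, rfl⟩
          rw [Set.mem_ofPred_eq, Algebra.algebraMap_eq_smul_one, map_sub, map_smul, H.counit_one,
            smul_eq_mul, mul_one, sub_self]
        rw [map_sub, AlgHom.commutes, map_sub, sub_eq_zero, Algebra.algebraMap_eq_smul_one,
          map_smul] at h
        exact h
      rw [φ.comul_comp, ← LinearMap.comp_apply, ← TensorProduct.map_comp, e,
        TensorProduct.map_comp, LinearMap.comp_apply,
        ← LinearMap.lTensor_comp_rTensor (f := Coalgebra.counit) (g := Coalgebra.counit),
        LinearMap.comp_apply, Coalgebra.rTensor_counit_comul, LinearMap.lTensor_tmul, hf,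
        TensorProduct.tmul_zero, map_zero]
    | zero => rw [map_zero, map_zero]
    | add x y _ _ hx hy => rw [map_add, map_add, hx, hy, add_zero]
    | smul b x hx' hx =>
      have h := G.comul_mul b x
      rw [← LinearEquiv.eq_symm_apply] at h
      rw [smul_eq_mul, h]
      refine mkQ_mul_eq_zero G.alg _ ?_ _ _ hx
      exact kernel_homogeneous φ
  antipode_mem a ha := by
    induction ha using Submodule.span_induction with
    | mem x hx =>
      obtain ⟨f, hf, rfl⟩ := hx
      rw [φ.antipode_comp]
      refine Ideal.subset_span ⟨_, ?_, rfl⟩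
      have h := congrArg (Coalgebra.counit (R := K)) (LinearMap.congr_fun
        (congrArg Pt.lin (inv_one (G := H.Pt H.alg))) f)
      simp only [Pt.inv_lin, Pt.one_lin, LinearMap.comp_apply, Algebra.linearMap_apply,
        Algebra.algebraMap_eq_smul_one, map_smul, H.counit_one, smul_eq_mul, mul_one] at h
      exact h.trans hf
    | zero => rw [map_zero]; exact zero_mem _
    | add x y _ _ hx hy => rw [map_add]; exact add_mem hx hy
    | smul b x _ hx => rw [smul_eq_mul, map_mul]; exact Ideal.mul_mem_left _ _ hx

/-- The `R`-points of the kernel of `φ` are the elements of the kernel of `G(R) → H(R)`. -/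
theorem kernel_pt {G H : AffineSupergroup K} (φ : Mor G H) (R : SAlg K) :
    (kernel φ).pt R = (φ.onPt R).ker := by
  ext g
  rw [MonoidHom.mem_ker]
  constructor
  · intro hg
    ext x
    have h := hg (φ.comorphism.toAlgHom (x - algebraMap K _ (Coalgebra.counit (R := K) x))) (by
      refine Ideal.subset_span ⟨_, ?_, rfl⟩
      rw [Set.mem_ofPred_eq, Algebra.algebraMap_eq_smul_one, map_sub, map_smul, H.counit_one,
        smul_eq_mul, mul_one, sub_self])
    rw [map_sub, AlgHom.commutes, map_sub, sub_eq_zero] at h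
    exact h.trans ((SAlg.Hom.toAlgHom g).commutes _)
  · intro hg a ha
    induction ha using Submodule.span_induction with
    | mem x hx =>
      obtain ⟨f, hf, rfl⟩ := hx
      have h := LinearMap.congr_fun (congrArg Pt.lin hg) f
      refine h.trans ?_
      rw [Pt.one_lin, LinearMap.comp_apply, hf, map_zero]
    | zero => exact map_zero _
    | add x y _ _ hx hy => rw [map_add, hx, hy, add_zero]
    | smul b x _ hx => rw [smul_eq_mul, Pt.lin_mul, hx, mul_zero]

instance {G H : AffineSupergroup K} (φ : Mor G H) : (kernel φ).IsNormal where
  normal R := by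
    rw [kernel_pt]
    infer_instance

/-- The image of `φ : G → H`, with defining ideal `ker φ^*`. -/
def image {G H : AffineSupergroup K} (φ : Mor G H) : ClosedSub H where
  ideal := RingHom.ker φ.comorphism.toAlgHom
  homogeneous i a ha := by
    rw [RingHom.mem_ker] at ha ⊢
    rw [← SAlg.decompose_map, ha]
    simp
  counit_mem a ha := by
    rw [← φ.counit_comp, RingHom.mem_ker.1 ha, map_zero]
  comul_mem a ha := by
    set I := RingHom.ker φ.comorphism.toAlgHom with hI
    let q := (I.restrictScalars K).liftQ φ.comorphism.toAlgHom.toLinearMap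
      (fun x hx => (hx : φ.comorphism.toAlgHom x = 0))
    have hq : Function.Injective q := by
      rw [← LinearMap.ker_eq_bot]
      exact Submodule.ker_liftQ_eq_bot _ _ _ (fun x hx => hx)
    have hqq := TensorProduct.map_injective_of_flat_flat q q hq hq
    apply hqq
    have e : q ∘ₗ (I.restrictScalars K).mkQ = φ.comorphism.toAlgHom.toLinearMap := rfl
    rw [map_zero, ← LinearMap.comp_apply, ← TensorProduct.map_comp, e,
      ← φ.comul_comp, RingHom.mem_ker.1 ha, map_zero]
  antipode_mem a ha := by
    rw [RingHom.mem_ker, ← φ.antipode_comp, RingHom.mem_ker.1 ha, map_zero]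

namespace ClosedSub

/-! ### Faithful exactness -/

variable {G : AffineSupergroup K} (N : ClosedSub G)

/-- The superspace underlying the coordinate superalgebra `K[N] = K[G]/I_N`. -/
abbrev Coord : Type u := G.alg.carrier ⧸ N.ideal.restrictScalars K

/-- The canonical projection `K[G] → K[N]`. -/
def res : G.alg.carrier →ₗ[K] N.Coord := (N.ideal.restrictScalars K).mkQ

/-- The grading of `K[N]`. -/
def coordGr (i : ZMod 2) : Submodule K N.Coord := (G.alg.gr i).map N.res

/-- The comultiplication of `K[N]`. -/
def comul : N.Coord →ₗ[K] N.Coord ⊗[K] N.Coord :=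
  (N.ideal.restrictScalars K).liftQ (TensorProduct.map N.res N.res ∘ₗ Coalgebra.comul)
    (fun a ha => N.comul_mem a ha)

/-- The counit of `K[N]`. -/
def counit : N.Coord →ₗ[K] K :=
  (N.ideal.restrictScalars K).liftQ Coalgebra.counit (fun a ha => N.counit_mem a ha)

/-- Left `K[N]`-supercomodules. -/
structure LeftSupercomodule : Type (u + 1) where
  carrier : Type u
  [addCommGroup : AddCommGroup carrier]
  [module : Module K carrier]
  gr : ZMod 2 → Submodule K carrier
  [decomposition : DirectSum.Decomposition gr]
  coact : carrier →ₗ[K] N.Coord ⊗[K] carrier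
  coact_even : ∀ (i : ZMod 2) (w : carrier), w ∈ gr i → coact w ∈ tensorGr N.coordGr gr i
  counit_coact : ∀ w : carrier, N.counit.rTensor carrier (coact w) = 1 ⊗ₜ[K] w
  coassoc : ∀ w : carrier, TensorProduct.assoc K N.Coord N.Coord carrier
    (N.comul.rTensor carrier (coact w)) = coact.lTensor N.Coord (coact w)

attribute [instance] LeftSupercomodule.addCommGroup LeftSupercomodule.module
  LeftSupercomodule.decomposition

variable {N}

/-- Even morphisms of left supercomodules. -/
structure LeftSupercomodule.Hom (V W : N.LeftSupercomodule) : Type u where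
  lin : V.carrier →ₗ[K] W.carrier
  even : ∀ (i : ZMod 2) (v : V.carrier), v ∈ V.gr i → lin v ∈ W.gr i
  coact_comp : ∀ v : V.carrier, W.coact (lin v) = lin.lTensor N.Coord (V.coact v)

variable (N)

/-- The right `K[N]`-supercomodule structure `K[G] → K[G] ⊗ K[N]` of `K[G]`. -/
def rightCoact : G.alg.carrier →ₗ[K] G.alg.carrier ⊗[K] N.Coord :=
  N.res.lTensor G.alg.carrier ∘ₗ Coalgebra.comul

variable {N}

/-- The cotensor product `K[G] □ W` over `K[N]`, that is the set of `x ∈ K[G] ⊗ W` with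
`(τ ⊗ id)(x) = (id ⊗ τ_W)(x)`, where `τ` is the right coaction of `K[N]` on `K[G]`. -/
def cotensor (W : N.LeftSupercomodule) : Submodule K (G.alg.carrier ⊗[K] W.carrier) :=
  LinearMap.eqLocus
    ((TensorProduct.assoc K G.alg.carrier N.Coord W.carrier).toLinearMap ∘ₗ
      N.rightCoact.rTensor W.carrier)
    (W.coact.lTensor G.alg.carrier)

/-- Functoriality of the cotensor product: the restriction of `id ⊗ f`. -/
def cotensorMap {V W : N.LeftSupercomodule} (f : V.Hom W) : cotensor V →ₗ[K] cotensor W :=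
  (f.lin.lTensor G.alg.carrier).restrict (fun x hx => by
    have hx' : TensorProduct.assoc K G.alg.carrier N.Coord V.carrier
      (N.rightCoact.rTensor V.carrier x) = V.coact.lTensor G.alg.carrier x := hx
    have h1 : ∀ x : G.alg.carrier ⊗[K] V.carrier,
        TensorProduct.assoc K G.alg.carrier N.Coord W.carrier
          (N.rightCoact.rTensor W.carrier (f.lin.lTensor G.alg.carrier x)) =
        (f.lin.lTensor N.Coord).lTensor G.alg.carrier
          (TensorProduct.assoc K G.alg.carrier N.Coord V.carrier
            (N.rightCoact.rTensor V.carrier x)) := by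
      intro x
      induction x with
      | zero => simp
      | add x y hx hy => simp only [map_add, hx, hy]
      | tmul a v =>
        simp only [LinearMap.lTensor_tmul, LinearMap.rTensor_tmul]
        generalize N.rightCoact a = t
        induction t with
        | zero => simp
        | add x y hx hy => simp only [map_add, TensorProduct.add_tmul, hx, hy]
        | tmul a v => simp
    have h2 : W.coact.lTensor G.alg.carrier (f.lin.lTensor G.alg.carrier x) =
        (f.lin.lTensor N.Coord).lTensor G.alg.carrier (V.coact.lTensor G.alg.carrier x) := by
      rw [← LinearMap.comp_apply, ← LinearMap.lTensor_comp, ← LinearMap.comp_apply (f :=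
        (f.lin.lTensor N.Coord).lTensor G.alg.carrier), ← LinearMap.lTensor_comp]
      congr 2
      ext v
      exact f.coact_comp v
    change TensorProduct.assoc K G.alg.carrier N.Coord W.carrier
      (N.rightCoact.rTensor W.carrier (f.lin.lTensor G.alg.carrier x)) =
        W.coact.lTensor G.alg.carrier (f.lin.lTensor G.alg.carrier x)
    rw [h1, h2, hx'])

variable (N)

/-- `N` is faithfully exact in `G`: the right `K[N]`-supercomodule `K[G]` is faithfully coflat,
that is a sequence `V' → V → V''` of left `K[N]`-supercomodules is exact if and only if
`K[G] □ V' → K[G] □ V → K[G] □ V''` is exact. -/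
def IsFaithfullyExact : Prop :=
  ∀ (V' V V'' : N.LeftSupercomodule) (f : V'.Hom V) (g : V.Hom V''),
    Function.Exact f.lin g.lin ↔ Function.Exact (cotensorMap f) (cotensorMap g)

end ClosedSub

end AffineSupergroup

/-! ### Faithful flatness and coverings -/

/-- Right supermodules over a commutative superalgebra `R`. -/
structure RightSupermodule (R : SAlg K) : Type (u + 1) where
  carrier : Type u
  [addCommGroup : AddCommGroup carrier]
  [moduleK : Module K carrier]
  [module : Module R.carrierᵐᵒᵖ carrier]
  [tower : IsScalarTower K R.carrierᵐᵒᵖ carrier]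
  gr : ZMod 2 → Submodule K carrier
  [decomposition : DirectSum.Decomposition gr]
  smul_mem : ∀ (i j : ZMod 2) (r : R.carrier) (x : carrier), r ∈ R.gr i → x ∈ gr j →
    MulOpposite.op r • x ∈ gr (i + j)

attribute [instance] RightSupermodule.addCommGroup RightSupermodule.moduleK
  RightSupermodule.module RightSupermodule.tower RightSupermodule.decomposition

/-- Even morphisms of right supermodules. -/
structure RightSupermodule.Hom {R : SAlg K} (X Y : RightSupermodule R) : Type u where
  lin : X.carrier →ₗ[K] Y.carrier
  map_smul : ∀ (r : R.carrierᵐᵒᵖ) (x : X.carrier), lin (r • x) = r • lin x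
  even : ∀ (i : ZMod 2) (x : X.carrier), x ∈ X.gr i → lin x ∈ Y.gr i

section Flat

variable {R : SAlg K} {Y : Type u} [AddCommGroup Y] [Module K Y]

/-- The relations `x r ⊗ y = x ⊗ r y` defining `X ⊗_R Y` as a quotient of `X ⊗_K Y`, where the
left `R`-module structure of `Y` is given by `act`. -/
def tensorRel (X : RightSupermodule R) (act : R.carrier →ₐ[K] Module.End K Y) :
    Submodule K (X.carrier ⊗[K] Y) :=
  Submodule.span K {t | ∃ (x : X.carrier) (r : R.carrier) (y : Y),
    t = (MulOpposite.op r • x) ⊗ₜ[K] y - x ⊗ₜ[K] act r y}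

/-- The map `X ⊗_R Y → X' ⊗_R Y` induced by `f : X → X'`. -/
def tensorMap {X X' : RightSupermodule R} (f : X.Hom X')
    (act : R.carrier →ₐ[K] Module.End K Y) :
    ((X.carrier ⊗[K] Y) ⧸ tensorRel X act) →ₗ[K] ((X'.carrier ⊗[K] Y) ⧸ tensorRel X' act) :=
  Submodule.mapQ _ _ (f.lin.rTensor Y) (by
    refine Submodule.span_le.2 ?_
    rintro _ ⟨x, r, y, rfl⟩
    refine Submodule.subset_span ⟨f.lin x, r, y, ?_⟩
    rw [map_sub, LinearMap.rTensor_tmul, LinearMap.rTensor_tmul, f.map_smul])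

/-- The left `R`-module `Y` is faithfully flat: a sequence `X' → X → X''` of right
`R`-supermodules is exact if and only if `X' ⊗_R Y → X ⊗_R Y → X'' ⊗_R Y` is exact. -/
def IsFaithfullyFlat (act : R.carrier →ₐ[K] Module.End K Y) : Prop :=
  ∀ (X' X X'' : RightSupermodule R) (f : X'.Hom X) (g : X.Hom X''),
    Function.Exact f.lin g.lin ↔ Function.Exact (tensorMap f act) (tensorMap g act)

end Flat

/-- Finite families of `R`-superalgebras. -/
structure SAlg.Family (R : SAlg K) : Type (u + 1) where
  n : ℕ
  alg : Fin n → SAlg K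
  map : ∀ i, R ⟶ alg i

/-- A faithfully flat covering of `R`: a finite family `R_1, …, R_n` of `R`-superalgebras such
that the `R`-supermodule `R_1 × ⋯ × R_n` is faithfully flat. -/
def SAlg.Family.IsFF {R : SAlg K} (F : R.Family) : Prop :=
  IsFaithfullyFlat (R := R) (Y := ∀ i, (F.alg i).carrier)
    ((Algebra.lmul K (∀ i, (F.alg i).carrier)).comp (AlgHom.pi fun i => (F.map i).toAlgHom))

/-- `P`, with the elements `t` and `z`, is the free commutative `R`-superalgebra
`R[t_1, …, t_m | z_1, …, z_n]` on even generators `t_i` and odd generators `z_j`. -/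
def IsFreeSuperalgebra {R P : SAlg K} (ι : R ⟶ P) {m n : ℕ} (t : Fin m → P.carrier)
    (z : Fin n → P.carrier) : Prop :=
  (∀ i, t i ∈ P.gr 0) ∧ (∀ j, z j ∈ P.gr 1) ∧
    ∀ (S : SAlg K) (f : R ⟶ S) (t' : Fin m → S.carrier) (z' : Fin n → S.carrier),
      (∀ i, t' i ∈ S.gr 0) → (∀ j, z' j ∈ S.gr 1) →
      ∃! g : P ⟶ S, ι ≫ g = f ∧ (∀ i, g.toAlgHom (t i) = t' i) ∧
        (∀ j, g.toAlgHom (z j) = z' j)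

/-- The `R`-superalgebra `S` is finitely presented: it is the quotient of a free commutative
`R`-superalgebra `R[m|n]` by a finitely generated superideal. -/
def IsFinitelyPresented {R S : SAlg K} (f : R ⟶ S) : Prop :=
  ∃ (m n : ℕ) (P : SAlg K) (ι : R ⟶ P) (t : Fin m → P.carrier) (z : Fin n → P.carrier)
    (p : P ⟶ S), IsFreeSuperalgebra ι t z ∧ ι ≫ p = f ∧ Function.Surjective p.toAlgHom ∧
      (RingHom.ker p.toAlgHom).FG

/-- A faithfully flat covering by finitely presented superalgebras. -/
def SAlg.Family.IsFppf {R : SAlg K} (F : R.Family) : Prop :=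
  F.IsFF ∧ ∀ i, IsFinitelyPresented (F.map i)

/-! ### Sheaves -/

/-- The `K`-functor `X` satisfies the sheaf condition for the family `F`: the diagram
`X(R) → ∏ X(R_i) ⇉ ∏ X(R_i ⊗_R R_j)` is exact. As `R_i ⊗_R R_j` is the pushout of `R_i` and `R_j`
over `R`, two sections agree on it if and only if they agree on every commutative superalgebra
`T` with morphisms from `R_i` and `R_j` that agree on `R`. -/
def SheafCondition (X : SAlg K ⥤ Type u) {R : SAlg K} (F : R.Family) : Prop :=
  ∀ x : ∀ i, X.obj (F.alg i),
    (∀ (i j : Fin F.n) (T : SAlg K) (g : F.alg i ⟶ T) (h : F.alg j ⟶ T),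
      F.map i ≫ g = F.map j ≫ h → X.map g (x i) = X.map h (x j)) →
    ∃! y : X.obj R, ∀ i, X.map (F.map i) y = x i

/-- Dur `K`-sheaves: sheaves for faithfully flat coverings. -/
def IsDurSheaf (X : SAlg K ⥤ Type u) : Prop :=
  ∀ (R : SAlg K) (F : R.Family), F.IsFF → SheafCondition X F

/-- `K`-sheaves: sheaves for fppf coverings. -/
def IsFppfSheaf (X : SAlg K ⥤ Type u) : Prop :=
  ∀ (R : SAlg K) (F : R.Family), F.IsFppf → SheafCondition X F

/-- `α : X → Y` exhibits `Y` as the dur `K`-sheaf associated with `X`. -/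
def IsAssociatedDurSheaf {X Y : SAlg K ⥤ Type u} (α : X ⟶ Y) : Prop :=
  IsDurSheaf Y ∧ ∀ Z : SAlg K ⥤ Type u, IsDurSheaf Z → ∀ h : X ⟶ Z, ∃! v : Y ⟶ Z, α ≫ v = h

/-- `α : X → Y` exhibits `Y` as the `K`-sheaf associated with `X`. -/
def IsAssociatedFppfSheaf {X Y : SAlg K ⥤ Type u} (α : X ⟶ Y) : Prop :=
  IsFppfSheaf Y ∧ ∀ Z : SAlg K ⥤ Type u, IsFppfSheaf Z → ∀ h : X ⟶ Z, ∃! v : Y ⟶ Z, α ≫ v = h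

end

end Super

/-! Write A for K[G], B for the image of φ^* (`Mor.sub`) and N for the kernel of φ. Everything rests
on A being faithfully flat over B on both sides. The strong form proved here is
`exists_projective_submodule`: every finite subset of A lies in a B-submodule M that has a finite
dual basis and carries a B-linear form M → B with value 1 at 1. Such local projectivity implies
faithful flatness (`IsLocallyProjective.exact_iff`), by contracting tensors with the forms.

Local projectivity is a homogeneity argument. Take M = BV for a finite-dimensional graded left
coideal V. Near the identity M is free: lifts of a basis of the fibre M/B⁺M generate M after
multiplication by an even s with ε(s) = 1 (Nakayama, with a substitute for the adjugate matrix).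
They are also independent up to a power of s, because functionals η on the fibre give B-linear maps
a ↦ ∑ a₁ η(a₂), whose matrix on the lifts is inverted up to s by the antipode
(`exists_traceSpan_eq_mul`). Hence the space of even t in B whose multiplication on M is a sum of
maps m ↦ f(m) m₀, with f a B-linear form, contains an element of counit 1. This space is stable
under translation by points. Translating by the generic point with values in the even part of A
modulo its nilradical produces an element that is 1 modulo odd and nilpotent elements
(`exists_toRed_eq_one`). That element is invertible, so 1 lies in the space and M is projective. The
same argument, applied to the values r(1) of forms r on M, gives a form with r(1) = 1. Points with
values in purely even algebras carry no signs, and they suffice because odd elements square to zero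
when 2 is invertible.

Faithful coflatness follows from the translation map a ⊗ c ↦ a S(c₁) ⊗ c₂ from A ⊗ K[N] to A ⊗_B A.
Combined with flatness it yields an isomorphism A ⊗_B (A □ W) ≅ A ⊗ W, natural in the
K[N]-supercomodule W. Both A ⊗_B − and A ⊗_K − preserve and reflect exactness, hence so does A □ −.

For the sheaf statements, Im φ is the affine superscheme of B, and affine superschemes are dur
sheaves by faithfully flat descent. The inclusion B → A is a covering, and two points of G with the
same image in H differ by a point of N. A morphism from the naive quotient to a sheaf Z is therefore
a section of Z over A with equal restrictions along any two maps out of A that agree on B; it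
descends to a unique section over B, which by Yoneda is a morphism Im φ → Z. In the algebraic case
the covering is fppf, since finitely generated superalgebras are noetherian. -/

namespace Super

noncomputable section

variable {K : Type u} [Field K]

/-! ### Parity in commutative superalgebras -/

namespace SAlg

variable (A : SAlg K)

/-- The projection of a superalgebra onto its component of degree `i`. -/
def proj (i : ZMod 2) : A.carrier →ₗ[K] A.carrier := GradedAlgebra.proj A.gr i

variable {A}

theorem proj_mem (i : ZMod 2) (a : A.carrier) : A.proj i a ∈ A.gr i := SetLike.coe_mem _

theorem proj_of_mem {i : ZMod 2} {a : A.carrier} (h : a ∈ A.gr i) : A.proj i a = a :=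
  DirectSum.decompose_of_mem_same _ h

theorem proj_of_mem_ne {i j : ZMod 2} {a : A.carrier} (h : a ∈ A.gr i) (hij : i ≠ j) :
    A.proj j a = 0 :=
  DirectSum.decompose_of_mem_ne _ h hij

theorem proj_one_of_even {a : A.carrier} (h : a ∈ A.gr 0) : A.proj 1 a = 0 :=
  proj_of_mem_ne h zero_ne_one

theorem proj_zero_of_odd {a : A.carrier} (h : a ∈ A.gr 1) : A.proj 0 a = 0 :=
  proj_of_mem_ne h one_ne_zero

theorem proj_add_proj (a : A.carrier) : A.proj 0 a + A.proj 1 a = a := A.even_add_odd a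

theorem one_mem_even : (1 : A.carrier) ∈ A.gr 0 := SetLike.GradedOne.one_mem

theorem mul_mem {i j : ZMod 2} {a b : A.carrier} (ha : a ∈ A.gr i) (hb : b ∈ A.gr j) :
    a * b ∈ A.gr (i + j) := SetLike.GradedMul.mul_mem ha hb

theorem even_mul_even {a b : A.carrier} (ha : a ∈ A.gr 0) (hb : b ∈ A.gr 0) :
    a * b ∈ A.gr 0 := mul_mem ha hb

theorem even_mul_odd {a b : A.carrier} (ha : a ∈ A.gr 0) (hb : b ∈ A.gr 1) :
    a * b ∈ A.gr 1 := mul_mem ha hb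

theorem odd_mul_even {a b : A.carrier} (ha : a ∈ A.gr 1) (hb : b ∈ A.gr 0) :
    a * b ∈ A.gr 1 := mul_mem ha hb

theorem odd_mul_odd {a b : A.carrier} (ha : a ∈ A.gr 1) (hb : b ∈ A.gr 1) :
    a * b ∈ A.gr 0 := mul_mem ha hb

theorem proj_map {B : SAlg K} (f : A ⟶ B) (i : ZMod 2) (a : A.carrier) :
    B.proj i (f.toAlgHom a) = f.toAlgHom (A.proj i a) := decompose_map f a i

theorem even_comm {a : A.carrier} (ha : a ∈ A.gr 0) (b : A.carrier) : a * b = b * a := by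
  rw [← proj_add_proj b, mul_add, add_mul, A.supercomm 0 0 _ _ ha (proj_mem 0 b),
    A.supercomm 0 1 _ _ ha (proj_mem 1 b)]
  simp

theorem odd_anticomm {a b : A.carrier} (ha : a ∈ A.gr 1) (hb : b ∈ A.gr 1) :
    a * b = -(b * a) := by
  rw [A.supercomm 1 1 _ _ ha hb]
  simp

theorem odd_mul_self (hK : (2 : K) ≠ 0) {a : A.carrier} (ha : a ∈ A.gr 1) : a * a = 0 := by
  have h := odd_anticomm ha ha
  have h2 : (2 : K) • (a * a) = 0 := by rw [two_smul]; exact add_eq_zero_iff_eq_neg.2 h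
  exact (smul_eq_zero.1 h2).resolve_left hK

theorem proj_zero_mul (a b : A.carrier) :
    A.proj 0 (a * b) = A.proj 0 a * A.proj 0 b + A.proj 1 a * A.proj 1 b := by
  conv_lhs => rw [← proj_add_proj a, ← proj_add_proj b]
  simp only [mul_add, add_mul, map_add]
  rw [proj_of_mem (even_mul_even (proj_mem 0 a) (proj_mem 0 b)),
    proj_of_mem (odd_mul_odd (proj_mem 1 a) (proj_mem 1 b)),
    proj_zero_of_odd (odd_mul_even (proj_mem 1 a) (proj_mem 0 b)),
    proj_zero_of_odd (even_mul_odd (proj_mem 0 a) (proj_mem 1 b))]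
  abel

theorem proj_one_mul (a b : A.carrier) :
    A.proj 1 (a * b) = A.proj 0 a * A.proj 1 b + A.proj 1 a * A.proj 0 b := by
  conv_lhs => rw [← proj_add_proj a, ← proj_add_proj b]
  simp only [mul_add, add_mul, map_add]
  rw [proj_one_of_even (even_mul_even (proj_mem 0 a) (proj_mem 0 b)),
    proj_one_of_even (odd_mul_odd (proj_mem 1 a) (proj_mem 1 b)),
    proj_of_mem (odd_mul_even (proj_mem 1 a) (proj_mem 0 b)),
    proj_of_mem (even_mul_odd (proj_mem 0 a) (proj_mem 1 b))]
  abel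

variable (A) in
/-- The parity involution. -/
def parity : A.carrier →ₗ[K] A.carrier := A.proj 0 - A.proj 1

theorem parity_apply (a : A.carrier) : A.parity a = A.proj 0 a - A.proj 1 a := rfl

theorem parity_even {a : A.carrier} (h : a ∈ A.gr 0) : A.parity a = a := by
  rw [parity_apply, proj_of_mem h, proj_one_of_even h, sub_zero]

theorem parity_odd {a : A.carrier} (h : a ∈ A.gr 1) : A.parity a = -a := by
  rw [parity_apply, proj_of_mem h, proj_zero_of_odd h, zero_sub]

theorem parity_mul (a b : A.carrier) : A.parity (a * b) = A.parity a * A.parity b := by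
  simp only [parity_apply, proj_zero_mul, proj_one_mul]
  noncomm_ring

theorem parity_map {B : SAlg K} (f : A ⟶ B) (a : A.carrier) :
    B.parity (f.toAlgHom a) = f.toAlgHom (A.parity a) := by
  simp only [parity_apply, proj_map, map_sub]

theorem odd_mul {y : A.carrier} (hy : y ∈ A.gr 1) (b : A.carrier) : y * b = A.parity b * y := by
  conv_lhs => rw [← proj_add_proj b]
  rw [mul_add, odd_anticomm hy (proj_mem 1 b), ← even_comm (proj_mem 0 b), parity_apply, sub_mul,
    sub_eq_add_neg]

/-- Multiplication in the graded tensor product, without signs. -/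
theorem tmul_mul_tmul (A B : SAlg K) (x a : A.carrier) (y b : B.carrier) :
    GradedTensorProduct.of K A.gr B.gr (x ⊗ₜ y) * GradedTensorProduct.of K A.gr B.gr (a ⊗ₜ b) =
      GradedTensorProduct.of K A.gr B.gr
        ((x * a) ⊗ₜ (B.proj 0 y * b) + (x * A.parity a) ⊗ₜ (B.proj 1 y * b)) := by
  have key : ∀ (j k : ZMod 2) (y' : B.carrier) (a' : A.carrier), y' ∈ B.gr j → a' ∈ A.gr k →
      GradedTensorProduct.of K A.gr B.gr (x ⊗ₜ y') * GradedTensorProduct.of K A.gr B.gr (a' ⊗ₜ b) =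
      ((-1 : ℤˣ) ^ (j * k)) • GradedTensorProduct.of K A.gr B.gr ((x * a') ⊗ₜ (y' * b)) :=
    fun j k y' a' hy ha =>
      GradedTensorProduct.tmul_coe_mul_coe_tmul (R := K) A.gr B.gr x ⟨y', hy⟩ ⟨a', ha⟩ b
  have e1 : GradedTensorProduct.of K A.gr B.gr (x ⊗ₜ y) =
      GradedTensorProduct.of K A.gr B.gr (x ⊗ₜ B.proj 0 y) +
      GradedTensorProduct.of K A.gr B.gr (x ⊗ₜ B.proj 1 y) := by
    rw [← map_add, ← TensorProduct.tmul_add, proj_add_proj]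
  have e2 : GradedTensorProduct.of K A.gr B.gr (a ⊗ₜ b) =
      GradedTensorProduct.of K A.gr B.gr (A.proj 0 a ⊗ₜ b) +
      GradedTensorProduct.of K A.gr B.gr (A.proj 1 a ⊗ₜ b) := by
    rw [← map_add, ← TensorProduct.add_tmul, proj_add_proj]
  rw [e1, e2]
  simp only [mul_add, add_mul]
  rw [key 0 0 _ _ (proj_mem 0 y) (proj_mem 0 a), key 1 0 _ _ (proj_mem 1 y) (proj_mem 0 a),
    key 0 1 _ _ (proj_mem 0 y) (proj_mem 1 a), key 1 1 _ _ (proj_mem 1 y) (proj_mem 1 a)]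
  have e3 : (x * a) ⊗ₜ[K] (B.proj 0 y * b) = (x * A.proj 0 a) ⊗ₜ[K] (B.proj 0 y * b) +
      (x * A.proj 1 a) ⊗ₜ[K] (B.proj 0 y * b) := by
    rw [← TensorProduct.add_tmul, ← mul_add, proj_add_proj]
  rw [e3, parity_apply, mul_sub, TensorProduct.sub_tmul]
  simp only [map_add, map_sub, mul_zero, mul_one, uzpow_zero, one_smul, uzpow_one,
    Units.neg_smul]
  abel

/-! ### The even part -/

variable (A)

/-- The even part, a central commutative subalgebra. -/
def evenPart : Subalgebra K A.carrier where
  carrier := A.gr 0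
  mul_mem' ha hb := even_mul_even ha hb
  add_mem' ha hb := add_mem ha hb
  algebraMap_mem' r := SetLike.algebraMap_mem_graded A.gr r

instance : CommRing A.evenPart :=
  { (inferInstance : Ring A.evenPart) with
    mul_comm := fun a b => Subtype.ext (even_comm a.2 b.1) }

variable {A}

theorem odd_mul_odd_sq (hK : (2 : K) ≠ 0) {a b : A.carrier} (ha : a ∈ A.gr 1) (hb : b ∈ A.gr 1) :
    (a * b) ^ 2 = 0 := by
  have : (a * b) ^ 2 = a * (b * a) * b := by noncomm_ring
  rw [this, odd_anticomm hb ha, mul_neg, ← mul_assoc, odd_mul_self hK ha]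
  simp

theorem odd_mul_odd_nilpotent (hK : (2 : K) ≠ 0) {a b : A.carrier} (ha : a ∈ A.gr 1)
    (hb : b ∈ A.gr 1) : (⟨a * b, odd_mul_odd ha hb⟩ : A.evenPart) ∈ nilradical A.evenPart :=
  ⟨2, Subtype.ext (odd_mul_odd_sq hK ha hb)⟩

variable (A) in
/-- The projection onto the even part. -/
def toEven : A.carrier →ₗ[K] A.evenPart :=
  (A.proj 0).codRestrict (Subalgebra.toSubmodule A.evenPart) (fun a => proj_mem 0 a)

variable (A) in
/-- The reduced commutative algebra associated with a superalgebra. -/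
abbrev Red : Type u := A.evenPart ⧸ nilradical A.evenPart

variable (A) in
/-- The canonical projection onto the associated reduced algebra. -/
def toRed (hK : (2 : K) ≠ 0) : A.carrier →ₐ[K] A.Red :=
  AlgHom.ofLinearMap ((Ideal.Quotient.mkₐ K (nilradical A.evenPart)).toLinearMap ∘ₗ A.toEven)
    (by
      have h : A.toEven 1 = 1 := Subtype.ext (proj_of_mem one_mem_even)
      simp only [LinearMap.comp_apply, h, AlgHom.toLinearMap_apply, map_one])
    (fun a b => by
      have h : A.toEven (a * b) = A.toEven a * A.toEven b +
          ⟨A.proj 1 a * A.proj 1 b, odd_mul_odd (proj_mem 1 a) (proj_mem 1 b)⟩ :=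
        Subtype.ext (proj_zero_mul a b)
      simp only [LinearMap.comp_apply, h, AlgHom.toLinearMap_apply, map_add, map_mul]
      rw [Ideal.Quotient.mkₐ_eq_mk, Ideal.Quotient.eq_zero_iff_mem.2
        (odd_mul_odd_nilpotent hK (proj_mem 1 a) (proj_mem 1 b)), add_zero])

theorem toRed_apply (hK : (2 : K) ≠ 0) (a : A.carrier) :
    A.toRed hK a = Ideal.Quotient.mk _ (A.toEven a) := rfl

theorem toRed_proj (hK : (2 : K) ≠ 0) (a : A.carrier) :
    A.toRed hK (A.proj 0 a) = A.toRed hK a := by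
  rw [toRed_apply, toRed_apply]
  congr 1
  exact Subtype.ext (proj_of_mem (proj_mem 0 a))

theorem toRed_odd (hK : (2 : K) ≠ 0) {a : A.carrier} (h : a ∈ A.gr 1) : A.toRed hK a = 0 := by
  have : A.toEven a = 0 := Subtype.ext (proj_zero_of_odd h)
  rw [toRed_apply, this, map_zero]

/-- Elements that map to `1` in the reduced algebra are units; the inverse can be formed in every
subalgebra that contains the homogeneous components. -/
theorem exists_inv_of_toRed_eq_one (hK : (2 : K) ≠ 0) (B : Subalgebra K A.carrier)
    {a : A.carrier} (h0 : A.proj 0 a ∈ B) (h1 : A.proj 1 a ∈ B) (ha : A.toRed hK a = 1) :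
    ∃ b ∈ B, a * b = 1 ∧ (a ∈ A.gr 0 → b ∈ A.gr 0) := by
  have hn : IsNilpotent (A.toEven a - 1) := by
    have : Ideal.Quotient.mk (nilradical A.evenPart) (A.toEven a) = Ideal.Quotient.mk _ 1 := ha
    exact Ideal.Quotient.eq.1 this
  obtain ⟨n, hn⟩ := hn
  have hn' : (A.proj 0 a - 1) ^ n = 0 := congrArg Subtype.val hn
  set x := A.proj 0 a with hx
  set z := A.proj 1 a with hz
  have hxz : x * z = z * x := even_comm (proj_mem 0 a) z
  -- the geometric series
  let c : A.carrier := ∑ i ∈ Finset.range n, (1 - x) ^ i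
  have hcB : c ∈ B := sum_mem fun i _ => pow_mem (sub_mem (one_mem _) h0) _
  have hc : x * c = 1 := by
    have h := mul_neg_geom_sum (1 - x) n
    rw [sub_sub_cancel, ← neg_sub x 1, neg_pow, hn', mul_zero, sub_zero] at h
    rw [neg_sub] at h
    exact h
  have hce : c ∈ A.gr 0 := by
    have : c ∈ A.evenPart := sum_mem fun i _ =>
      pow_mem (sub_mem (one_mem _) (show A.proj 0 a ∈ A.evenPart from proj_mem 0 a)) _
    exact this
  -- With a = x + z, x central and z² = 0, one has a(x − z) = x². Since `c` inverts x, this makes (x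
  -- − z)c² an inverse of a.
  refine ⟨(x - z) * (c * c), B.mul_mem (sub_mem h0 h1) (B.mul_mem hcB hcB), ?_, fun h => ?_⟩
  · have e : a * (x - z) = x * x := by
      conv_lhs => rw [← proj_add_proj a, ← hx, ← hz]
      have : (x + z) * (x - z) = x * x - z * z + (z * x - x * z) := by noncomm_ring
      rw [this, hxz, odd_mul_self hK (proj_mem 1 a)]
      simp
    rw [← mul_assoc, e, mul_assoc, ← mul_assoc x c c, hc, one_mul, hc]
  · have : z = 0 := proj_one_of_even h
    rw [this, sub_zero]
    exact even_mul_even (proj_mem 0 a) (even_mul_even hce hce)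

/-! ### Matrices over commutative superalgebras -/

/-- The element x = y − (y − x) divides y^k − (y − x)^k for all k, and the second power vanishes for
large k. -/
theorem dvd_pow_of_sub_mem_nilradical {R : Type*} [CommRing R] {x y : R}
    (h : y - x ∈ nilradical R) : ∃ k, x ∣ y ^ k := by
  obtain ⟨k, hk⟩ := h
  refine ⟨k, ?_⟩
  have h2 := sub_dvd_pow_sub_pow y (y - x) k
  rwa [hk, sub_zero, sub_sub_cancel] at h2

theorem det_sub_mem_nilradical {R : Type*} [CommRing R] {n : ℕ} (P Q : Matrix (Fin n) (Fin n) R)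
    (h : ∀ i j, P i j - Q i j ∈ nilradical R) : P.det - Q.det ∈ nilradical R := by
  rw [← Ideal.Quotient.eq, RingHom.map_det, RingHom.map_det]
  congr 1
  ext i j
  exact Ideal.Quotient.eq.2 (h i j)

variable {n : ℕ}

/-- The even part of a matrix. -/
def evenMat (P : Matrix (Fin n) (Fin n) A.carrier) : Matrix (Fin n) (Fin n) A.evenPart :=
  P.map A.toEven

/-- The inclusion of even matrices. -/
def coeMat : Matrix (Fin n) (Fin n) A.evenPart →+* Matrix (Fin n) (Fin n) A.carrier :=
  A.evenPart.val.toRingHom.mapMatrix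

theorem coeMat_apply (P : Matrix (Fin n) (Fin n) A.evenPart) (i j : Fin n) :
    coeMat P i j = (P i j : A.carrier) := rfl

/-- A square matrix of odd elements has an even square with nilpotent entries. -/
theorem odd_matrix_sq (hK : (2 : K) ≠ 0) (P Q : Matrix (Fin n) (Fin n) A.carrier)
    (hP : ∀ i j, P i j ∈ A.gr 1) (hQ : ∀ i j, Q i j ∈ A.gr 1) :
    ∃ N : Matrix (Fin n) (Fin n) A.evenPart, coeMat N = P * Q ∧
      ∀ i j, N i j ∈ nilradical A.evenPart := by
  refine ⟨Matrix.of fun i j => ∑ k, ⟨P i k * Q k j, odd_mul_odd (hP i k) (hQ k j)⟩, ?_, fun i j => ?_⟩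
  · ext i j
    rw [coeMat_apply, Matrix.mul_apply, Matrix.of_apply]
    exact map_sum A.evenPart.val _ _
  · rw [Matrix.of_apply]
    exact sum_mem fun k _ => odd_mul_odd_nilpotent hK (hP i k) (hQ k j)

theorem coeMat_smul_one (d : A.evenPart) :
    coeMat (d • (1 : Matrix (Fin n) (Fin n) A.evenPart)) =
      (d : A.carrier) • (1 : Matrix (Fin n) (Fin n) A.carrier) := by
  ext i j
  rw [coeMat_apply, Matrix.smul_apply, Matrix.smul_apply, Matrix.one_apply, Matrix.one_apply]
  split_ifs <;> simp

/-- A one-sided adjugate for matrices over a commutative superalgebra, on both sides. -/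
theorem exists_superadjugate (hK : (2 : K) ≠ 0) (P : Matrix (Fin n) (Fin n) A.carrier) :
    (∃ (k : ℕ) (Q : Matrix (Fin n) (Fin n) A.carrier),
      Q * P = (((evenMat P).det ^ k : A.evenPart) : A.carrier) • 1) ∧
    (∃ (k : ℕ) (Q : Matrix (Fin n) (Fin n) A.carrier),
      P * Q = (((evenMat P).det ^ k : A.evenPart) : A.carrier) • 1) := by
  set P₀ := evenMat P with hP₀
  set P₁ : Matrix (Fin n) (Fin n) A.carrier := P.map (A.proj 1) with hP₁
  have hP : P = coeMat P₀ + P₁ := by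
    ext i j
    exact (proj_add_proj (P i j)).symm
  set d := P₀.det with hd
  set D : Matrix (Fin n) (Fin n) A.carrier := coeMat (d • 1) with hD
  have hDc : ∀ M : Matrix (Fin n) (Fin n) A.carrier, D * M = M * D := by
    intro M
    rw [hD, coeMat_smul_one]
    ext i j
    simp only [Matrix.mul_apply, Matrix.smul_apply, Matrix.one_apply, smul_eq_mul, mul_ite,
      mul_one, mul_zero, ite_mul, zero_mul, Finset.sum_ite_eq, Finset.mem_univ, if_true,
      Finset.sum_ite_eq']
    exact even_comm d.2 _
  -- the common part: if `γ` is odd, then `D² - γ²` has an adjugate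
  have fin : ∀ γ : Matrix (Fin n) (Fin n) A.carrier, (∀ i j, γ i j ∈ A.gr 1) →
      ∃ (k : ℕ) (Q : Matrix (Fin n) (Fin n) A.carrier),
        Q * (D * D - γ * γ) = ((d ^ k : A.evenPart) : A.carrier) • 1 ∧
        (D * D - γ * γ) * Q = ((d ^ k : A.evenPart) : A.carrier) • 1 := by
    intro γ hγ
    obtain ⟨N, hN, hN'⟩ := odd_matrix_sq hK γ γ hγ hγ
    set E : Matrix (Fin n) (Fin n) A.evenPart := (d • 1) * (d • 1) - N with hE
    have hE' : D * D - γ * γ = coeMat E := by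
      rw [hE, map_sub, map_mul, hN]
    -- `E` is d²·1 up to nilpotent entries, so its determinant is d^(2n) up to a nilpotent. It
    -- therefore divides a power of d^(2n), and a multiple of the ordinary adjugate of `E` does the
    -- job.
    have hdet : (d ^ (2 * n)) - E.det ∈ nilradical A.evenPart := by
      have h := det_sub_mem_nilradical ((d • 1) * (d • 1)) E (fun i j => by
        rw [hE, Matrix.sub_apply, sub_sub_cancel]
        exact hN' i j)
      have e : ((d • (1 : Matrix (Fin n) (Fin n) A.evenPart)) * (d • 1)).det = d ^ (2 * n) := by
        rw [Matrix.det_mul, Matrix.det_smul, Matrix.det_one, Fintype.card_fin]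
        ring
      rwa [e] at h
    obtain ⟨k, c, hc⟩ := dvd_pow_of_sub_mem_nilradical hdet
    refine ⟨2 * n * k, coeMat (c • E.adjugate), ?_, ?_⟩
    · rw [hE', ← map_mul, Matrix.smul_mul, Matrix.adjugate_mul, smul_smul, mul_comm c, ← hc,
        ← pow_mul, coeMat_smul_one]
    · rw [hE', ← map_mul, Matrix.mul_smul, Matrix.mul_adjugate, smul_smul, mul_comm c, ← hc,
        ← pow_mul, coeMat_smul_one]
  have hadj : ∀ i j, P₁ i j ∈ A.gr 1 := fun i j => proj_mem 1 _
  constructor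
  · have h1 : coeMat P₀.adjugate * P = D + coeMat P₀.adjugate * P₁ := by
      rw [hP, mul_add, ← map_mul, Matrix.adjugate_mul]
    set γ := coeMat P₀.adjugate * P₁ with hγ
    have hγo : ∀ i j, γ i j ∈ A.gr 1 := fun i j => by
      rw [hγ, Matrix.mul_apply]
      exact sum_mem fun k _ => even_mul_odd (P₀.adjugate i k).2 (hadj k j)
    obtain ⟨k, Q, hQ, -⟩ := fin γ hγo
    -- The ordinary adjugate of the even part turns P into D + γ with γ odd. As D is central, (D −
    -- γ)(D + γ) = D² − γ², which is an even matrix.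
    refine ⟨k, Q * (D - γ) * coeMat P₀.adjugate, ?_⟩
    rw [mul_assoc, h1, mul_assoc, ← hQ]
    congr 1
    have : (D - γ) * (D + γ) = D * D - γ * γ + (D * γ - γ * D) := by noncomm_ring
    rw [this, hDc γ, sub_self, add_zero]
  · have h1 : P * coeMat P₀.adjugate = D + P₁ * coeMat P₀.adjugate := by
      rw [hP, add_mul, ← map_mul, Matrix.mul_adjugate]
    set γ := P₁ * coeMat P₀.adjugate with hγ
    have hγo : ∀ i j, γ i j ∈ A.gr 1 := fun i j => by
      rw [hγ, Matrix.mul_apply]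
      exact sum_mem fun k _ => odd_mul_even (hadj i k) (P₀.adjugate k j).2
    obtain ⟨k, Q, -, hQ⟩ := fin γ hγo
    refine ⟨k, coeMat P₀.adjugate * ((D - γ) * Q), ?_⟩
    rw [← mul_assoc, h1, ← mul_assoc, ← hQ]
    congr 1
    have : (D + γ) * (D - γ) = D * D - γ * γ + (γ * D - D * γ) := by noncomm_ring
    rw [this, hDc γ, sub_self, add_zero]

/-- If `Y X = s` for square matrices and an even scalar `s`, then `X` is right invertible up to a
power of `s`. -/
theorem exists_right_inv_up_to_pow (hK : (2 : K) ≠ 0) (X Y : Matrix (Fin n) (Fin n) A.carrier)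
    (s : A.evenPart) (h : Y * X = (s : A.carrier) • 1) :
    ∃ (e : ℕ) (Z : Matrix (Fin n) (Fin n) A.carrier),
      X * Z = ((s ^ e : A.evenPart) : A.carrier) • 1 := by
  obtain ⟨k, Q, hQ⟩ := (exists_superadjugate hK X).2
  obtain ⟨N, hN, hN'⟩ := odd_matrix_sq hK (Y.map (A.proj 1)) (X.map (A.proj 1))
    (fun i j => proj_mem 1 _) (fun i j => proj_mem 1 _)
  -- The even part of the identity YX = s. The contribution of the odd parts is nilpotent, so det Y₀
  -- · det X₀ agrees with sⁿ up to a nilpotent and det X₀ divides a power of s. This absorbs the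
  -- scalar in the right adjugate of X.
  have h0 : evenMat Y * evenMat X + N = s • 1 := by
    ext i j
    have h1 := congrArg (fun M => A.proj 0 (M i j)) h
    have h2 := congrArg (fun M => M i j) hN
    simp only [coeMat_apply] at h2
    simp only [Matrix.mul_apply, map_sum, proj_zero_mul, Finset.sum_add_distrib] at h1 h2
    rw [Matrix.add_apply, Subalgebra.coe_add, h2, Matrix.mul_apply,
      AddSubmonoidClass.coe_finsetSum]
    refine h1.trans ?_
    rw [Matrix.smul_apply, Matrix.smul_apply, Matrix.one_apply, Matrix.one_apply]
    split_ifs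
    · simp [proj_of_mem s.2]
    · simp
  have hdet : s ^ n - (evenMat Y).det * (evenMat X).det ∈ nilradical A.evenPart := by
    have h1 := det_sub_mem_nilradical (s • 1) (evenMat Y * evenMat X) (fun i j => by
      rw [← h0, Matrix.add_apply, add_sub_cancel_left]
      exact hN' i j)
    rwa [Matrix.det_smul, Matrix.det_one, mul_one, Fintype.card_fin, Matrix.det_mul] at h1
  obtain ⟨l, hl⟩ := dvd_pow_of_sub_mem_nilradical hdet
  have hx : (evenMat X).det ^ k ∣ (s ^ (n * l * k) : A.evenPart) := by
    rw [pow_mul, pow_mul]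
    exact pow_dvd_pow_of_dvd ((dvd_mul_left _ _).trans hl) k
  obtain ⟨c, hc⟩ := hx
  refine ⟨n * l * k, Q * coeMat (c • 1), ?_⟩
  rw [← mul_assoc, hQ, ← coeMat_smul_one, ← coeMat_smul_one, ← map_mul, hc]
  congr 1
  rw [Matrix.smul_mul, one_mul, smul_smul]

end SAlg

end

end Super

namespace Super

noncomputable section

variable {K : Type u} [Field K]

/-! ### Slices of tensors -/

section Slice

variable {M N P : Type u} [AddCommGroup M] [Module K M] [AddCommGroup N] [Module K N]
  [AddCommGroup P] [Module K P]

/-- The slice map `x ⊗ y ↦ ξ(x) y`. -/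
def slice (ξ : M →ₗ[K] K) : M ⊗[K] N →ₗ[K] N :=
  (TensorProduct.lid K N).toLinearMap ∘ₗ ξ.rTensor N

@[simp]
theorem slice_tmul (ξ : M →ₗ[K] K) (x : M) (y : N) : slice ξ (x ⊗ₜ[K] y) = ξ x • y := by
  simp [slice]

theorem slice_lTensor (ξ : M →ₗ[K] K) (f : N →ₗ[K] P) (t : M ⊗[K] N) :
    slice ξ (f.lTensor M t) = f (slice ξ t) := by
  induction t with
  | zero => simp
  | add x y hx hy => simp only [map_add, hx, hy]
  | tmul x y => simp

/-- A tensor in `M' ⊗ N` is a sum of pure tensors whose second factors are slices. -/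
theorem exists_sum_slice (M' : Submodule K M) (t : M ⊗[K] N)
    (ht : t ∈ LinearMap.range (M'.subtype.rTensor N)) :
    ∃ (n : ℕ) (x : Fin n → M) (ξ : Fin n → M →ₗ[K] K), (∀ i, x i ∈ M') ∧
      t = ∑ i, x i ⊗ₜ[K] slice (ξ i) t := by
  classical
  obtain ⟨t, rfl⟩ := ht
  -- The coefficients of t in a basis of M' are slices, taken with the coordinate forms extended to
  -- M.
  let b := Module.Basis.ofVectorSpace K M'
  have hξ : ∀ i, ∃ ξ : M →ₗ[K] K, ξ ∘ₗ M'.subtype = b.coord i :=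
    fun i => LinearMap.exists_extend (b.coord i)
  choose ξ hξ using hξ
  set y := TensorProduct.equivFinsuppOfBasisLeft (N := N) b t with hy
  have hy' : ∀ i, y i = slice (ξ i) (M'.subtype.rTensor N t) := by
    intro i
    rw [hy, TensorProduct.equivFinsuppOfBasisLeft_apply]
    rw [← hξ i, slice, LinearMap.rTensor_comp]
    rfl
  have ht : t = y.sum fun i n => b i ⊗ₜ[K] n := by
    rw [← TensorProduct.equivFinsuppOfBasisLeft_symm_apply, hy, LinearEquiv.symm_apply_apply]
  let e := y.support.equivFin.symm
  refine ⟨y.support.card, fun i => b (e i).1, fun i => ξ (e i).1, fun i => (b _).2, ?_⟩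
  conv_lhs => rw [ht]
  simp only [← hy']
  rw [Finsupp.sum, map_sum, ← Finset.sum_coe_sort, ← e.sum_comp]
  rfl

/-- A tensor lies in `M ⊗ N'` if all its slices lie in `N'`. -/
theorem mem_range_lTensor_iff (N' : Submodule K N) (t : M ⊗[K] N) :
    t ∈ LinearMap.range (N'.subtype.lTensor M) ↔ ∀ ξ : M →ₗ[K] K, slice ξ t ∈ N' := by
  constructor
  · rintro ⟨t, rfl⟩ ξ
    rw [slice_lTensor]
    exact (slice ξ t).2
  · intro h
    obtain ⟨n, x, ξ, -, ht⟩ := exists_sum_slice ⊤ t (by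
      have : Function.Surjective ((⊤ : Submodule K M).subtype.rTensor N) :=
        LinearMap.rTensor_surjective N (fun x => ⟨⟨x, trivial⟩, rfl⟩)
      exact this t)
    rw [ht]
    exact sum_mem fun i _ => ⟨x i ⊗ₜ ⟨_, h (ξ i)⟩, by simp⟩

theorem mem_range_lTensor_of_tmul {N' : Submodule K N} (x : M) {y : N} (hy : y ∈ N') :
    x ⊗ₜ[K] y ∈ LinearMap.range (N'.subtype.lTensor M) := ⟨x ⊗ₜ ⟨y, hy⟩, by simp⟩

/-- Elements of `M ⊗ N'` are sums of pure tensors. -/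
theorem range_lTensor_eq_span (N' : Submodule K N) :
    LinearMap.range (N'.subtype.lTensor M) =
      Submodule.span K {t | ∃ (x : M) (y : N), y ∈ N' ∧ t = x ⊗ₜ[K] y} := by
  refine le_antisymm ?_ (Submodule.span_le.2 ?_)
  · rintro _ ⟨t, rfl⟩
    induction t with
    | zero => simp
    | add x y hx hy => rw [map_add]; exact add_mem hx hy
    | tmul x y => exact Submodule.subset_span ⟨x, y, y.2, by simp⟩
  · rintro _ ⟨x, y, hy, rfl⟩
    exact mem_range_lTensor_of_tmul x hy

/-- Elements of `M ⊗ N'`, in terms of a spanning family of `N'`. -/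
theorem exists_sum_of_mem_range_lTensor {ι : Type*} [Fintype ι] (v : ι → N) (t : M ⊗[K] N)
    (ht : t ∈ LinearMap.range ((Submodule.span K (Set.range v)).subtype.lTensor M)) :
    ∃ c : ι → M, t = ∑ j, c j ⊗ₜ[K] v j := by
  rw [range_lTensor_eq_span] at ht
  induction ht using Submodule.span_induction with
  | mem t ht =>
    obtain ⟨x, y, hy, rfl⟩ := ht
    obtain ⟨a, rfl⟩ := (Submodule.mem_span_range_iff_exists_fun K).1 hy
    exact ⟨fun j => a j • x, by simp only [TensorProduct.tmul_sum, TensorProduct.tmul_smul,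
      TensorProduct.smul_tmul']⟩
  | zero => exact ⟨0, by simp⟩
  | add x y _ _ hx hy =>
    obtain ⟨c, rfl⟩ := hx
    obtain ⟨c', rfl⟩ := hy
    exact ⟨c + c', by simp [TensorProduct.add_tmul, Finset.sum_add_distrib]⟩
  | smul a x _ hx =>
    obtain ⟨c, rfl⟩ := hx
    exact ⟨a • c, by simp [Finset.smul_sum, TensorProduct.smul_tmul']⟩

end Slice

namespace AffineSupergroup

/-! ### Left coideals of the coordinate superalgebra -/

section Coideal

variable (G : AffineSupergroup K)

/-- The counit as a morphism of algebras. -/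
def counitHom : G.alg.carrier →ₐ[K] K :=
  AlgHom.ofLinearMap Coalgebra.counit G.counit_one G.counit_mul

theorem counitHom_apply (a : G.alg.carrier) : G.counitHom a = Coalgebra.counit (R := K) a := rfl

theorem counit_proj (a : G.alg.carrier) : G.counitHom (G.alg.proj 0 a) = G.counitHom a := by
  conv_rhs => rw [← SAlg.proj_add_proj a, map_add, counitHom_apply _ (G.alg.proj 1 a),
    G.counit_odd _ (SAlg.proj_mem 1 a), add_zero]

variable {G}

/-- `V` is a left coideal: `δ(V) ⊆ K[G] ⊗ V`. -/
def IsLeftCoideal (V : Submodule K G.alg.carrier) : Prop :=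
  ∀ v ∈ V, Coalgebra.comul (R := K) v ∈ LinearMap.range (V.subtype.lTensor G.alg.carrier)

theorem range_lTensor_mono {V W : Submodule K G.alg.carrier} (h : V ≤ W) :
    LinearMap.range (V.subtype.lTensor G.alg.carrier) ≤
      LinearMap.range (W.subtype.lTensor G.alg.carrier) := by
  intro t ht
  rw [mem_range_lTensor_iff] at ht ⊢
  exact fun ξ => h (ht ξ)

theorem IsLeftCoideal.sup {V W : Submodule K G.alg.carrier} (hV : IsLeftCoideal V)
    (hW : IsLeftCoideal W) : IsLeftCoideal (V ⊔ W) := by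
  intro x hx
  obtain ⟨v, hv, w, hw, rfl⟩ := Submodule.mem_sup.1 hx
  rw [map_add]
  exact add_mem (range_lTensor_mono le_sup_left (hV v hv))
    (range_lTensor_mono le_sup_right (hW w hw))

/-- Every element lies in a finite-dimensional left coideal. -/
theorem exists_leftCoideal_mem (a : G.alg.carrier) : ∃ V : Submodule K G.alg.carrier,
    IsLeftCoideal V ∧ V.FG ∧ a ∈ V := by
  set δa := Coalgebra.comul (R := K) a with hδ
  -- The coideal consists of all slices (ξ ⊗ id)δ(a). Coassociativity makes it a coideal, finiteness
  -- of the sum δ(a) makes it finite-dimensional, and ξ = ε recovers a.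
  let L : (G.alg.carrier →ₗ[K] K) →ₗ[K] G.alg.carrier :=
    { toFun := fun ξ => slice ξ δa
      map_add' := fun ξ η => by
        simp only [slice, LinearMap.rTensor_add, LinearMap.comp_add, LinearMap.add_apply]
      map_smul' := fun c ξ => by
        simp only [slice, LinearMap.rTensor_smul, LinearMap.comp_smul, LinearMap.smul_apply,
          RingHom.id_apply] }
  refine ⟨LinearMap.range L, ?_, ?_, ⟨Coalgebra.counit, ?_⟩⟩
  · rintro _ ⟨ξ, rfl⟩
    rw [mem_range_lTensor_iff]
    intro η
    refine ⟨LinearMap.mul' K K ∘ₗ TensorProduct.map ξ η ∘ₗ Coalgebra.comul, ?_⟩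
    change slice _ δa = slice η (Coalgebra.comul (slice ξ δa))
    rw [← slice_lTensor, hδ, ← Coalgebra.coassoc_apply, ← hδ]
    generalize δa = t
    induction t with
    | zero => simp
    | add x y hx hy => simp only [map_add, hx, hy]
    | tmul x y =>
      rw [slice_tmul, LinearMap.rTensor_tmul, LinearMap.comp_apply, LinearMap.comp_apply]
      generalize Coalgebra.comul (R := K) x = s
      induction s with
      | zero => simp
      | add x y hx hy => simp only [map_add, TensorProduct.add_tmul, add_smul, hx, hy]
      | tmul x z =>
        rw [TensorProduct.assoc_tmul, slice_tmul, map_smul, slice_tmul, TensorProduct.map_tmul,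
          LinearMap.mul'_apply, mul_smul]
  · obtain ⟨n, x, ξ, -, ht⟩ := exists_sum_slice ⊤ δa (by
      have : Function.Surjective ((⊤ : Submodule K G.alg.carrier).subtype.rTensor G.alg.carrier) :=
        LinearMap.rTensor_surjective _ (fun x => ⟨⟨x, trivial⟩, rfl⟩)
      exact this _)
    have : LinearMap.range L ≤ Submodule.span K (Set.range fun i => slice (ξ i) δa) := by
      rintro _ ⟨η, rfl⟩
      change slice η δa ∈ _
      have e := congrArg (slice η) ht
      rw [map_sum] at e
      rw [e]
      refine sum_mem fun i _ => ?_
      rw [slice_tmul]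
      exact Submodule.smul_mem _ _ (Submodule.subset_span ⟨i, rfl⟩)
    have hfin : Module.Finite K (Submodule.span K (Set.range fun i => slice (ξ i) δa)) :=
      Module.Finite.span_of_finite K (Set.finite_range _)
    have := Submodule.finiteDimensional_of_le this
    exact (Submodule.fg_iff_finiteDimensional _).2 this
  · change slice _ δa = a
    rw [slice, LinearMap.comp_apply, hδ, Coalgebra.rTensor_counit_comul]
    simp

theorem exists_leftCoideal_of_finset (F : Finset G.alg.carrier) :
    ∃ V : Submodule K G.alg.carrier, IsLeftCoideal V ∧ V.FG ∧ (F : Set G.alg.carrier) ⊆ V := by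
  classical
  induction F using Finset.induction_on with
  | empty => exact ⟨⊥, fun v hv => by rw [(Submodule.mem_bot K).1 hv, map_zero]; exact zero_mem _,
      Submodule.fg_bot, by simp⟩
  | insert a F _ ih =>
    obtain ⟨V, hV, hfg, hF⟩ := ih
    obtain ⟨W, hW, hfg', ha⟩ := exists_leftCoideal_mem a
    refine ⟨W ⊔ V, hW.sup hV, hfg'.sup hfg, ?_⟩
    rw [Finset.coe_insert, Set.insert_subset_iff]
    exact ⟨(le_sup_left : W ≤ W ⊔ V) ha, hF.trans (le_sup_right : V ≤ W ⊔ V)⟩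

/-- The comultiplication and the projections onto homogeneous components. -/
theorem comul_proj (i : ZMod 2) (a : G.alg.carrier) :
    Coalgebra.comul (R := K) (G.alg.proj i a) =
      TensorProduct.map (G.alg.proj 0) (G.alg.proj i) (Coalgebra.comul (R := K) a) +
      TensorProduct.map (G.alg.proj 1) (G.alg.proj (i - 1)) (Coalgebra.comul (R := K) a) := by
  -- `D i` is the projection of the tensor square onto total degree i; the claim is that it commutes
  -- with δ, because δ is even.
  set D : ZMod 2 → (G.alg.carrier ⊗[K] G.alg.carrier →ₗ[K] G.alg.carrier ⊗[K] G.alg.carrier) :=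
    fun i => TensorProduct.map (G.alg.proj 0) (G.alg.proj i) +
      TensorProduct.map (G.alg.proj 1) (G.alg.proj (i - 1)) with hD
  have key : ∀ (k i : ZMod 2) (t : G.alg.carrier ⊗[K] G.alg.carrier),
      t ∈ tensorGr G.alg.gr G.alg.gr k → D i t = if k = i then t else 0 := by
    intro k i t ht
    have hle : tensorGr G.alg.gr G.alg.gr k ≤
        LinearMap.eqLocus (D i) (if k = i then LinearMap.id else 0) := by
      refine iSup_le fun j => Submodule.map₂_le.2 fun x hx y hy => ?_
      rw [LinearMap.mem_eqLocus, TensorProduct.mk_apply]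
      have h01 : ∀ j : ZMod 2, j = 0 ∨ j = 1 := by decide
      have e : ∀ {l l' : ZMod 2} {z : G.alg.carrier}, z ∈ G.alg.gr l →
          G.alg.proj l' z = if l = l' then z else 0 := by
        intro l l' z hz
        split_ifs with h
        · subst h; exact SAlg.proj_of_mem hz
        · exact SAlg.proj_of_mem_ne hz h
      rw [hD]
      simp only [LinearMap.add_apply, TensorProduct.map_tmul, e hx, e hy]
      rcases h01 j with rfl | rfl <;> rcases h01 k with rfl | rfl <;> rcases h01 i with rfl | rfl <;>
        simp
    have := hle ht
    rw [LinearMap.mem_eqLocus] at this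
    rw [this]
    split_ifs <;> rfl
  have h := congrArg (D i) (congrArg (Coalgebra.comul (R := K)) (SAlg.proj_add_proj a))
  rw [map_add, map_add, key 0 i _ (G.comul_even 0 _ (SAlg.proj_mem 0 a)),
    key 1 i _ (G.comul_even 1 _ (SAlg.proj_mem 1 a))] at h
  refine Eq.trans ?_ h
  have h01 : ∀ i : ZMod 2, i = 0 ∨ i = 1 := by decide
  rcases h01 i with rfl | rfl <;> simp

/-- Every finite set lies in a finite-dimensional left coideal that is stable under the
projections onto homogeneous components. -/
theorem exists_graded_leftCoideal (F : Finset G.alg.carrier) :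
    ∃ V : Submodule K G.alg.carrier, IsLeftCoideal V ∧ V.FG ∧ (F : Set G.alg.carrier) ⊆ V ∧
      ∀ i, ∀ v ∈ V, G.alg.proj i v ∈ V := by
  obtain ⟨V, hV, hfg, hF⟩ := exists_leftCoideal_of_finset F
  set W := V.map (G.alg.proj 0) ⊔ V.map (G.alg.proj 1) with hW
  have hVW : ∀ i, ∀ v ∈ V, G.alg.proj i v ∈ W := by
    intro i v hv
    have h01 : i = 0 ∨ i = 1 := by revert i; decide
    rcases h01 with rfl | rfl
    · exact (le_sup_left : _ ≤ W) ⟨v, hv, rfl⟩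
    · exact (le_sup_right : _ ≤ W) ⟨v, hv, rfl⟩
  have hle : V ≤ W := fun v hv => by
    rw [← SAlg.proj_add_proj v]
    exact add_mem (hVW 0 v hv) (hVW 1 v hv)
  have hpp : ∀ (i j : ZMod 2) (v : G.alg.carrier), v ∈ V → G.alg.proj i (G.alg.proj j v) ∈ W := by
    intro i j v hv
    by_cases h : j = i
    · subst h
      rw [SAlg.proj_of_mem (SAlg.proj_mem j v)]
      exact hVW j v hv
    · rw [SAlg.proj_of_mem_ne (SAlg.proj_mem j v) h]
      exact zero_mem _
  have hmap : ∀ (i j : ZMod 2) (t : G.alg.carrier ⊗[K] G.alg.carrier),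
      t ∈ LinearMap.range (V.subtype.lTensor G.alg.carrier) →
      TensorProduct.map (G.alg.proj i) (G.alg.proj j) t ∈
        LinearMap.range (W.subtype.lTensor G.alg.carrier) := by
    intro i j t ht
    rw [range_lTensor_eq_span] at ht
    induction ht using Submodule.span_induction with
    | mem t ht =>
      obtain ⟨x, y, hy, rfl⟩ := ht
      rw [TensorProduct.map_tmul]
      exact mem_range_lTensor_of_tmul _ (hVW j y hy)
    | zero => rw [map_zero]; exact zero_mem _
    | add x y _ _ hx hy => rw [map_add]; exact add_mem hx hy
    | smul a x _ hx => rw [map_smul]; exact Submodule.smul_mem _ _ hx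
  have hco : ∀ i, ∀ v ∈ V, Coalgebra.comul (R := K) (G.alg.proj i v) ∈
      LinearMap.range (W.subtype.lTensor G.alg.carrier) := by
    intro i v hv
    rw [comul_proj]
    exact add_mem (hmap _ _ _ (hV v hv)) (hmap _ _ _ (hV v hv))
  refine ⟨W, ?_, (hfg.map _).sup (hfg.map _), hF.trans hle, ?_⟩
  · intro x hx
    obtain ⟨_, ⟨v, hv, rfl⟩, _, ⟨w, hw, rfl⟩, rfl⟩ := Submodule.mem_sup.1 hx
    rw [map_add]
    exact add_mem (hco 0 v hv) (hco 1 w hw)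
  · intro i x hx
    obtain ⟨_, ⟨v, hv, rfl⟩, _, ⟨w, hw, rfl⟩, rfl⟩ := Submodule.mem_sup.1 hx
    rw [map_add]
    exact add_mem (hpp i 0 v hv) (hpp i 1 w hw)

/-- The comultiplication of a product. -/
theorem comul_mul_apply (a b : G.alg.carrier) :
    Coalgebra.comul (R := K) (a * b) = (GradedTensorProduct.of K G.alg.gr G.alg.gr).symm
      (GradedTensorProduct.of K G.alg.gr G.alg.gr (Coalgebra.comul (R := K) a) *
        GradedTensorProduct.of K G.alg.gr G.alg.gr (Coalgebra.comul (R := K) b)) := by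
  rw [← G.comul_mul]
  rfl

/-- The bilinear product of `K[G] ⊗ K[G]`. -/
def gmul : G.alg.carrier ⊗[K] G.alg.carrier →ₗ[K] G.alg.carrier ⊗[K] G.alg.carrier →ₗ[K]
    G.alg.carrier ⊗[K] G.alg.carrier :=
  GradedTensorProduct.mulHom G.alg.gr G.alg.gr

theorem comul_mul_eq_gmul (a b : G.alg.carrier) : Coalgebra.comul (R := K) (a * b) =
    gmul (Coalgebra.comul (R := K) a) (Coalgebra.comul (R := K) b) :=
  comul_mul_apply a b

theorem gmul_tmul (x y a b : G.alg.carrier) : gmul (x ⊗ₜ[K] y) (a ⊗ₜ[K] b) =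
    (x * a) ⊗ₜ (G.alg.proj 0 y * b) + (x * G.alg.parity a) ⊗ₜ (G.alg.proj 1 y * b) :=
  SAlg.tmul_mul_tmul G.alg G.alg x a y b

end Coideal

end AffineSupergroup

end

end Super

namespace Super

noncomputable section

variable {K : Type u} [Field K]

namespace AffineSupergroup

section Translation

variable {G : AffineSupergroup K}

theorem comul_one_eq : Coalgebra.comul (R := K) (1 : G.alg.carrier) = 1 ⊗ₜ[K] 1 :=
  congrArg (GradedTensorProduct.of K G.alg.gr G.alg.gr).symm G.comul_one

/-! ### Translation by points with values in purely even algebras -/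

variable {R : Type u} [CommRing R] [Algebra K R]

/-- The sign in the product of K[G] ⊗ K[G] enters through the parity of a first factor, and π does
not see that parity because it kills odd elements. So no sign is left in R ⊗ K[G], and translation
is an ordinary algebra map. -/
theorem map_gmul (π : G.alg.carrier →ₐ[K] R) (hπ : ∀ a ∈ G.alg.gr 1, π a = 0)
    (s t : G.alg.carrier ⊗[K] G.alg.carrier) :
    TensorProduct.map π.toLinearMap LinearMap.id (gmul s t) =
      TensorProduct.map π.toLinearMap LinearMap.id s *
        TensorProduct.map π.toLinearMap LinearMap.id t := by
  induction s with
  | zero => simp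
  | add x y hx hy => simp only [map_add, LinearMap.add_apply, add_mul, hx, hy]
  | tmul x y =>
    induction t with
    | zero => simp
    | add x y hx hy => simp only [map_add, mul_add, hx, hy]
    | tmul a b =>
      have hp : π (G.alg.parity a) = π a := by
        conv_rhs => rw [← SAlg.proj_add_proj a, map_add, hπ _ (SAlg.proj_mem 1 a)]
        rw [SAlg.parity_apply, map_sub, hπ _ (SAlg.proj_mem 1 a), sub_zero, add_zero]
      rw [gmul_tmul]
      simp only [map_add, TensorProduct.map_tmul, Algebra.TensorProduct.tmul_mul_tmul,
        AlgHom.toLinearMap_apply, map_mul, hp, LinearMap.id_apply]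
      rw [← TensorProduct.tmul_add, ← add_mul, SAlg.proj_add_proj]

/-- The translation `a ↦ ∑ π(a₁) ⊗ a₂` by a point `π` with values in a commutative algebra. -/
def trans (π : G.alg.carrier →ₐ[K] R) (hπ : ∀ a ∈ G.alg.gr 1, π a = 0) :
    G.alg.carrier →ₐ[K] R ⊗[K] G.alg.carrier :=
  AlgHom.ofLinearMap (TensorProduct.map π.toLinearMap LinearMap.id ∘ₗ Coalgebra.comul)
    (by rw [LinearMap.comp_apply, comul_one_eq, TensorProduct.map_tmul, AlgHom.toLinearMap_apply,
          map_one]; rfl)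
    (fun a b => by
      rw [LinearMap.comp_apply, comul_mul_eq_gmul, map_gmul π hπ]; rfl)

theorem trans_apply (π : G.alg.carrier →ₐ[K] R) (hπ : ∀ a ∈ G.alg.gr 1, π a = 0)
    (a : G.alg.carrier) : trans π hπ a =
      TensorProduct.map π.toLinearMap LinearMap.id (Coalgebra.comul (R := K) a) := rfl

theorem antipode_point_odd (π : G.alg.carrier →ₐ[K] R) (hπ : ∀ a ∈ G.alg.gr 1, π a = 0) :
    ∀ a ∈ G.alg.gr 1, (π.comp G.antipode.toAlgHom) a = 0 :=
  fun a ha => hπ _ (G.antipode.even 1 a ha)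

/-- The translation by the inverse of `π`. -/
def transInv (π : G.alg.carrier →ₐ[K] R) (hπ : ∀ a ∈ G.alg.gr 1, π a = 0) :
    G.alg.carrier →ₐ[K] R ⊗[K] G.alg.carrier :=
  trans (π.comp G.antipode.toAlgHom) (antipode_point_odd π hπ)

/-- The `R`-linear extension of the translation by the inverse of `π`. -/
def transInvExt (π : G.alg.carrier →ₐ[K] R) (hπ : ∀ a ∈ G.alg.gr 1, π a = 0) :
    R ⊗[K] G.alg.carrier →ₐ[K] R ⊗[K] G.alg.carrier :=
  Algebra.TensorProduct.lift Algebra.TensorProduct.includeLeft (transInv π hπ)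
    (fun r a => by
      change Commute (r ⊗ₜ[K] (1 : G.alg.carrier)) (transInv π hπ a)
      generalize transInv π hπ a = t
      induction t with
      | zero => exact Commute.zero_right _
      | add x y hx hy => exact hx.add_right hy
      | tmul x y =>
        change r ⊗ₜ[K] 1 * x ⊗ₜ[K] y = x ⊗ₜ[K] y * r ⊗ₜ[K] 1
        rw [Algebra.TensorProduct.tmul_mul_tmul, Algebra.TensorProduct.tmul_mul_tmul, mul_comm,
          one_mul, mul_one])

theorem transInvExt_tmul (π : G.alg.carrier →ₐ[K] R) (hπ : ∀ a ∈ G.alg.gr 1, π a = 0) (r : R)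
    (a : G.alg.carrier) :
    transInvExt π hπ (r ⊗ₜ[K] a) = (r ⊗ₜ[K] 1) * transInv π hπ a := by
  rw [transInvExt, Algebra.TensorProduct.lift_tmul]
  rfl

theorem transInvExt_one_tmul (π : G.alg.carrier →ₐ[K] R) (hπ : ∀ a ∈ G.alg.gr 1, π a = 0)
    (a : G.alg.carrier) : transInvExt π hπ (1 ⊗ₜ[K] a) = transInv π hπ a := by
  rw [transInvExt_tmul, ← Algebra.TensorProduct.one_def, one_mul]

theorem antipode_right_apply (π : G.alg.carrier →ₐ[K] R) (a : G.alg.carrier) :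
    LinearMap.mul' K R (TensorProduct.map π.toLinearMap
      (π.comp G.antipode.toAlgHom).toLinearMap (Coalgebra.comul (R := K) a)) =
      algebraMap K R (Coalgebra.counit (R := K) a) := by
  rw [← π.commutes, ← G.antipode_right]
  generalize Coalgebra.comul (R := K) a = t
  induction t with
  | zero => simp
  | add x y hx hy => simp only [map_add, hx, hy]
  | tmul x y => simp

theorem antipode_left_apply (π : G.alg.carrier →ₐ[K] R) (a : G.alg.carrier) :
    LinearMap.mul' K R (TensorProduct.map (π.comp G.antipode.toAlgHom).toLinearMap
      π.toLinearMap (Coalgebra.comul (R := K) a)) =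
      algebraMap K R (Coalgebra.counit (R := K) a) := by
  rw [← π.commutes, ← G.antipode_left]
  generalize Coalgebra.comul (R := K) a = t
  induction t with
  | zero => simp
  | add x y hx hy => simp only [map_add, hx, hy]
  | tmul x y => simp

/-- By coassociativity the composite is ∑ π(a₁)π(S(a₂)) ⊗ a₃, and the antipode collapses the first
factor to ε. -/
theorem transInvExt_trans (π : G.alg.carrier →ₐ[K] R) (hπ : ∀ a ∈ G.alg.gr 1, π a = 0)
    (a : G.alg.carrier) : transInvExt π hπ (trans π hπ a) = 1 ⊗ₜ[K] a := by
  set μ : G.alg.carrier ⊗[K] G.alg.carrier →ₗ[K] R := LinearMap.mul' K R ∘ₗ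
    TensorProduct.map π.toLinearMap (π.comp G.antipode.toAlgHom).toLinearMap with hμ
  have h1 : ∀ x y : G.alg.carrier, transInvExt π hπ (π x ⊗ₜ[K] y) =
      μ.rTensor G.alg.carrier ((TensorProduct.assoc K _ _ _).symm
        (x ⊗ₜ[K] Coalgebra.comul (R := K) y)) := by
    intro x y
    rw [transInvExt_tmul, transInv, trans_apply]
    generalize Coalgebra.comul (R := K) y = t
    induction t with
    | zero => simp
    | add x y hx hy => simp only [map_add, mul_add, TensorProduct.tmul_add, hx, hy]
    | tmul z w =>
      rw [TensorProduct.assoc_symm_tmul, LinearMap.rTensor_tmul, TensorProduct.map_tmul,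
        Algebra.TensorProduct.tmul_mul_tmul, one_mul]
      rfl
  have h2 : ∀ t : G.alg.carrier ⊗[K] G.alg.carrier,
      transInvExt π hπ (TensorProduct.map π.toLinearMap LinearMap.id t) =
      μ.rTensor G.alg.carrier ((TensorProduct.assoc K _ _ _).symm
        ((Coalgebra.comul (R := K)).lTensor _ t)) := by
    intro t
    induction t with
    | zero => simp
    | add x y hx hy => simp only [map_add, hx, hy]
    | tmul x y => exact h1 x y
  rw [trans_apply, h2, Coalgebra.coassoc_symm_apply, ← LinearMap.comp_apply,
    ← LinearMap.rTensor_comp]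
  have h3 : μ ∘ₗ Coalgebra.comul = Algebra.linearMap K R ∘ₗ
      Coalgebra.counit (R := K) (A := G.alg.carrier) := by
    ext a
    exact antipode_right_apply π a
  rw [h3, LinearMap.rTensor_comp, LinearMap.comp_apply, Coalgebra.rTensor_counit_comul]
  simp

end Translation

/-! ### Hopf modules over the image of a comorphism -/

section HopfModule

variable {G H : AffineSupergroup K} (φ : Mor G H)

/-- The image of the comorphism. -/
def Mor.sub : Subalgebra K G.alg.carrier := φ.comorphism.toAlgHom.range

variable {φ}

theorem Mor.sub_proj {b : G.alg.carrier} (hb : b ∈ φ.sub) (i : ZMod 2) :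
    G.alg.proj i b ∈ φ.sub := by
  obtain ⟨h, rfl⟩ := hb
  exact ⟨H.alg.proj i h, (SAlg.proj_map φ.comorphism i h).symm⟩

theorem Mor.sub_antipode {b : G.alg.carrier} (hb : b ∈ φ.sub) :
    G.antipode.toAlgHom b ∈ φ.sub := by
  obtain ⟨h, rfl⟩ := hb
  exact ⟨H.antipode.toAlgHom h, (φ.antipode_comp h).symm⟩

/-- The comultiplication preserves the image of the comorphism. -/
theorem Mor.sub_comul {b : G.alg.carrier} (hb : b ∈ φ.sub) :
    Coalgebra.comul (R := K) b ∈
      Submodule.span K {t | ∃ x ∈ φ.sub, ∃ y ∈ φ.sub, t = x ⊗ₜ[K] y} := by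
  obtain ⟨h, rfl⟩ := hb
  change Coalgebra.comul (R := K) (φ.comorphism.toAlgHom h) ∈ _
  rw [φ.comul_comp]
  generalize Coalgebra.comul (R := K) h = t
  induction t with
  | zero => rw [map_zero]; exact zero_mem _
  | add x y hx hy => rw [map_add]; exact add_mem hx hy
  | tmul x y => exact Submodule.subset_span ⟨_, ⟨x, rfl⟩, _, ⟨y, rfl⟩, rfl⟩

/-- The product of two sub-comodules. -/
theorem IsLeftCoideal.sub_mul {V : Submodule K G.alg.carrier} (hV : IsLeftCoideal V) :
    IsLeftCoideal (Subalgebra.toSubmodule φ.sub * V) := by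
  intro m hm
  induction hm using Submodule.mul_induction_on' with
  | add x _ y _ hx hy => rw [map_add]; exact add_mem hx hy
  | mem_mul_mem b hb v hv =>
    rw [comul_mul_eq_gmul]
    have h1 := Mor.sub_comul hb
    have h2 := hV v hv
    rw [range_lTensor_eq_span] at h2
    generalize Coalgebra.comul (R := K) b = s at h1 ⊢
    generalize Coalgebra.comul (R := K) v = t at h2 ⊢
    induction h1 using Submodule.span_induction with
    | zero => rw [map_zero]; exact zero_mem _
    | add x y _ _ hx hy => rw [map_add]; exact add_mem hx hy
    | smul c x _ hx => rw [map_smul]; exact Submodule.smul_mem _ c hx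
    | mem s hs =>
      obtain ⟨x, hx, y, hy, rfl⟩ := hs
      induction h2 using Submodule.span_induction with
      | zero => rw [map_zero]; exact zero_mem _
      | add x y _ _ hx hy => rw [map_add]; exact add_mem hx hy
      | smul c x _ hx => rw [map_smul]; exact Submodule.smul_mem _ c hx
      | mem t ht =>
        obtain ⟨a, w, hw, rfl⟩ := ht
        rw [gmul_tmul]
        exact add_mem
          (mem_range_lTensor_of_tmul _ (Submodule.mul_mem_mul (Mor.sub_proj hy 0) hw))
          (mem_range_lTensor_of_tmul _ (Submodule.mul_mem_mul (Mor.sub_proj hy 1) hw))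

variable (φ) in
/-- The linear map `f` restricts to a morphism of left modules `M → Im φ^*`. -/
structure IsModuleMap (M : Submodule K G.alg.carrier) (f : G.alg.carrier →ₗ[K] G.alg.carrier) :
    Prop where
  mem : ∀ m ∈ M, f m ∈ φ.sub
  map_mul : ∀ b ∈ φ.sub, ∀ m ∈ M, f (b * m) = b * f m

variable (φ) in
/-- `M` is a submodule over the image of the comorphism and a left coideal. -/
structure IsHopfSubmodule (M : Submodule K G.alg.carrier) : Prop where
  mul_mem : ∀ b ∈ φ.sub, ∀ m ∈ M, b * m ∈ M
  coideal : IsLeftCoideal M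

variable {R : Type u} [CommRing R] [Algebra K R] (π : G.alg.carrier →ₐ[K] R)
  (hπ : ∀ a ∈ G.alg.gr 1, π a = 0)

theorem trans_mem {M : Submodule K G.alg.carrier} (hM : IsLeftCoideal M) {m : G.alg.carrier}
    (hm : m ∈ M) : trans π hπ m ∈ LinearMap.range (M.subtype.lTensor R) := by
  rw [trans_apply]
  have h := hM m hm
  rw [range_lTensor_eq_span] at h
  generalize Coalgebra.comul (R := K) m = s at h ⊢
  induction h using Submodule.span_induction with
  | zero => rw [map_zero]; exact zero_mem _
  | add x y _ _ hx hy => rw [map_add]; exact add_mem hx hy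
  | smul c x _ hx => rw [map_smul]; exact Submodule.smul_mem _ c hx
  | mem s hs =>
    obtain ⟨x, y, hy, rfl⟩ := hs
    exact mem_range_lTensor_of_tmul _ hy

theorem isLeftCoideal_sub : IsLeftCoideal (Subalgebra.toSubmodule φ.sub) := by
  intro b hb
  rw [range_lTensor_eq_span]
  refine Submodule.span_mono ?_ (Mor.sub_comul hb)
  rintro _ ⟨x, -, y, hy, rfl⟩
  exact ⟨x, y, hy, rfl⟩

/-- Translation of `R ⊗ M` by the inverse of a point. -/
theorem transInvExt_mem {M : Submodule K G.alg.carrier} (hM : IsLeftCoideal M)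
    {t : R ⊗[K] G.alg.carrier} (ht : t ∈ LinearMap.range (M.subtype.lTensor R)) :
    transInvExt π hπ t ∈ LinearMap.range (M.subtype.lTensor R) := by
  rw [range_lTensor_eq_span] at ht
  induction ht using Submodule.span_induction with
  | zero => rw [map_zero]; exact zero_mem _
  | add x y _ _ hx hy => rw [map_add]; exact add_mem hx hy
  | smul c x _ hx => rw [map_smul]; exact Submodule.smul_mem _ c hx
  | mem t ht =>
    obtain ⟨r, y, hy, rfl⟩ := ht
    rw [transInvExt_tmul]
    have h := trans_mem (π.comp G.antipode.toAlgHom) (antipode_point_odd π hπ) hM hy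
    change transInv π hπ y ∈ _ at h
    rw [range_lTensor_eq_span] at h
    generalize transInv π hπ y = s at h ⊢
    induction h using Submodule.span_induction with
    | zero => rw [mul_zero]; exact zero_mem _
    | add x y _ _ hx hy => rw [mul_add]; exact add_mem hx hy
    | smul c x _ hx => rw [mul_smul_comm]; exact Submodule.smul_mem _ c hx
    | mem t ht =>
      obtain ⟨a, w, hw, rfl⟩ := ht
      rw [Algebra.TensorProduct.tmul_mul_tmul, one_mul]
      exact mem_range_lTensor_of_tmul _ hw

/-- Linearity of f over B, extended to scalars in R. The forms used later are linear only on M, so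
membership of the tensors in R ⊗ B and R ⊗ M has to be carried along. -/
theorem lTensor_mul {M : Submodule K G.alg.carrier} {f : G.alg.carrier →ₗ[K] G.alg.carrier}
    (hf : ∀ b ∈ φ.sub, ∀ m ∈ M, f (b * m) = b * f m) {s t : R ⊗[K] G.alg.carrier}
    (hs : s ∈ LinearMap.range ((Subalgebra.toSubmodule φ.sub).subtype.lTensor R))
    (ht : t ∈ LinearMap.range (M.subtype.lTensor R)) :
    f.lTensor R (s * t) = s * f.lTensor R t := by
  rw [range_lTensor_eq_span] at hs
  induction hs using Submodule.span_induction with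
  | zero => simp
  | add x y _ _ hx hy => simp only [add_mul, map_add, hx, hy]
  | smul c x _ hx => simp only [smul_mul_assoc, map_smul, hx]
  | mem s hs =>
    obtain ⟨r, b, hb, rfl⟩ := hs
    rw [range_lTensor_eq_span] at ht
    induction ht using Submodule.span_induction with
    | zero => simp
    | add x y _ _ hx hy => simp only [mul_add, map_add, hx, hy]
    | smul c x _ hx => simp only [mul_smul_comm, map_smul, hx]
    | mem t ht =>
      obtain ⟨a, w, hw, rfl⟩ := ht
      rw [Algebra.TensorProduct.tmul_mul_tmul, LinearMap.lTensor_tmul, LinearMap.lTensor_tmul,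
        Algebra.TensorProduct.tmul_mul_tmul, hf b hb w hw]

/-- The conjugate of a linear map by the translation by `π`. -/
def conj (f : G.alg.carrier →ₗ[K] G.alg.carrier) : G.alg.carrier →ₗ[K] R ⊗[K] G.alg.carrier :=
  (transInvExt π hπ).toLinearMap ∘ₗ f.lTensor R ∘ₗ (trans π hπ).toLinearMap

theorem conj_apply (f : G.alg.carrier →ₗ[K] G.alg.carrier) (a : G.alg.carrier) :
    conj π hπ f a = transInvExt π hπ (f.lTensor R (trans π hπ a)) := rfl

/-- Translation is multiplicative and sends B into R ⊗ B, over which id ⊗ f is linear on R ⊗ M. The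
inverse translation then brings the translate of b back to 1 ⊗ b. -/
theorem conj_mul {M : Submodule K G.alg.carrier} (hM : IsHopfSubmodule φ M)
    {f : G.alg.carrier →ₗ[K] G.alg.carrier} (hf : IsModuleMap φ M f) {b m : G.alg.carrier}
    (hb : b ∈ φ.sub) (hm : m ∈ M) :
    conj π hπ f (b * m) = (1 ⊗ₜ[K] b) * conj π hπ f m := by
  rw [conj_apply, map_mul, lTensor_mul hf.map_mul (trans_mem π hπ isLeftCoideal_sub hb)
    (trans_mem π hπ hM.coideal hm), map_mul, transInvExt_trans, conj_apply]

theorem conj_mem {M : Submodule K G.alg.carrier} (hM : IsHopfSubmodule φ M)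
    {f : G.alg.carrier →ₗ[K] G.alg.carrier} (hf : IsModuleMap φ M f) {m : G.alg.carrier}
    (hm : m ∈ M) :
    conj π hπ f m ∈ LinearMap.range ((Subalgebra.toSubmodule φ.sub).subtype.lTensor R) := by
  rw [conj_apply]
  refine transInvExt_mem π hπ isLeftCoideal_sub ?_
  have h := trans_mem π hπ hM.coideal hm
  rw [range_lTensor_eq_span] at h
  generalize trans π hπ m = s at h ⊢
  induction h using Submodule.span_induction with
  | zero => rw [map_zero]; exact zero_mem _
  | add x y _ _ hx hy => rw [map_add]; exact add_mem hx hy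
  | smul c x _ hx => rw [map_smul]; exact Submodule.smul_mem _ c hx
  | mem t ht =>
    obtain ⟨r, y, hy, rfl⟩ := ht
    rw [LinearMap.lTensor_tmul]
    exact mem_range_lTensor_of_tmul _ (hf.mem y hy)

theorem slice_one_tmul_mul (ξ : R →ₗ[K] K) (b : G.alg.carrier) (t : R ⊗[K] G.alg.carrier) :
    slice ξ ((1 ⊗ₜ[K] b) * t) = b * slice ξ t := by
  induction t with
  | zero => simp
  | add x y hx hy => simp only [map_add, mul_add, hx, hy]
  | tmul x y =>
    rw [Algebra.TensorProduct.tmul_mul_tmul, slice_tmul, slice_tmul, one_mul, mul_smul_comm]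

/-- The slices of the conjugate of a module map are module maps. -/
theorem IsModuleMap.slice_conj {M : Submodule K G.alg.carrier} (hM : IsHopfSubmodule φ M)
    {f : G.alg.carrier →ₗ[K] G.alg.carrier} (hf : IsModuleMap φ M f) (ξ : R →ₗ[K] K) :
    IsModuleMap φ M (slice ξ ∘ₗ conj π hπ f) where
  mem m hm := (mem_range_lTensor_iff _ _).1 (conj_mem π hπ hM hf hm) ξ
  map_mul b hb m hm := by
    rw [LinearMap.comp_apply, conj_mul π hπ hM hf hb hm, slice_one_tmul_mul]
    rfl

variable (φ) in
/-- The span of the endomorphisms `m ↦ f(m) m₀` of `M`, for module maps `f` and `m₀ ∈ M`. -/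
def traceSpan (M : Submodule K G.alg.carrier) :
    Submodule K (G.alg.carrier →ₗ[K] G.alg.carrier) :=
  Submodule.span K {F | ∃ f, IsModuleMap φ M f ∧ ∃ m₀ ∈ M, F = LinearMap.mulRight K m₀ ∘ₗ f}

/-- Conjugating m ↦ f(m)m₀ gives the conjugate of f times the inverse translate of m₀. Expanding
that translate as ∑ rⱼ ⊗ yⱼ with yⱼ in M, a slice by ξ becomes a sum of slices of the conjugate of f
by ξ(· rⱼ), followed by multiplication by yⱼ. -/
theorem slice_conj_mem_traceSpan {M : Submodule K G.alg.carrier} (hM : IsHopfSubmodule φ M)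
    {F : G.alg.carrier →ₗ[K] G.alg.carrier} (hF : F ∈ traceSpan φ M) (ξ : R →ₗ[K] K) :
    slice ξ ∘ₗ conj π hπ F ∈ traceSpan φ M := by
  induction hF using Submodule.span_induction with
  | zero =>
    have : slice ξ ∘ₗ conj π hπ (0 : G.alg.carrier →ₗ[K] G.alg.carrier) = 0 := by
      ext a; simp [conj_apply]
    rw [this]
    exact zero_mem _
  | add x y _ _ hx hy =>
    have : slice ξ ∘ₗ conj π hπ (x + y) = slice ξ ∘ₗ conj π hπ x + slice ξ ∘ₗ conj π hπ y := by
      ext a; simp [conj_apply, LinearMap.lTensor_add]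
    rw [this]
    exact add_mem hx hy
  | smul c x _ hx =>
    have : slice ξ ∘ₗ conj π hπ (c • x) = c • (slice ξ ∘ₗ conj π hπ x) := by
      ext a; simp [conj_apply, LinearMap.lTensor_smul]
    rw [this]
    exact Submodule.smul_mem _ c hx
  | mem F hF =>
    obtain ⟨f, hf, m₀, hm₀, rfl⟩ := hF
    have h1 : ∀ t : R ⊗[K] G.alg.carrier,
        (LinearMap.mulRight K m₀ ∘ₗ f).lTensor R t = f.lTensor R t * (1 ⊗ₜ[K] m₀) := by
      intro t
      induction t with
      | zero => simp
      | add x y hx hy => simp only [map_add, add_mul, hx, hy]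
      | tmul x y => simp
    have h2 : ∀ a, conj π hπ (LinearMap.mulRight K m₀ ∘ₗ f) a =
        conj π hπ f a * transInv π hπ m₀ := by
      intro a
      rw [conj_apply, h1, map_mul, transInvExt_one_tmul, conj_apply]
    have h := trans_mem (π.comp G.antipode.toAlgHom) (antipode_point_odd π hπ) hM.coideal hm₀
    change transInv π hπ m₀ ∈ _ at h
    rw [range_lTensor_eq_span] at h
    have h3 : ∀ t ∈ Submodule.span K {t | ∃ (x : R) (y : G.alg.carrier), y ∈ M ∧ t = x ⊗ₜ[K] y},
        slice ξ ∘ₗ (LinearMap.mulRight K t ∘ₗ conj π hπ f) ∈ traceSpan φ M := by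
      intro t ht
      induction ht using Submodule.span_induction with
      | zero => simp
      | add x y _ _ hx hy =>
        have : LinearMap.mulRight K (x + y) = LinearMap.mulRight K x + LinearMap.mulRight K y := by
          ext; simp [mul_add]
        rw [this, LinearMap.add_comp, LinearMap.comp_add]
        exact add_mem hx hy
      | smul c x _ hx =>
        have : LinearMap.mulRight K (c • x) = c • LinearMap.mulRight K x := by
          ext; simp
        rw [this, LinearMap.smul_comp, LinearMap.comp_smul]
        exact Submodule.smul_mem _ c hx
      | mem t ht =>
        obtain ⟨r, y, hy, rfl⟩ := ht
        refine Submodule.subset_span ⟨_, hf.slice_conj π hπ hM (ξ ∘ₗ LinearMap.mulRight K r),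
          y, hy, ?_⟩
        ext a
        simp only [LinearMap.comp_apply, LinearMap.mulRight_apply]
        generalize conj π hπ f a = s
        induction s with
        | zero => simp
        | add x y hx hy => simp only [map_add, add_mul, hx, hy]
        | tmul x z => simp
    have h4 : slice ξ ∘ₗ conj π hπ (LinearMap.mulRight K m₀ ∘ₗ f) =
        slice ξ ∘ₗ (LinearMap.mulRight K (transInv π hπ m₀) ∘ₗ conj π hπ f) := by
      ext a
      simp only [LinearMap.comp_apply, LinearMap.mulRight_apply, h2]
    rw [h4]
    exact h3 _ h

/-- A subspace of `Im φ^*` that is stable under translations, under multiplication by even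
elements, and contains an element with nonzero counit, contains an element that is `1` modulo
odd and nilpotent elements. -/
theorem exists_toRed_eq_one (hK : (2 : K) ≠ 0) (W : Submodule K G.alg.carrier)
    (hW : ∀ w ∈ W, w ∈ φ.sub)
    (hWmul : ∀ w ∈ W, ∀ b ∈ φ.sub, b ∈ G.alg.gr 0 → w * b ∈ W)
    (hWst : ∀ w ∈ W, ∀ ξ, slice ξ (transInv (G.alg.toRed hK)
      (fun _ h => SAlg.toRed_odd hK h) w) ∈ W)
    {w : G.alg.carrier} (hw : w ∈ W) (hw1 : Coalgebra.counit (R := K) w = 1) :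
    ∃ w' ∈ W, G.alg.toRed hK w' = 1 := by
  set π := G.alg.toRed hK with hπ
  set t := transInv π (fun _ h => SAlg.toRed_odd hK h) w with ht
  have ht' : t = TensorProduct.map (π.comp G.antipode.toAlgHom).toLinearMap LinearMap.id
    (Coalgebra.comul (R := K) w) := rfl
  -- Since B is stable under δ and S, the first tensor factors of t lie in π(B), so that the
  -- coefficients of its slices lift to B.
  have hmem : t ∈ LinearMap.range
      (((Subalgebra.toSubmodule φ.sub).map π.toLinearMap).subtype.rTensor G.alg.carrier) := by
    rw [ht']
    have h := Mor.sub_comul (hW w hw)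
    generalize Coalgebra.comul (R := K) w = s at h ⊢
    induction h using Submodule.span_induction with
    | zero => rw [map_zero]; exact zero_mem _
    | add x y _ _ hx hy => rw [map_add]; exact add_mem hx hy
    | smul c x _ hx => rw [map_smul]; exact Submodule.smul_mem _ c hx
    | mem s hs =>
      obtain ⟨x, hx, y, hy, rfl⟩ := hs
      exact ⟨⟨_, _, Mor.sub_antipode hx, rfl⟩ ⊗ₜ y, rfl⟩
  obtain ⟨n, x, ξ, hx, hsum⟩ := exists_sum_slice _ t hmem
  choose b hb hbx using hx
  -- The image of this element under π is ∑ π(S(w₁))π(w₂) = ε(w) = 1. Lifts may be replaced by their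
  -- even parts because π kills the odd ones; this is needed as `W` is only stable under even
  -- multipliers.
  refine ⟨∑ i, slice (ξ i) t * G.alg.proj 0 (b i), sum_mem fun i _ =>
    hWmul _ (hWst w hw (ξ i)) _ (Mor.sub_proj (hb i) 0) (SAlg.proj_mem 0 _), ?_⟩
  have h1 : LinearMap.mul' K _ (π.toLinearMap.lTensor _ t) = 1 := by
    have h := antipode_left_apply π w
    rw [hw1, map_one] at h
    rw [← h, ht']
    generalize Coalgebra.comul (R := K) w = s
    induction s with
    | zero => simp
    | add x y hx hy => simp only [map_add, hx, hy]
    | tmul x y => simp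
  rw [hsum] at h1
  simp only [map_sum, LinearMap.lTensor_tmul, LinearMap.mul'_apply] at h1
  rw [← h1, map_sum]
  refine Finset.sum_congr rfl fun i _ => ?_
  rw [map_mul, ← hbx i, hπ, SAlg.toRed_proj, mul_comm]
  rfl

end HopfModule

end AffineSupergroup

end

end Super

namespace Super

noncomputable section

variable {K : Type u} [Field K]

section Slice

variable {M N : Type u} [AddCommGroup M] [Module K M] [AddCommGroup N] [Module K N]

/-- The slice map `x ⊗ y ↦ η(y) x`. -/
def rslice (η : N →ₗ[K] K) : M ⊗[K] N →ₗ[K] M :=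
  (TensorProduct.rid K M).toLinearMap ∘ₗ η.lTensor M

@[simp]
theorem rslice_tmul (η : N →ₗ[K] K) (x : M) (y : N) : rslice η (x ⊗ₜ[K] y) = η y • x := by
  simp [rslice]

end Slice

theorem mul_submodule_mono_left {A : Type*} [Ring A] [Algebra K A] {W W' V : Submodule K A}
    (h : W ≤ W') : W * V ≤ W' * V :=
  Submodule.mul_le.2 fun _ hx _ hy => Submodule.mul_mem_mul (h hx) hy

theorem exists_sum_of_mem_mul_span {A : Type*} [Ring A] [Algebra K A] {n : ℕ} (W : Submodule K A)
    (v : Fin n → A) {x : A} (hx : x ∈ W * Submodule.span K (Set.range v)) :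
    ∃ c : Fin n → A, (∀ j, c j ∈ W) ∧ x = ∑ j, c j * v j := by
  induction hx using Submodule.mul_induction_on' with
  | mem_mul_mem b hb y hy =>
    obtain ⟨a, rfl⟩ := (Submodule.mem_span_range_iff_exists_fun K).1 hy
    exact ⟨fun j => a j • b, fun j => W.smul_mem _ hb, by
      simp only [Finset.mul_sum, mul_smul_comm, smul_mul_assoc]⟩
  | add x _ y _ hx hy =>
    obtain ⟨c, hc, rfl⟩ := hx
    obtain ⟨c', hc', rfl⟩ := hy
    exact ⟨c + c', fun j => W.add_mem (hc j) (hc' j), by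
      simp [add_mul, Finset.sum_add_distrib]⟩

namespace AffineSupergroup

variable {G H : AffineSupergroup K} {φ : Mor G H}

/-! ### The generic freeness of Hopf modules -/

/-- The map `a ↦ ∑ a₁ η(a₂)`. -/
def rtrans (η : G.alg.carrier →ₗ[K] K) : G.alg.carrier →ₗ[K] G.alg.carrier :=
  rslice η ∘ₗ Coalgebra.comul

/-- In δ(b)δ(m) the second factors coming from b lie in B, and η replaces them by their counits. The
term with a sign contains an odd second factor, whose counit is zero, and ∑ b₁ε(b₂) = b remains. -/
theorem rtrans_mul {M : Submodule K G.alg.carrier} (hM : IsHopfSubmodule φ M)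
    {η : G.alg.carrier →ₗ[K] K}
    (hη : ∀ b ∈ φ.sub, ∀ m ∈ M, η (b * m) = Coalgebra.counit (R := K) b * η m)
    {b m : G.alg.carrier} (hb : b ∈ φ.sub) (hm : m ∈ M) :
    rtrans η (b * m) = b * rtrans η m := by
  have hb' : b = rslice Coalgebra.counit (Coalgebra.comul (R := K) b) := by
    rw [rslice, LinearMap.comp_apply, Coalgebra.lTensor_counit_comul]
    simp
  have hs := Mor.sub_comul hb
  have ht := hM.coideal m hm
  rw [rtrans, LinearMap.comp_apply, LinearMap.comp_apply, comul_mul_eq_gmul]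
  conv_rhs => rw [hb']
  clear hb'
  generalize Coalgebra.comul (R := K) b = s at hs ⊢
  rw [range_lTensor_eq_span] at ht
  generalize Coalgebra.comul (R := K) m = t at ht ⊢
  induction hs using Submodule.span_induction with
  | zero => simp
  | add x y _ _ hx hy => simp only [map_add, LinearMap.add_apply, add_mul, hx, hy]
  | smul c x _ hx => simp only [map_smul, LinearMap.smul_apply, smul_mul_assoc, hx]
  | mem s hs =>
    obtain ⟨x, hx, y, hy, rfl⟩ := hs
    induction ht using Submodule.span_induction with
    | zero => simp
    | add x y _ _ hx hy => simp only [map_add, mul_add, hx, hy]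
    | smul c x _ hx => simp only [map_smul, mul_smul_comm, hx]
    | mem t ht =>
      obtain ⟨a, w, hw, rfl⟩ := ht
      have h0 := G.counit_proj y
      rw [counitHom_apply, counitHom_apply] at h0
      rw [gmul_tmul, map_add, rslice_tmul, rslice_tmul, rslice_tmul, rslice_tmul,
        hη _ (Mor.sub_proj hy 0) _ hw, hη _ (Mor.sub_proj hy 1) _ hw,
        G.counit_odd _ (SAlg.proj_mem 1 y), zero_mul, zero_smul, add_zero, h0, smul_mul_smul_comm]

/-- The left side is ∑ S(v₁) v₂ η(v₃). This identity inverts the matrix of the maps `rtrans η` on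
lifts of a basis of the fibre. -/
theorem antipode_rtrans (η : G.alg.carrier →ₗ[K] K) (v : G.alg.carrier) :
    LinearMap.mul' K _ (TensorProduct.map G.antipode.toAlgHom.toLinearMap (rtrans η)
      (Coalgebra.comul (R := K) v)) = η v • (1 : G.alg.carrier) := by
  set μ : G.alg.carrier ⊗[K] G.alg.carrier →ₗ[K] G.alg.carrier := LinearMap.mul' K _ ∘ₗ
    G.antipode.toAlgHom.toLinearMap.rTensor _ with hμ
  have h2 : ∀ t : G.alg.carrier ⊗[K] G.alg.carrier,
      LinearMap.mul' K _ (TensorProduct.map G.antipode.toAlgHom.toLinearMap (rtrans η) t) =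
      rslice η (μ.rTensor G.alg.carrier ((TensorProduct.assoc K _ _ _).symm
        ((Coalgebra.comul (R := K)).lTensor _ t))) := by
    intro t
    induction t with
    | zero => simp
    | add x y hx hy => simp only [map_add, hx, hy]
    | tmul x y =>
      rw [TensorProduct.map_tmul, LinearMap.mul'_apply, LinearMap.lTensor_tmul, rtrans,
        LinearMap.comp_apply]
      generalize Coalgebra.comul (R := K) y = t
      induction t with
      | zero => simp
      | add x y hx hy => simp only [map_add, mul_add, TensorProduct.tmul_add, hx, hy]
      | tmul z w =>
        rw [TensorProduct.assoc_symm_tmul, LinearMap.rTensor_tmul, rslice_tmul, rslice_tmul,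
          mul_smul_comm]
        rfl
  rw [h2, Coalgebra.coassoc_symm_apply, ← LinearMap.comp_apply (f := μ.rTensor _),
    ← LinearMap.rTensor_comp]
  have h3 : μ ∘ₗ Coalgebra.comul = Algebra.linearMap K G.alg.carrier ∘ₗ
      Coalgebra.counit (R := K) (A := G.alg.carrier) := by
    ext a
    exact G.antipode_left a
  rw [h3, LinearMap.rTensor_comp, LinearMap.comp_apply, Coalgebra.rTensor_counit_comul]
  simp

/-- A finitely generated Hopf submodule is free near the identity, which is expressed by an even
element `t` with `ε(t) = 1` such that multiplication by `t` factors through a free module. -/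
theorem exists_traceSpan_eq_mul (hK : (2 : K) ≠ 0) {V M : Submodule K G.alg.carrier}
    (hV : IsLeftCoideal V) (hfg : V.FG) (hMV : M = Subalgebra.toSubmodule φ.sub * V) :
    ∃ t ∈ φ.sub, t ∈ G.alg.gr 0 ∧ Coalgebra.counit (R := K) t = 1 ∧
      ∃ F ∈ traceSpan φ M, ∀ m ∈ M, F m = t * m := by
  have hM : IsHopfSubmodule φ M :=
    { mul_mem := fun b hb m hm => by
        rw [hMV] at hm ⊢
        have h := Submodule.mul_mem_mul (M := Subalgebra.toSubmodule φ.sub) hb hm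
        rw [← mul_assoc] at h
        exact mul_submodule_mono_left (Submodule.mul_le.2 fun x hx y hy => φ.sub.mul_mem hx hy) h
      coideal := by rw [hMV]; exact hV.sub_mul }
  have hVM : V ≤ M := fun v hv => by
    have h := Submodule.mul_mem_mul (M := Subalgebra.toSubmodule φ.sub) (one_mem φ.sub) hv
    rwa [one_mul, ← hMV] at h
  obtain ⟨n, v, hv⟩ := Submodule.fg_iff_exists_fin_generating_family.1 hfg
  have hvV : ∀ i, v i ∈ V := fun i => by rw [← hv]; exact Submodule.subset_span ⟨i, rfl⟩
  -- `Bp` is the augmentation ideal B⁺ of B, and `N` = B⁺V = B⁺M. The image of V modulo `N` is thus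
  -- the fibre of M at the identity.
  set Bp : Submodule K G.alg.carrier := Subalgebra.toSubmodule φ.sub ⊓
    LinearMap.ker (Coalgebra.counit (R := K) (A := G.alg.carrier)) with hBp
  set N : Submodule K G.alg.carrier := Bp * V with hN
  have hBpM : ∀ b ∈ Bp, ∀ m ∈ M, b * m ∈ N := by
    intro b hb m hm
    rw [hMV] at hm
    have h := Submodule.mul_mem_mul hb hm
    rw [← mul_assoc] at h
    refine mul_submodule_mono_left ?_ h
    refine Submodule.mul_le.2 fun x hx y hy => ⟨φ.sub.mul_mem hx.1 hy, ?_⟩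
    have hx' : Coalgebra.counit (R := K) x = 0 := hx.2
    rw [SetLike.mem_coe, LinearMap.mem_ker, G.counit_mul, hx', zero_mul]
  -- a basis of the fibre of `M` at the identity
  have hfin : Module.Finite K (V.map N.mkQ) := Module.Finite.iff_fg.2 (hfg.map _)
  set r := Module.finrank K (V.map N.mkQ) with hr
  let w : Module.Basis (Fin r) K (V.map N.mkQ) := Module.finBasis K _
  have hlift : ∀ k, ∃ m ∈ V, N.mkQ m = (w k : G.alg.carrier ⧸ N) := fun k => (w k).2
  choose m hmV hmw using hlift
  have hext : ∀ k, ∃ η : (G.alg.carrier ⧸ N) →ₗ[K] K, η ∘ₗ (V.map N.mkQ).subtype = w.coord k :=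
    fun k => LinearMap.exists_extend (w.coord k)
  choose η' hη' using hext
  -- The dual basis of the fibre, extended to all of K[G] but still zero on B⁺M. This vanishing
  -- makes B act through ε, as `rtrans_mul` requires.
  let η : Fin r → G.alg.carrier →ₗ[K] K := fun k => η' k ∘ₗ N.mkQ
  have hηm : ∀ k l, η l (m k) = if k = l then 1 else 0 := by
    intro k l
    have h := LinearMap.congr_fun (hη' l) (w k)
    rw [LinearMap.comp_apply, Submodule.subtype_apply, ← hmw k] at h
    refine Eq.trans h ?_
    rw [Module.Basis.coord_apply, Module.Basis.repr_self, Finsupp.single_apply]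
  have hηN : ∀ l, ∀ x ∈ N, η l x = 0 := by
    intro l x hx
    change η' l (N.mkQ x) = 0
    rw [Submodule.mkQ_apply, (Submodule.Quotient.mk_eq_zero N).2 hx, map_zero]
  have hηmul : ∀ l, ∀ b ∈ φ.sub, ∀ x ∈ M,
      η l (b * x) = Coalgebra.counit (R := K) b * η l x := by
    intro l b hb x hx
    have hb' : b - algebraMap K _ (Coalgebra.counit (R := K) b) ∈ Bp := by
      refine ⟨φ.sub.sub_mem hb (φ.sub.algebraMap_mem _), ?_⟩
      rw [SetLike.mem_coe, LinearMap.mem_ker, map_sub, Algebra.algebraMap_eq_smul_one, map_smul, G.counit_one,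
        smul_eq_mul, mul_one, sub_self]
    have h := hηN l _ (hBpM _ hb' x hx)
    rw [sub_mul, map_sub, sub_eq_zero] at h
    rw [h, ← Algebra.smul_def, map_smul, smul_eq_mul]
  have hηv : ∀ x ∈ V, x - ∑ k, η k x • m k ∈ N := by
    intro x hx
    rw [← Submodule.Quotient.mk_eq_zero, ← Submodule.mkQ_apply, map_sub, sub_eq_zero, map_sum]
    have h := congrArg Subtype.val (w.sum_repr ⟨N.mkQ x, x, hx, rfl⟩)
    refine h.symm.trans ?_
    rw [AddSubmonoidClass.coe_finsetSum]
    refine Finset.sum_congr rfl fun k _ => ?_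
    rw [map_smul, hmw]
    have h2 := LinearMap.congr_fun (hη' k) ⟨N.mkQ x, x, hx, rfl⟩
    rw [Module.Basis.coord_apply] at h2
    rw [SetLike.val_smul, ← h2]
    rfl
  -- Nakayama's lemma
  have hβ : ∀ i, ∃ β : Fin n → H.alg.carrier, (∀ j, Coalgebra.counit (R := K) (β j) = 0) ∧
      v i - ∑ k, η k (v i) • m k = ∑ j, φ.comorphism.toAlgHom (β j) * v j := by
    intro i
    have h := hηv (v i) (hvV i)
    rw [hN, ← hv] at h
    obtain ⟨c, hc, hx⟩ := exists_sum_of_mem_mul_span Bp v h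
    have hc' : ∀ j, ∃ y : H.alg.carrier, φ.comorphism.toAlgHom y = c j := fun j => (hc j).1
    choose y hy using hc'
    refine ⟨y, fun j => ?_, ?_⟩
    · rw [← φ.counit_comp, hy]
      exact (hc j).2
    · simp only [hy]
      exact hx
  choose β hβ0 hβv using hβ
  -- The relations say that `P` sends the generators `v` to combinations of the `m k`. The
  -- coefficients were lifted to K[H] so that the adjugate, computed there, has image in B. Its even
  -- part reduces to the identity matrix under ε, so the scalar obtained has counit 1.
  let P : Matrix (Fin n) (Fin n) H.alg.carrier := 1 - Matrix.of β
  obtain ⟨k₀, Q, hQ⟩ := (SAlg.exists_superadjugate hK P).1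
  set d : H.alg.evenPart := (SAlg.evenMat P).det ^ k₀ with hd
  have hdε : Coalgebra.counit (R := K) (d : H.alg.carrier) = 1 := by
    let e : H.alg.evenPart →+* K := (H.counitHom.comp H.alg.evenPart.val).toRingHom
    have h1 : e (SAlg.evenMat P).det = 1 := by
      rw [RingHom.map_det]
      have : e.mapMatrix (SAlg.evenMat P) = 1 := by
        ext i j
        change H.counitHom (H.alg.proj 0 (P i j)) = _
        have hP : P i j = (1 : Matrix (Fin n) (Fin n) H.alg.carrier) i j - β i j := rfl
        rw [H.counit_proj, hP, map_sub, counitHom_apply _ (β i j),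
          hβ0, sub_zero, Matrix.one_apply, Matrix.one_apply]
        split_ifs <;> simp
      rw [this, Matrix.det_one]
    change e d = 1
    rw [hd, map_pow, h1, one_pow]
  set s : G.alg.carrier := φ.comorphism.toAlgHom (d : H.alg.carrier) with hs
  have hse : s ∈ G.alg.gr 0 := φ.comorphism.even 0 _ d.2
  have hsB : s ∈ φ.sub := ⟨_, rfl⟩
  have hsε : Coalgebra.counit (R := K) s = 1 := by rw [hs, φ.counit_comp, hdε]
  let y : Fin n → Fin r → G.alg.carrier := fun i k =>
    ∑ j, η k (v j) • φ.comorphism.toAlgHom (Q i j)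
  have hyB : ∀ i k, y i k ∈ φ.sub := fun i k =>
    sum_mem fun j _ => φ.sub.smul_mem ⟨_, rfl⟩ _
  have hsv : ∀ i, s * v i = ∑ k, y i k * m k := by
    intro i
    have h1 : ∀ j, ∑ l, φ.comorphism.toAlgHom (P j l) * v l = ∑ k, η k (v j) • m k := by
      intro j
      have h2 := hβv j
      rw [sub_eq_iff_eq_add'] at h2
      have h3 : ∑ l, φ.comorphism.toAlgHom (P j l) * v l =
          v j - ∑ l, φ.comorphism.toAlgHom (β j l) * v l := by
        simp only [P, Matrix.sub_apply, Matrix.of_apply, map_sub, sub_mul,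
          Finset.sum_sub_distrib, Matrix.one_apply]
        congr 1
        rw [Finset.sum_eq_single j] <;> simp +contextual [eq_comm]
      rw [h3, sub_eq_iff_eq_add, ← h2]
    have h4 : ∀ l, ∑ j, φ.comorphism.toAlgHom (Q i j) * φ.comorphism.toAlgHom (P j l) =
        if i = l then s else 0 := by
      intro l
      have h5 := congrArg (fun X => φ.comorphism.toAlgHom (X i l)) hQ
      simp only [Matrix.mul_apply, map_sum, map_mul, Matrix.smul_apply, Matrix.one_apply] at h5
      rw [h5]
      split_ifs
      · rw [hs, smul_eq_mul, mul_one]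
      · rw [smul_zero, map_zero]
    have h6 : s * v i = ∑ l, (if i = l then s else 0) * v l := by
      simp
    rw [h6]
    simp only [← h4, Finset.sum_mul]
    rw [Finset.sum_comm]
    simp only [y, mul_assoc, ← Finset.mul_sum, h1, Finset.sum_mul]
    simp only [Finset.mul_sum, mul_smul_comm, smul_mul_assoc]
    rw [Finset.sum_comm]
  have hvM : ∀ i, v i ∈ M := fun i => hVM (hvV i)
  have hmM : ∀ i, m i ∈ M := fun i => hVM (hmV i)
  -- the matrix of the `m k` with respect to the trivialization
  have hψ : ∀ l, ∀ b ∈ φ.sub, ∀ x ∈ M, rtrans (η l) (b * x) = b * rtrans (η l) x :=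
    fun l b hb x hx => rtrans_mul hM (hηmul l) hb hx
  let X : Matrix (Fin r) (Fin r) G.alg.carrier := Matrix.of fun k l => rtrans (η l) (m k)
  have hc : ∀ k, ∃ c : Fin n → G.alg.carrier,
      Coalgebra.comul (R := K) (m k) = ∑ j, c j ⊗ₜ[K] v j := fun k =>
    exists_sum_of_mem_range_lTensor v _ (by rw [hv]; exact hV _ (hmV k))
  choose c hc using hc
  -- Write δ(m_k) = ∑ c_kj ⊗ v_j. Then `antipode_rtrans` gives ∑ S(c_kj) · rtrans η_l (v_j) = δ_kl.
  -- Multiplying by s and substituting s v_j = ∑ y_jk' m_k' yields YX = s.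
  let Y : Matrix (Fin r) (Fin r) G.alg.carrier := Matrix.of fun k k' =>
    ∑ j, G.antipode.toAlgHom (c k j) * y j k'
  let s' : G.alg.evenPart := ⟨s, hse⟩
  have hYX : Y * X = (s' : G.alg.carrier) • 1 := by
    ext k l
    have h1 := antipode_rtrans (η l) (m k)
    rw [hc, map_sum, map_sum] at h1
    simp only [TensorProduct.map_tmul, LinearMap.mul'_apply, AlgHom.toLinearMap_apply] at h1
    have h2 : ∀ j, s * rtrans (η l) (v j) = ∑ k', y j k' * X k' l := by
      intro j
      rw [← hψ l s hsB _ (hvM j), hsv, map_sum]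
      exact Finset.sum_congr rfl fun k' _ => hψ l _ (hyB j k') _ (hmM k')
    rw [Matrix.mul_apply, Matrix.smul_apply, Matrix.one_apply]
    have h3 : ∑ k', Y k k' * X k' l = s * (η l (m k) • (1 : G.alg.carrier)) := by
      rw [← h1, Finset.mul_sum]
      simp only [Y, Matrix.of_apply, Finset.sum_mul, mul_assoc]
      rw [Finset.sum_comm]
      refine Finset.sum_congr rfl fun j _ => ?_
      rw [← mul_assoc, SAlg.even_comm hse, mul_assoc, h2, Finset.mul_sum]
    rw [h3, hηm, ite_smul, one_smul, zero_smul]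
    rfl
  obtain ⟨e, Z, hZ⟩ := SAlg.exists_right_inv_up_to_pow hK X Y s' hYX
  have hse' : s ^ e ∈ G.alg.gr 0 := (s' ^ e).2
  -- Applying the maps `rtrans (η j)` to a relation ∑ l_k m_k = 0 gives lX = 0, and the right
  -- inverse up to s^e gives s^e l = 0. So the `m k` are independent up to a power of s.
  have hkill : ∀ l : Fin r → G.alg.carrier, (∀ k, l k ∈ φ.sub) → ∑ k, l k * m k = 0 →
      ∀ k, s ^ e * l k = 0 := by
    intro l hl h0 k
    have h1 : Matrix.vecMul l X = 0 := by
      ext j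
      have h2 := congrArg (rtrans (η j)) h0
      rw [map_sum, map_zero] at h2
      refine Eq.trans ?_ h2
      rw [Matrix.vecMul, dotProduct]
      exact Finset.sum_congr rfl fun i _ => (hψ j _ (hl i) _ (hmM i)).symm
    have h3 := congrArg (fun u => Matrix.vecMul u Z k) h1
    simp only [Matrix.vecMul_vecMul, hZ, Matrix.zero_vecMul] at h3
    rw [SAlg.even_comm hse']
    refine Eq.trans ?_ h3
    have h5 : ∀ i, ((((s' ^ e : G.alg.evenPart) : G.alg.carrier) •
        (1 : Matrix (Fin r) (Fin r) G.alg.carrier)) i k) = if i = k then s ^ e else 0 := by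
      intro i
      rw [Matrix.smul_apply, Matrix.one_apply]
      split_ifs
      · rw [smul_eq_mul, mul_one]; rfl
      · rw [smul_zero]
    simp only [Matrix.vecMul, dotProduct, h5]
    simp
  -- a pseudo-inverse of the map given by the `m k`
  let Φ : (Fin r → φ.sub) →ₗ[K] G.alg.carrier :=
    { toFun := fun l => ∑ k, (l k : G.alg.carrier) * m k
      map_add' := fun l l' => by simp [add_mul, Finset.sum_add_distrib]
      map_smul' := fun a l => by simp [Finset.smul_sum] }
  obtain ⟨g', hg'⟩ := LinearMap.exists_rightInverse_of_surjective Φ.rangeRestrict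
    Φ.range_rangeRestrict
  obtain ⟨g, hg⟩ := LinearMap.exists_extend g'
  have hΦg : ∀ z ∈ LinearMap.range Φ, Φ (g z) = z := by
    intro z hz
    have h1 := congrArg Subtype.val (LinearMap.congr_fun hg' ⟨z, hz⟩)
    have h2 := LinearMap.congr_fun hg ⟨z, hz⟩
    change g z = g' ⟨z, hz⟩ at h2
    rw [h2]
    exact h1
  have hΦmul : ∀ b : φ.sub, ∀ l, Φ (fun k => b * l k) = b * Φ l := by
    intro b l
    change ∑ k, ((b * l k : φ.sub) : G.alg.carrier) * m k = b * ∑ k, (l k : G.alg.carrier) * m k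
    rw [Finset.mul_sum]
    simp only [Subalgebra.coe_mul, mul_assoc]
  have hsM : ∀ x ∈ M, s * x ∈ LinearMap.range Φ := by
    intro x hx
    rw [hMV, ← hv] at hx
    obtain ⟨a, ha, rfl⟩ := exists_sum_of_mem_mul_span _ v hx
    rw [Finset.mul_sum]
    refine sum_mem fun j _ => ⟨fun k => ⟨a j, ha j⟩ * ⟨y j k, hyB j k⟩, ?_⟩
    have h1 : Φ (fun k => ⟨y j k, hyB j k⟩) = s * v j := (hsv j).symm
    rw [hΦmul, h1, ← mul_assoc, ← mul_assoc, SAlg.even_comm hse]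
  -- The section `g` of `Φ` is only K-linear. Its failure to be B-linear is a relation among the `m
  -- k`, so the factor s^e removes it.
  let f : Fin r → G.alg.carrier →ₗ[K] G.alg.carrier := fun k =>
    LinearMap.mulLeft K (s ^ e) ∘ₗ φ.sub.val.toLinearMap ∘ₗ LinearMap.proj k ∘ₗ g ∘ₗ
      LinearMap.mulLeft K s
  have hf_apply : ∀ k x, f k x = s ^ e * (g (s * x) k : G.alg.carrier) := fun _ _ => rfl
  have hseB : s ^ e ∈ φ.sub := pow_mem hsB e
  have hf : ∀ k, IsModuleMap φ M (f k) := by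
    intro k
    refine ⟨fun x _ => φ.sub.mul_mem hseB (g (s * x) k).2, fun b hb x hx => ?_⟩
    rw [hf_apply, hf_apply]
    have h1 := hkill (fun k => (g (s * (b * x)) k : G.alg.carrier) - b * g (s * x) k)
      (fun k => φ.sub.sub_mem (g _ k).2 (φ.sub.mul_mem hb (g _ k).2)) (by
        have h2 : Φ (g (s * (b * x)) - fun k => ⟨b, hb⟩ * g (s * x) k) = 0 := by
          rw [map_sub, hΦg _ (hsM _ (hM.mul_mem b hb x hx)), hΦmul, hΦg _ (hsM x hx),
            ← mul_assoc, ← mul_assoc, SAlg.even_comm hse, sub_self]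
        exact h2) k
    rw [mul_sub, sub_eq_zero] at h1
    rw [h1, ← mul_assoc, ← mul_assoc, SAlg.even_comm hse']
  refine ⟨s ^ e * s, φ.sub.mul_mem hseB hsB, SAlg.even_mul_even hse' hse, ?_,
    ∑ k, LinearMap.mulRight K (m k) ∘ₗ f k,
    sum_mem fun k _ => Submodule.subset_span ⟨f k, hf k, m k, hmM k, rfl⟩, fun x hx => ?_⟩
  · rw [← counitHom_apply, map_mul, map_pow, counitHom_apply, hsε, one_pow, one_mul]
  · have h1 := hΦg _ (hsM x hx)
    rw [mul_assoc, ← h1]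
    change _ = s ^ e * ∑ k, (g (s * x) k : G.alg.carrier) * m k
    rw [LinearMap.sum_apply, Finset.mul_sum]
    refine Finset.sum_congr rfl fun k _ => ?_
    rw [LinearMap.comp_apply, LinearMap.mulRight_apply, hf_apply, mul_assoc]

end AffineSupergroup

end

end Super

/-! ### Projectivity of Hopf modules over the image, and unimodularity of 1 -/

namespace Super

noncomputable section

variable {K : Type u} [Field K]

namespace AffineSupergroup

variable {G H : AffineSupergroup K} {φ : Mor G H}

/-- Evenness makes b central, so that left multiplication by b respects the left B-module structure.
-/
theorem IsModuleMap.mulLeft_even {M : Submodule K G.alg.carrier}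
    {f : G.alg.carrier →ₗ[K] G.alg.carrier} (hf : IsModuleMap φ M f) {b : G.alg.carrier}
    (hb : b ∈ φ.sub) (hb0 : b ∈ G.alg.gr 0) : IsModuleMap φ M (LinearMap.mulLeft K b ∘ₗ f) where
  mem m hm := φ.sub.mul_mem hb (hf.mem m hm)
  map_mul c hc m hm := by
    simp only [LinearMap.comp_apply, LinearMap.mulLeft_apply, hf.map_mul c hc m hm]
    rw [← mul_assoc, ← mul_assoc, SAlg.even_comm hb0]

theorem IsModuleMap.mulRight {M : Submodule K G.alg.carrier}
    {f : G.alg.carrier →ₗ[K] G.alg.carrier} (hf : IsModuleMap φ M f) {b : G.alg.carrier}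
    (hb : b ∈ φ.sub) : IsModuleMap φ M (LinearMap.mulRight K b ∘ₗ f) where
  mem m hm := φ.sub.mul_mem (hf.mem m hm) hb
  map_mul c hc m hm := by
    simp only [LinearMap.comp_apply, LinearMap.mulRight_apply, hf.map_mul c hc m hm, mul_assoc]

theorem IsModuleMap.smul {M : Submodule K G.alg.carrier}
    {f : G.alg.carrier →ₗ[K] G.alg.carrier} (hf : IsModuleMap φ M f) (a : K) :
    IsModuleMap φ M (a • f) where
  mem m hm := φ.sub.smul_mem (hf.mem m hm) a
  map_mul c hc m hm := by
    simp only [LinearMap.smul_apply, hf.map_mul c hc m hm, mul_smul_comm]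

theorem IsModuleMap.add {M : Submodule K G.alg.carrier}
    {f g : G.alg.carrier →ₗ[K] G.alg.carrier} (hf : IsModuleMap φ M f) (hg : IsModuleMap φ M g) :
    IsModuleMap φ M (f + g) where
  mem m hm := φ.sub.add_mem (hf.mem m hm) (hg.mem m hm)
  map_mul c hc m hm := by
    simp only [LinearMap.add_apply, hf.map_mul c hc m hm, hg.map_mul c hc m hm, mul_add]

theorem isModuleMap_zero (M : Submodule K G.alg.carrier) : IsModuleMap φ M 0 where
  mem m hm := φ.sub.zero_mem
  map_mul c hc m hm := by simp

theorem mulLeft_comp_mem_traceSpan {M : Submodule K G.alg.carrier}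
    {F : G.alg.carrier →ₗ[K] G.alg.carrier} (hF : F ∈ traceSpan φ M) {b : G.alg.carrier}
    (hb : b ∈ φ.sub) (hb0 : b ∈ G.alg.gr 0) : LinearMap.mulLeft K b ∘ₗ F ∈ traceSpan φ M := by
  induction hF using Submodule.span_induction with
  | zero => rw [LinearMap.comp_zero]; exact zero_mem _
  | add x y _ _ hx hy => rw [LinearMap.comp_add]; exact add_mem hx hy
  | smul c x _ hx => rw [LinearMap.comp_smul]; exact Submodule.smul_mem _ c hx
  | mem F hF =>
    obtain ⟨f, hf, m₀, hm₀, rfl⟩ := hF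
    refine Submodule.subset_span ⟨_, hf.mulLeft_even hb hb0, m₀, hm₀, ?_⟩
    ext x
    simp [mul_assoc]

theorem exists_sum_of_mem_traceSpan {M : Submodule K G.alg.carrier}
    {F : G.alg.carrier →ₗ[K] G.alg.carrier} (hF : F ∈ traceSpan φ M) :
    ∃ (n : ℕ) (f : Fin n → G.alg.carrier →ₗ[K] G.alg.carrier) (m : Fin n → G.alg.carrier),
      (∀ i, IsModuleMap φ M (f i)) ∧ (∀ i, m i ∈ M) ∧ ∀ x, F x = ∑ i, f i x * m i := by
  obtain ⟨n, a, g, rfl⟩ := Submodule.mem_span_set'.1 hF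
  choose f hf m hm hg using fun i => (g i).2
  refine ⟨n, fun i => a i • f i, m, fun i => (hf i).smul _, hm, fun x => ?_⟩
  rw [LinearMap.sum_apply]
  refine Finset.sum_congr rfl fun i _ => ?_
  rw [LinearMap.smul_apply, hg, LinearMap.comp_apply, LinearMap.mulRight_apply,
    LinearMap.smul_apply, smul_mul_assoc]

section

variable {R : Type u} [CommRing R] [Algebra K R] (π : G.alg.carrier →ₐ[K] R)
  (hπ : ∀ a ∈ G.alg.gr 1, π a = 0)

/-- The slices of the translate of an even element are even. -/
theorem slice_trans_even {a : G.alg.carrier} (ha : a ∈ G.alg.gr 0) (ξ : R →ₗ[K] K) :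
    slice ξ (trans π hπ a) ∈ G.alg.gr 0 := by
  have hle : tensorGr G.alg.gr G.alg.gr 0 ≤ (G.alg.gr 0).comap
      (slice ξ ∘ₗ TensorProduct.map π.toLinearMap LinearMap.id) := by
    refine iSup_le fun j => Submodule.map₂_le.2 fun x hx y hy => ?_
    rw [Submodule.mem_comap, LinearMap.comp_apply, TensorProduct.mk_apply, TensorProduct.map_tmul,
      slice_tmul]
    obtain rfl | rfl : j = 0 ∨ j = 1 := by
      clear hx hy; revert j; decide
    · rw [sub_zero] at hy
      exact Submodule.smul_mem _ _ hy
    · rw [AlgHom.toLinearMap_apply, hπ x hx, map_zero, zero_smul]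
      exact zero_mem _
  exact hle (G.comul_even 0 a ha)

theorem slice_transInv_mem_sub {b : G.alg.carrier} (hb : b ∈ φ.sub) (ξ : R →ₗ[K] K) :
    slice ξ (transInv π hπ b) ∈ φ.sub :=
  (mem_range_lTensor_iff (Subalgebra.toSubmodule φ.sub) _).1
    (trans_mem (π.comp G.antipode.toAlgHom) (antipode_point_odd π hπ) isLeftCoideal_sub hb) ξ

theorem slice_mul_one_tmul (ξ : R →ₗ[K] K) (m : G.alg.carrier) (t : R ⊗[K] G.alg.carrier) :
    slice ξ (t * (1 ⊗ₜ[K] m)) = slice ξ t * m := by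
  induction t with
  | zero => simp
  | add x y hx hy => simp only [map_add, add_mul, hx, hy]
  | tmul x y =>
    rw [Algebra.TensorProduct.tmul_mul_tmul, slice_tmul, slice_tmul, mul_one, smul_mul_assoc]

/-- Conjugation of a linear map that is multiplication by `t` on `M`. -/
theorem slice_conj_eq_mul {M : Submodule K G.alg.carrier} (hM : IsHopfSubmodule φ M)
    {F : G.alg.carrier →ₗ[K] G.alg.carrier} {t : G.alg.carrier} (hF : ∀ m ∈ M, F m = t * m)
    (ξ : R →ₗ[K] K) {m : G.alg.carrier} (hm : m ∈ M) :
    (slice ξ ∘ₗ conj π hπ F) m = slice ξ (transInv π hπ t) * m := by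
  have h1 : F.lTensor R (trans π hπ m) = (1 ⊗ₜ[K] t) * trans π hπ m := by
    have h := trans_mem π hπ hM.coideal hm
    rw [range_lTensor_eq_span] at h
    generalize trans π hπ m = s at h ⊢
    induction h using Submodule.span_induction with
    | zero => simp
    | add x y _ _ hx hy => simp only [map_add, mul_add, hx, hy]
    | smul c x _ hx => simp only [map_smul, mul_smul_comm, hx]
    | mem s hs =>
      obtain ⟨r, y, hy, rfl⟩ := hs
      rw [LinearMap.lTensor_tmul, Algebra.TensorProduct.tmul_mul_tmul, hF y hy, one_mul]
  rw [LinearMap.comp_apply, conj_apply, h1, map_mul, transInvExt_trans, transInvExt_one_tmul,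
    slice_mul_one_tmul]

end

/-- The image of `φ^*` is projective in `K[G]`: every finite subset of `K[G]` lies in a finitely
generated projective submodule that contains the image of `φ^*` as a direct summand. -/
theorem exists_projective_submodule (hK : (2 : K) ≠ 0) (φ : Mor G H) (S : Finset G.alg.carrier) :
    ∃ M : Submodule K G.alg.carrier, (∀ b ∈ φ.sub, ∀ m ∈ M, b * m ∈ M) ∧ 1 ∈ M ∧
      (∀ x ∈ S, x ∈ M) ∧ (∀ i, ∀ m ∈ M, G.alg.proj i m ∈ M) ∧
      (∃ (n : ℕ) (f : Fin n → G.alg.carrier →ₗ[K] G.alg.carrier) (m : Fin n → G.alg.carrier),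
        (∀ i, IsModuleMap φ M (f i)) ∧ (∀ i, m i ∈ M) ∧ ∀ x ∈ M, ∑ i, f i x * m i = x) ∧
      ∃ r, IsModuleMap φ M r ∧ r 1 = 1 := by
  classical
  obtain ⟨V, hV, hfg, hSV, hVgr⟩ := exists_graded_leftCoideal (insert 1 S)
  set M := Subalgebra.toSubmodule φ.sub * V with hMV
  have hM : IsHopfSubmodule φ M :=
    { mul_mem := fun b hb m hm => by
        have h := Submodule.mul_mem_mul (M := Subalgebra.toSubmodule φ.sub) hb hm
        rw [hMV, ← mul_assoc] at h
        exact mul_submodule_mono_left (Submodule.mul_le.2 fun x hx y hy => φ.sub.mul_mem hx hy) h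
      coideal := hV.sub_mul }
  have hVM : V ≤ M := fun v hv => by
    have h := Submodule.mul_mem_mul (M := Subalgebra.toSubmodule φ.sub) (one_mem φ.sub) hv
    rwa [one_mul] at h
  have h1M : 1 ∈ M := hVM (hSV (Finset.mem_insert_self 1 S))
  have hMgr : ∀ i, ∀ m ∈ M, G.alg.proj i m ∈ M := by
    intro i m hm
    induction hm using Submodule.mul_induction_on' with
    | add x _ y _ hx hy => rw [map_add]; exact add_mem hx hy
    | mem_mul_mem b hb v hv =>
      have hmm : ∀ j k, G.alg.proj j b * G.alg.proj k v ∈ M := fun j k =>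
        Submodule.mul_mem_mul (Mor.sub_proj hb j) (hVgr k v hv)
      obtain rfl | rfl : i = 0 ∨ i = 1 := by
        revert i; decide
      · rw [SAlg.proj_zero_mul]
        exact add_mem (hmm _ _) (hmm _ _)
      · rw [SAlg.proj_one_mul]
        exact add_mem (hmm _ _) (hmm _ _)
  have hodd : ∀ a ∈ G.alg.gr 1, G.alg.toRed hK a = 0 := fun _ h => SAlg.toRed_odd hK h
  -- projectivity
  let T : Submodule K G.alg.carrier :=
    { carrier := {t | t ∈ φ.sub ∧ t ∈ G.alg.gr 0 ∧ ∃ F ∈ traceSpan φ M, ∀ m ∈ M, F m = t * m}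
      zero_mem' := ⟨zero_mem _, zero_mem _, 0, zero_mem _, by simp⟩
      add_mem' := by
        rintro t t' ⟨h1, h2, F, hF, h⟩ ⟨h1', h2', F', hF', h'⟩
        exact ⟨add_mem h1 h1', add_mem h2 h2', F + F', add_mem hF hF', fun m hm => by
          rw [LinearMap.add_apply, h m hm, h' m hm, add_mul]⟩
      smul_mem' := by
        rintro c t ⟨h1, h2, F, hF, h⟩
        exact ⟨φ.sub.smul_mem h1 c, Submodule.smul_mem _ c h2, c • F,
          Submodule.smul_mem _ c hF, fun m hm => by
          rw [LinearMap.smul_apply, h m hm, smul_mul_assoc]⟩ }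
  have hTmul : ∀ t ∈ T, ∀ b ∈ φ.sub, b ∈ G.alg.gr 0 → t * b ∈ T := by
    rintro t ⟨h1, h2, F, hF, h⟩ b hb hb0
    refine ⟨φ.sub.mul_mem h1 hb, SAlg.even_mul_even h2 hb0, _,
      mulLeft_comp_mem_traceSpan hF hb hb0, fun m hm => ?_⟩
    rw [LinearMap.comp_apply, h m hm, LinearMap.mulLeft_apply, SAlg.even_comm h2 b, mul_assoc]
  -- The element of counit 1 from generic freeness is moved by translation to an element that is 1
  -- in the reduced algebra. This element has an inverse inside B, and `T` absorbs that inverse.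
  have hT1 : (1 : G.alg.carrier) ∈ T := by
    obtain ⟨t, ht, ht0, htε, F, hF, hFt⟩ := exists_traceSpan_eq_mul (φ := φ) hK hV hfg hMV
    obtain ⟨w, hw, hw1⟩ := exists_toRed_eq_one (φ := φ) hK T (fun w hw => hw.1) hTmul
      (by
        rintro w ⟨h1, h2, F, hF, h⟩ ξ
        exact ⟨slice_transInv_mem_sub _ hodd h1 ξ,
          slice_trans_even _ (antipode_point_odd _ hodd) h2 ξ,
          _, slice_conj_mem_traceSpan _ hodd hM hF ξ,
          fun m hm => slice_conj_eq_mul _ hodd hM h ξ hm⟩)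
      (w := t) ⟨ht, ht0, F, hF, hFt⟩ htε
    obtain ⟨b, hb, hwb, hb0⟩ := SAlg.exists_inv_of_toRed_eq_one hK φ.sub
      (Mor.sub_proj hw.1 0) (Mor.sub_proj hw.1 1) hw1
    rw [← hwb]
    exact hTmul w hw b hb (hb0 hw.2.1)
  obtain ⟨-, -, F, hF, hF1⟩ := hT1
  obtain ⟨n, f, m, hf, hm, hsum⟩ := exists_sum_of_mem_traceSpan hF
  have hdual : ∀ x ∈ M, ∑ i, f i x * m i = x := fun x hx => by
    rw [← hsum, hF1 x hx, one_mul]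
  -- the element `1` is unimodular
  let U : Submodule K G.alg.carrier :=
    { carrier := {x | ∃ r, IsModuleMap φ M r ∧ r 1 = x}
      zero_mem' := ⟨0, isModuleMap_zero M, rfl⟩
      add_mem' := by
        rintro _ _ ⟨r, hr, rfl⟩ ⟨r', hr', rfl⟩
        exact ⟨r + r', hr.add hr', rfl⟩
      smul_mem' := by
        rintro c _ ⟨r, hr, rfl⟩
        exact ⟨c • r, hr.smul c, rfl⟩ }
  have hUmul : ∀ x ∈ U, ∀ b ∈ φ.sub, x * b ∈ U := by
    rintro _ ⟨r, hr, rfl⟩ b hb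
    exact ⟨_, hr.mulRight hb, rfl⟩
  have hUB : ∀ x ∈ U, x ∈ φ.sub := by
    rintro _ ⟨r, hr, rfl⟩
    exact hr.mem 1 h1M
  -- Apply ε to the dual basis identity 1 = ∑ fᵢ(1)mᵢ: the elements fᵢ(1) of `U` cannot all have
  -- counit zero.
  have hUε : ∃ x ∈ U, Coalgebra.counit (R := K) x = 1 := by
    by_contra hcon
    have h0 : ∀ x ∈ U, Coalgebra.counit (R := K) x = 0 := by
      intro x hx
      by_contra hne
      refine hcon ⟨(Coalgebra.counit (R := K) x)⁻¹ • x, Submodule.smul_mem _ _ hx, ?_⟩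
      rw [map_smul, smul_eq_mul, inv_mul_cancel₀ hne]
    have h1 := congrArg (Coalgebra.counit (R := K)) (hdual 1 h1M)
    rw [map_sum, G.counit_one] at h1
    refine zero_ne_one (α := K) (Eq.trans ?_ h1)
    refine (Finset.sum_eq_zero fun i _ => ?_).symm
    rw [G.counit_mul, h0 _ ⟨f i, hf i, rfl⟩, zero_mul]
  have hU1 : (1 : G.alg.carrier) ∈ U := by
    obtain ⟨x, hx, hxε⟩ := hUε
    obtain ⟨w, hw, hw1⟩ := exists_toRed_eq_one (φ := φ) hK U hUB
      (fun w hw b hb _ => hUmul w hw b hb)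
      (by
        rintro _ ⟨r, hr, rfl⟩ ξ
        -- Translation fixes 1, so the conjugate of r takes at 1 the value given by the inverse
        -- translate of r(1). Hence slices of that translate are again values at 1 of module maps.
        refine ⟨_, hr.slice_conj _ hodd hM ξ, ?_⟩
        rw [LinearMap.comp_apply, conj_apply, map_one, Algebra.TensorProduct.one_def,
          LinearMap.lTensor_tmul, transInvExt_one_tmul]) hx hxε
    obtain ⟨b, hb, hwb, -⟩ := SAlg.exists_inv_of_toRed_eq_one hK φ.sub
      (Mor.sub_proj (hUB w hw) 0) (Mor.sub_proj (hUB w hw) 1) hw1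
    rw [← hwb]
    exact hUmul w hw b hb
  exact ⟨M, hM.mul_mem, h1M, fun x hx => hVM (hSV (Finset.mem_insert_of_mem hx)), hMgr,
    ⟨n, f, m, hf, hm, hdual⟩, hU1⟩

end AffineSupergroup

end

end Super

namespace Super

noncomputable section

variable {K : Type u} [Field K]

/-! ### Faithful flatness of locally projective modules -/

section LocallyProjective

variable {S : Type u} [Ring S] [Algebra K S]

/-- The left `S`-module `Y` is a directed union of finitely generated projective submodules in
which a fixed element `y₀` is unimodular. -/
def IsLocallyProjective {Y : Type u} [AddCommGroup Y] [Module K Y]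
    (act : S →ₗ[K] Y →ₗ[K] Y) : Prop :=
  ∃ y₀ : Y, ∀ F : Finset Y, ∃ M : Submodule K Y, (∀ y ∈ F, y ∈ M) ∧
    (∃ (ι : Type) (_ : Fintype ι) (c : ι → Y →ₗ[K] S) (m : ι → Y),
      (∀ i, ∀ s, ∀ y ∈ M, c i (act s y) = s * c i y) ∧
      ∀ y ∈ M, ∑ i, act (c i y) (m i) = y) ∧
    ∃ r : Y →ₗ[K] S, (∀ s, ∀ y ∈ M, r (act s y) = s * r y) ∧ r y₀ = 1

theorem IsLocallyProjective.of_equiv {Y Y' : Type u} [AddCommGroup Y] [Module K Y]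
    [AddCommGroup Y'] [Module K Y'] {act : S →ₗ[K] Y →ₗ[K] Y} {act' : S →ₗ[K] Y' →ₗ[K] Y'}
    (h : IsLocallyProjective act) (e : Y ≃ₗ[K] Y') (he : ∀ s y, e (act s y) = act' s (e y)) :
    IsLocallyProjective act' := by
  classical
  obtain ⟨y₀, h⟩ := h
  have he' : ∀ s y, e.symm (act' s y) = act s (e.symm y) := fun s y => by
    rw [LinearEquiv.symm_apply_eq, he, LinearEquiv.apply_symm_apply]
  refine ⟨e y₀, fun F => ?_⟩
  obtain ⟨M, hF, ⟨ι, _, c, m, hc, hm⟩, r, hr, hr1⟩ := h (F.image e.symm)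
  refine ⟨M.comap e.symm.toLinearMap, fun y hy => hF _ (Finset.mem_image_of_mem _ hy),
    ⟨ι, inferInstance, fun i => c i ∘ₗ e.symm.toLinearMap, fun i => e (m i), ?_, ?_⟩,
    r ∘ₗ e.symm.toLinearMap, ?_, ?_⟩
  · intro i s y hy
    simp only [LinearMap.comp_apply, LinearEquiv.coe_coe, he']
    exact hc i s _ hy
  · intro y hy
    have h1 := congrArg e (hm _ hy)
    rw [map_sum] at h1
    simpa [he] using h1
  · intro s y hy
    simp only [LinearMap.comp_apply, LinearEquiv.coe_coe, he']
    exact hr s _ hy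
  · simp [hr1]

variable {X : Type u} [AddCommGroup X] [Module K X] {Y : Type u} [AddCommGroup Y] [Module K Y]

/-- The relations `x s ⊗ y = x ⊗ s y` defining `X ⊗_S Y`. -/
def balancedRel (actX : S →ₗ[K] X →ₗ[K] X) (actY : S →ₗ[K] Y →ₗ[K] Y) : Submodule K (X ⊗[K] Y) :=
  Submodule.span K {t | ∃ (x : X) (s : S) (y : Y), t = actX s x ⊗ₜ[K] y - x ⊗ₜ[K] actY s y}

/-- Contraction of a tensor with a linear form with values in `S`. -/
def contract (actX : S →ₗ[K] X →ₗ[K] X) (c : Y →ₗ[K] S) : X ⊗[K] Y →ₗ[K] X :=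
  TensorProduct.lift (actX ∘ₗ c).flip

theorem contract_tmul (actX : S →ₗ[K] X →ₗ[K] X) (c : Y →ₗ[K] S) (x : X) (y : Y) :
    contract actX c (x ⊗ₜ[K] y) = actX (c y) x := rfl

/-- A member of the span uses finitely many relations, so only finitely many instances of linearity
of c are needed. This is why forms that are linear merely on a submodule M suffice. -/
theorem exists_finset_contract_eq_zero {actX : S →ₗ[K] X →ₗ[K] X} {actY : S →ₗ[K] Y →ₗ[K] Y}
    (hmul : ∀ s s' x, actX (s * s') x = actX s' (actX s x)) {t : X ⊗[K] Y}
    (ht : t ∈ balancedRel actX actY) :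
    ∃ F : Finset Y, ∀ c : Y →ₗ[K] S, (∀ s, ∀ y ∈ F, c (actY s y) = s * c y) →
      contract actX c t = 0 := by
  classical
  induction ht using Submodule.span_induction with
  | mem t ht =>
    obtain ⟨x, s, y, rfl⟩ := ht
    refine ⟨{y}, fun c hc => ?_⟩
    rw [map_sub, contract_tmul, contract_tmul, hc s y (Finset.mem_singleton_self y), hmul, sub_self]
  | zero => exact ⟨∅, fun c _ => map_zero _⟩
  | add x y _ _ hx hy =>
    obtain ⟨F, hF⟩ := hx
    obtain ⟨F', hF'⟩ := hy
    refine ⟨F ∪ F', fun c hc => ?_⟩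
    rw [map_add, hF c fun s y hy => hc s y (Finset.mem_union_left _ hy),
      hF' c fun s y hy => hc s y (Finset.mem_union_right _ hy), add_zero]
  | smul a x _ hx =>
    obtain ⟨F, hF⟩ := hx
    exact ⟨F, fun c hc => by rw [map_smul, hF c hc, smul_zero]⟩

/-- If y = ∑ cᵢ(y)mᵢ, then x ⊗ y is congruent to ∑ x cᵢ(y) ⊗ mᵢ. The identity is needed only for the
finitely many y occurring in t. -/
theorem exists_finset_sub_sum_contract_mem (actX : S →ₗ[K] X →ₗ[K] X)
    (actY : S →ₗ[K] Y →ₗ[K] Y) (t : X ⊗[K] Y) :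
    ∃ F : Finset Y, ∀ (ι : Type) [Fintype ι] (c : ι → Y →ₗ[K] S) (m : ι → Y),
      (∀ y ∈ F, ∑ i, actY (c i y) (m i) = y) →
      t - ∑ i, contract actX (c i) t ⊗ₜ[K] m i ∈ balancedRel actX actY := by
  classical
  induction t with
  | zero => exact ⟨∅, fun ι _ c m _ => by simp⟩
  | add x y hx hy =>
    obtain ⟨F, hF⟩ := hx
    obtain ⟨F', hF'⟩ := hy
    refine ⟨F ∪ F', fun ι _ c m h => ?_⟩
    have h1 := add_mem (hF ι c m fun y hy => h y (Finset.mem_union_left _ hy))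
      (hF' ι c m fun y hy => h y (Finset.mem_union_right _ hy))
    simp only [map_add, TensorProduct.add_tmul, Finset.sum_add_distrib]
    convert h1 using 1
    abel
  | tmul x y =>
    refine ⟨{y}, fun ι _ c m h => ?_⟩
    have h1 := h y (Finset.mem_singleton_self y)
    have h2 : x ⊗ₜ[K] y - ∑ i, contract actX (c i) (x ⊗ₜ[K] y) ⊗ₜ[K] m i =
        -∑ i, (actX (c i y) x ⊗ₜ[K] m i - x ⊗ₜ[K] actY (c i y) (m i)) := by
      rw [Finset.sum_sub_distrib, ← TensorProduct.tmul_sum, h1, neg_sub]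
      rfl
    rw [h2]
    exact neg_mem (sum_mem fun i _ => Submodule.subset_span ⟨x, c i y, m i, rfl⟩)

/-- Locally projective modules are faithfully flat. -/
theorem IsLocallyProjective.exact_iff {actY : S →ₗ[K] Y →ₗ[K] Y} (hY : IsLocallyProjective actY)
    {X' X'' : Type u} [AddCommGroup X'] [Module K X'] [AddCommGroup X''] [Module K X'']
    (actX' : S →ₗ[K] X' →ₗ[K] X') (actX : S →ₗ[K] X →ₗ[K] X) (actX'' : S →ₗ[K] X'' →ₗ[K] X'')
    (hmul : ∀ s s' x, actX (s * s') x = actX s' (actX s x))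
    (hmul'' : ∀ s s' x, actX'' (s * s') x = actX'' s' (actX'' s x))
    (hone : ∀ x, actX 1 x = x) (hone'' : ∀ x, actX'' 1 x = x)
    (f : X' →ₗ[K] X) (g : X →ₗ[K] X'') (hf : ∀ s x, f (actX' s x) = actX s (f x))
    (hg : ∀ s x, g (actX s x) = actX'' s (g x)) :
    Function.Exact f g ↔ ∀ t : X ⊗[K] Y, g.rTensor Y t ∈ balancedRel actX'' actY ↔
      ∃ t' : X' ⊗[K] Y, t - f.rTensor Y t' ∈ balancedRel actX actY := by
  classical
  have hcg : ∀ (c : Y →ₗ[K] S) (t : X ⊗[K] Y),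
      contract actX'' c (g.rTensor Y t) = g (contract actX c t) := by
    intro c t
    induction t with
    | zero => simp
    | add x y hx hy => simp only [map_add, hx, hy]
    | tmul x y => rw [LinearMap.rTensor_tmul, contract_tmul, contract_tmul, hg]
  have hcf : ∀ (c : Y →ₗ[K] S) (t : X' ⊗[K] Y),
      contract actX c (f.rTensor Y t) = f (contract actX' c t) := by
    intro c t
    induction t with
    | zero => simp
    | add x y hx hy => simp only [map_add, hx, hy]
    | tmul x y => rw [LinearMap.rTensor_tmul, contract_tmul, contract_tmul, hf]
  obtain ⟨y₀, hY⟩ := hY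
  constructor
  · intro hex t
    constructor
    · intro ht
      obtain ⟨F, hF⟩ := exists_finset_contract_eq_zero hmul'' ht
      obtain ⟨F', hF'⟩ := exists_finset_sub_sum_contract_mem actX actY t
      obtain ⟨M, hM, ⟨ι, _, c, m, hc, hm⟩, -⟩ := hY (F ∪ F')
      -- Contraction commutes with g and kills the balanced relations, so each contraction of t lies
      -- in the kernel of g and lifts along f.
      have h1 : ∀ i, ∃ x', f x' = contract actX (c i) t := fun i => by
        refine (hex _).1 ?_
        rw [← hcg]
        exact hF (c i) fun s y hy => hc i s y (hM y (Finset.mem_union_left _ hy))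
      choose x' hx' using h1
      refine ⟨∑ i, x' i ⊗ₜ[K] m i, ?_⟩
      rw [map_sum]
      simp only [LinearMap.rTensor_tmul, hx']
      exact hF' ι c m fun y hy => hm y (hM y (Finset.mem_union_right _ hy))
    · rintro ⟨t', ht'⟩
      have h1 : ∀ t ∈ balancedRel actX actY, g.rTensor Y t ∈ balancedRel actX'' actY := by
        intro t ht
        induction ht using Submodule.span_induction with
        | mem t ht =>
          obtain ⟨x, s, y, rfl⟩ := ht
          exact Submodule.subset_span ⟨g x, s, y, by
            rw [map_sub, LinearMap.rTensor_tmul, LinearMap.rTensor_tmul, hg]⟩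
        | zero => rw [map_zero]; exact zero_mem _
        | add x y _ _ hx hy => rw [map_add]; exact add_mem hx hy
        | smul a x _ hx => rw [map_smul]; exact Submodule.smul_mem _ a hx
      have h2 := h1 _ ht'
      have h3 : g ∘ₗ f = 0 := LinearMap.ext fun x => hex.apply_apply_eq_zero x
      rwa [map_sub, ← LinearMap.comp_apply, ← LinearMap.rTensor_comp, h3, LinearMap.rTensor_zero,
        LinearMap.zero_apply, sub_zero] at h2
  · intro hex x
    constructor
    · intro hx
      -- Faithfulness: test on x ⊗ y₀, then contract with a form of value 1 at y₀ to recover x.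
      obtain ⟨t', ht'⟩ := (hex (x ⊗ₜ[K] y₀)).1 (by
        rw [LinearMap.rTensor_tmul, hx, TensorProduct.zero_tmul]
        exact zero_mem _)
      obtain ⟨F, hF⟩ := exists_finset_contract_eq_zero hmul ht'
      obtain ⟨M, hM, -, r, hr, hr1⟩ := hY F
      have h1 := hF r fun s y hy => hr s y (hM y hy)
      rw [map_sub, contract_tmul, hr1, hone, hcf, sub_eq_zero] at h1
      exact ⟨_, h1.symm⟩
    · rintro ⟨x', rfl⟩
      have h1 := (hex (f x' ⊗ₜ[K] y₀)).2 ⟨x' ⊗ₜ[K] y₀, by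
        rw [LinearMap.rTensor_tmul, sub_self]; exact zero_mem _⟩
      obtain ⟨F, hF⟩ := exists_finset_contract_eq_zero hmul'' h1
      obtain ⟨M, hM, -, r, hr, hr1⟩ := hY F
      have h2 := hF r fun s y hy => hr s y (hM y hy)
      rwa [LinearMap.rTensor_tmul, contract_tmul, hr1, hone''] at h2

/-- Locally projective modules are faithfully flat. -/
theorem IsLocallyProjective.isFaithfullyFlat {R : SAlg K} {act : R.carrier →ₐ[K] Module.End K Y}
    (hY : IsLocallyProjective (S := R.carrier) (Y := Y) act.toLinearMap) :
    IsFaithfullyFlat act := by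
  intro X' X X'' f g
  let actR : ∀ Z : RightSupermodule R, R.carrier →ₗ[K] Z.carrier →ₗ[K] Z.carrier := fun Z =>
    LinearMap.mk₂ K (fun r x => MulOpposite.op r • x)
      (fun r s x => by rw [MulOpposite.op_add, add_smul])
      (fun a r x => by rw [MulOpposite.op_smul, smul_assoc])
      (fun r x y => smul_add _ _ _)
      (fun a r x => by rw [smul_comm])
  have hrel : ∀ Z : RightSupermodule R, tensorRel Z act = balancedRel (actR Z) act.toLinearMap :=
    fun Z => rfl
  rw [hY.exact_iff (actR X') (actR X) (actR X'') (fun s s' x => mul_smul (MulOpposite.op s') (MulOpposite.op s) x)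
    (fun s s' x => mul_smul (MulOpposite.op s') (MulOpposite.op s) x) (fun x => one_smul R.carrierᵐᵒᵖ x)
    (fun x => one_smul R.carrierᵐᵒᵖ x) f.lin g.lin (fun s x => f.map_smul _ _)
    (fun s x => g.map_smul _ _)]
  constructor
  · intro h y
    obtain ⟨t, rfl⟩ := Submodule.Quotient.mk_surjective _ y
    have h1 : (tensorMap g act (Submodule.Quotient.mk t) = 0) ↔
        g.lin.rTensor Y t ∈ balancedRel (actR X'') act.toLinearMap :=
      Submodule.Quotient.mk_eq_zero _
    rw [h1, h t]
    constructor
    · rintro ⟨t', ht'⟩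
      exact ⟨Submodule.Quotient.mk t', ((Submodule.Quotient.eq _).2 ht').symm⟩
    · rintro ⟨y', hy'⟩
      obtain ⟨t', rfl⟩ := Submodule.Quotient.mk_surjective _ y'
      exact ⟨t', (Submodule.Quotient.eq _).1 hy'.symm⟩
  · intro h t
    have h1 : (tensorMap g act (Submodule.Quotient.mk t) = 0) ↔
        g.lin.rTensor Y t ∈ balancedRel (actR X'') act.toLinearMap :=
      Submodule.Quotient.mk_eq_zero _
    rw [← h1, h]
    constructor
    · rintro ⟨y', hy'⟩
      obtain ⟨t', rfl⟩ := Submodule.Quotient.mk_surjective _ y'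
      exact ⟨t', (Submodule.Quotient.eq _).1 hy'.symm⟩
    · rintro ⟨t', ht'⟩
      exact ⟨Submodule.Quotient.mk t', ((Submodule.Quotient.eq _).2 ht').symm⟩

end LocallyProjective

/-! ### Local projectivity of K[G] over the image, on both sides -/

namespace AffineSupergroup

variable {G H : AffineSupergroup K} (φ : Mor G H)

/-- The left action of the image of `φ^*` on `K[G]`. -/
def Mor.leftAct : φ.sub →ₗ[K] G.alg.carrier →ₗ[K] G.alg.carrier :=
  LinearMap.mul K G.alg.carrier ∘ₗ φ.sub.val.toLinearMap

/-- The right action of the image of `φ^*` on `K[G]`. -/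
def Mor.rightAct : φ.subᵐᵒᵖ →ₗ[K] G.alg.carrier →ₗ[K] G.alg.carrier :=
  (LinearMap.mul K G.alg.carrier).flip ∘ₗ φ.sub.val.toLinearMap ∘ₗ
    (MulOpposite.opLinearEquiv K).symm.toLinearMap

/-- A linear map that sends `M` to the image of `φ^*`, as a linear form on `K[G]`. -/
theorem exists_linearForm {M : Submodule K G.alg.carrier} {f : G.alg.carrier →ₗ[K] G.alg.carrier}
    (hf : ∀ m ∈ M, f m ∈ φ.sub) :
    ∃ c : G.alg.carrier →ₗ[K] φ.sub, ∀ m ∈ M, (c m : G.alg.carrier) = f m := by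
  obtain ⟨c, hc⟩ := LinearMap.exists_extend
    ((f ∘ₗ M.subtype).codRestrict (Subalgebra.toSubmodule φ.sub) (fun m => hf m m.2))
  exact ⟨c, fun m hm => congrArg Subtype.val (LinearMap.congr_fun hc ⟨m, hm⟩)⟩

theorem isLocallyProjective_left (hK : (2 : K) ≠ 0) : IsLocallyProjective φ.leftAct := by
  refine ⟨(1 : G.alg.carrier), fun F => ?_⟩
  obtain ⟨M, hmul, h1, hF, -, ⟨n, f, m, hf, hm, hsum⟩, r, hr, hr1⟩ :=
    exists_projective_submodule hK φ F
  choose c hc using fun i => exists_linearForm φ (hf i).mem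
  obtain ⟨ρ, hρ⟩ := exists_linearForm φ hr.mem
  refine ⟨M, hF, ⟨Fin n, inferInstance, c, m, fun i s y hy => ?_, fun y hy => ?_⟩, ρ,
    fun s y hy => ?_, ?_⟩
  · ext
    change (c i ((s : G.alg.carrier) * y) : G.alg.carrier) = s * c i y
    rw [hc i _ (hmul s s.2 y hy), hc i y hy, (hf i).map_mul s s.2 y hy]
  · refine Eq.trans (Finset.sum_congr rfl fun i _ => ?_) (hsum y hy)
    change (c i y : G.alg.carrier) * m i = _
    rw [hc i y hy]
  · ext
    change (ρ ((s : G.alg.carrier) * y) : G.alg.carrier) = s * ρ y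
    rw [hρ _ (hmul s s.2 y hy), hρ y hy, hr.map_mul s s.2 y hy]
  · ext
    rw [hρ 1 h1, hr1]
    rfl

/-- The right module map obtained from the parity preserving part of a left module map. -/
def rightEven (f : G.alg.carrier →ₗ[K] G.alg.carrier) : G.alg.carrier →ₗ[K] G.alg.carrier :=
  G.alg.proj 0 ∘ₗ f ∘ₗ G.alg.proj 0 + G.alg.proj 1 ∘ₗ f ∘ₗ G.alg.proj 1

/-- The right module map obtained from the parity reversing part of a left module map. -/
def rightOdd (f : G.alg.carrier →ₗ[K] G.alg.carrier) : G.alg.carrier →ₗ[K] G.alg.carrier :=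
  G.alg.proj 1 ∘ₗ f ∘ₗ G.alg.proj 0 - G.alg.proj 0 ∘ₗ f ∘ₗ G.alg.proj 1

variable {φ}

theorem proj_mul_even {A : SAlg K} {i : ZMod 2} {a b : A.carrier} (ha : a ∈ A.gr 0) :
    A.proj i (a * b) = a * A.proj i b := by
  obtain rfl | rfl : i = 0 ∨ i = 1 := by revert i; decide
  · rw [SAlg.proj_zero_mul, SAlg.proj_of_mem ha, SAlg.proj_one_of_even ha, zero_mul, add_zero]
  · rw [SAlg.proj_one_mul, SAlg.proj_of_mem ha, SAlg.proj_one_of_even ha, zero_mul, add_zero]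

theorem proj_mul_odd {A : SAlg K} {i : ZMod 2} {a b : A.carrier} (ha : a ∈ A.gr 1) :
    A.proj i (a * b) = a * A.proj (i + 1) b := by
  obtain rfl | rfl : i = 0 ∨ i = 1 := by revert i; decide
  · rw [SAlg.proj_zero_mul, SAlg.proj_of_mem ha, SAlg.proj_zero_of_odd ha, zero_mul, zero_add]
    rfl
  · rw [SAlg.proj_one_mul, SAlg.proj_of_mem ha, SAlg.proj_zero_of_odd ha, zero_mul, zero_add]
    rfl

/-- If f preserves parity, moving b past m and then past f(m) produces the same sign twice. -/
theorem rightEven_mul {M : Submodule K G.alg.carrier} (hM : ∀ i, ∀ m ∈ M, G.alg.proj i m ∈ M)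
    {f : G.alg.carrier →ₗ[K] G.alg.carrier} (hf : IsModuleMap φ M f) {b m : G.alg.carrier}
    (hb : b ∈ φ.sub) (hm : m ∈ M) : rightEven f (m * b) = rightEven f m * b := by
  have h0 := SAlg.proj_mem 0 b
  have h1 := SAlg.proj_mem 1 b
  have hf' : ∀ i j, f (G.alg.proj i b * G.alg.proj j m) = G.alg.proj i b * f (G.alg.proj j m) :=
    fun i j => hf.map_mul _ (Mor.sub_proj hb i) _ (hM j m hm)
  simp only [rightEven, LinearMap.add_apply, LinearMap.comp_apply, SAlg.proj_zero_mul,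
    SAlg.proj_one_mul, map_add]
  rw [← SAlg.even_comm h0, ← SAlg.even_comm h0,
    SAlg.odd_anticomm (SAlg.proj_mem 1 m) h1, SAlg.even_comm (SAlg.proj_mem 0 m) (G.alg.proj 1 b)]
  simp only [map_neg, hf', proj_mul_even h0, proj_mul_odd h1]
  conv_rhs => rw [← SAlg.proj_add_proj b]
  simp only [mul_add, add_mul]
  rw [show (0 : ZMod 2) + 1 = 1 from rfl, show (1 : ZMod 2) + 1 = 0 from rfl,
    ← SAlg.even_comm h0, ← SAlg.even_comm h0,
    SAlg.odd_anticomm (SAlg.proj_mem 1 (f (G.alg.proj 1 m))) h1,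
    SAlg.even_comm (SAlg.proj_mem 0 (f (G.alg.proj 0 m))) (G.alg.proj 1 b)]
  abel

/-- If f reverses parity, the two signs differ by (−1)^|b|. The factor (−1)^|m| built into
`rightOdd` compensates for it. -/
theorem rightOdd_mul {M : Submodule K G.alg.carrier} (hM : ∀ i, ∀ m ∈ M, G.alg.proj i m ∈ M)
    {f : G.alg.carrier →ₗ[K] G.alg.carrier} (hf : IsModuleMap φ M f) {b m : G.alg.carrier}
    (hb : b ∈ φ.sub) (hm : m ∈ M) : rightOdd f (m * b) = rightOdd f m * b := by
  have h0 := SAlg.proj_mem 0 b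
  have h1 := SAlg.proj_mem 1 b
  have hf' : ∀ i j, f (G.alg.proj i b * G.alg.proj j m) = G.alg.proj i b * f (G.alg.proj j m) :=
    fun i j => hf.map_mul _ (Mor.sub_proj hb i) _ (hM j m hm)
  simp only [rightOdd, LinearMap.sub_apply, LinearMap.comp_apply, SAlg.proj_zero_mul,
    SAlg.proj_one_mul, map_add]
  rw [← SAlg.even_comm h0, ← SAlg.even_comm h0,
    SAlg.odd_anticomm (SAlg.proj_mem 1 m) h1, SAlg.even_comm (SAlg.proj_mem 0 m) (G.alg.proj 1 b)]
  simp only [map_neg, hf', proj_mul_even h0, proj_mul_odd h1]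
  conv_rhs => rw [← SAlg.proj_add_proj b]
  simp only [mul_add, sub_mul]
  rw [show (0 : ZMod 2) + 1 = 1 from rfl, show (1 : ZMod 2) + 1 = 0 from rfl,
    ← SAlg.even_comm h0, ← SAlg.even_comm h0,
    SAlg.odd_anticomm (SAlg.proj_mem 1 (f (G.alg.proj 0 m))) h1,
    SAlg.even_comm (SAlg.proj_mem 0 (f (G.alg.proj 1 m))) (G.alg.proj 1 b)]
  abel

theorem IsModuleMap.proj_mem {M : Submodule K G.alg.carrier}
    (hM : ∀ i, ∀ m ∈ M, G.alg.proj i m ∈ M)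
    {f : G.alg.carrier →ₗ[K] G.alg.carrier} (hf : IsModuleMap φ M f) {m : G.alg.carrier}
    (hm : m ∈ M) (i j : ZMod 2) : G.alg.proj i (f (G.alg.proj j m)) ∈ φ.sub :=
  Mor.sub_proj (hf.mem _ (hM j m hm)) i

/-- Split each mᵢ and each fᵢ by parity in the left dual basis identity, then move the mᵢ to the
left. An odd mᵢ passing the parity-reversing part of fᵢ acquires, with the twist in `rightOdd`, a
sign −1 in both degrees of x. -/
theorem sum_rightEven_rightOdd {M : Submodule K G.alg.carrier} {n : ℕ}
    (hM : ∀ i, ∀ m ∈ M, G.alg.proj i m ∈ M) {f : Fin n → G.alg.carrier →ₗ[K] G.alg.carrier}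
    {m : Fin n → G.alg.carrier} (hsum : ∀ x ∈ M, ∑ i, f i x * m i = x) {x : G.alg.carrier}
    (hx : x ∈ M) :
    ∑ i, G.alg.proj 0 (m i) * rightEven (f i) x + ∑ i, -G.alg.proj 1 (m i) * rightOdd (f i) x =
      x := by
  have e0 := congrArg (G.alg.proj 0) (hsum _ (hM 0 x hx))
  have e1 := congrArg (G.alg.proj 1) (hsum _ (hM 1 x hx))
  rw [SAlg.proj_of_mem (SAlg.proj_mem _ _), map_sum] at e0 e1
  conv_rhs => rw [← SAlg.proj_add_proj x, ← e0, ← e1]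
  rw [← Finset.sum_add_distrib, ← Finset.sum_add_distrib]
  refine Finset.sum_congr rfl fun i _ => ?_
  simp only [rightEven, rightOdd, LinearMap.add_apply, LinearMap.sub_apply, LinearMap.comp_apply,
    SAlg.proj_zero_mul, SAlg.proj_one_mul, mul_add, mul_sub, neg_mul]
  rw [SAlg.even_comm (SAlg.proj_mem 0 (m i)), SAlg.even_comm (SAlg.proj_mem 0 (m i)),
    SAlg.odd_anticomm (SAlg.proj_mem 1 (m i)) (SAlg.proj_mem 1 _),
    ← SAlg.even_comm (SAlg.proj_mem 0 (f i (G.alg.proj 1 x))) (G.alg.proj 1 (m i))]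
  abel

variable (φ)

/-- Each pair (fᵢ, mᵢ) of the left dual basis yields two pairs of right dual basis elements, one
from the parity-preserving and one from the parity-reversing part. The form r keeps its value at 1
after passing to its even part. -/
theorem isLocallyProjective_right (hK : (2 : K) ≠ 0) : IsLocallyProjective φ.rightAct := by
  refine ⟨(1 : G.alg.carrier), fun F => ?_⟩
  obtain ⟨M, hmul, h1, hF, hgr, ⟨n, f, m, hf, hm, hsum⟩, r, hr, hr1⟩ :=
    exists_projective_submodule hK φ F
  have hmulr : ∀ b ∈ φ.sub, ∀ x ∈ M, x * b ∈ M := by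
    intro b hb x hx
    have hp : ∀ i j, G.alg.proj i b * G.alg.proj j x ∈ M := fun i j =>
      hmul _ (Mor.sub_proj hb i) _ (hgr j x hx)
    rw [← SAlg.proj_add_proj b, mul_add, ← SAlg.even_comm (SAlg.proj_mem 0 b)]
    refine add_mem (hmul _ (Mor.sub_proj hb 0) x hx) ?_
    rw [← SAlg.proj_add_proj x, add_mul, SAlg.even_comm (SAlg.proj_mem 0 x),
      SAlg.odd_anticomm (SAlg.proj_mem 1 x) (SAlg.proj_mem 1 b)]
    exact add_mem (hp 1 0) (neg_mem (hp 1 1))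
  have heven : ∀ {f : G.alg.carrier →ₗ[K] G.alg.carrier}, IsModuleMap φ M f →
      ∀ x ∈ M, rightEven f x ∈ φ.sub := fun hf x hx =>
    φ.sub.add_mem (hf.proj_mem hgr hx 0 0) (hf.proj_mem hgr hx 1 1)
  have hodd : ∀ {f : G.alg.carrier →ₗ[K] G.alg.carrier}, IsModuleMap φ M f →
      ∀ x ∈ M, rightOdd f x ∈ φ.sub := fun hf x hx =>
    φ.sub.sub_mem (hf.proj_mem hgr hx 1 0) (hf.proj_mem hgr hx 0 1)
  choose ce hce using fun i => exists_linearForm φ (heven (hf i))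
  choose co hco using fun i => exists_linearForm φ (hodd (hf i))
  obtain ⟨ρ, hρ⟩ := exists_linearForm φ (heven hr)
  let o : φ.sub →ₗ[K] φ.subᵐᵒᵖ := (MulOpposite.opLinearEquiv K).toLinearMap
  have key : ∀ {g : G.alg.carrier →ₗ[K] G.alg.carrier} {c : G.alg.carrier →ₗ[K] φ.sub},
      (∀ x ∈ M, (c x : G.alg.carrier) = g x) →
      (∀ b ∈ φ.sub, ∀ x ∈ M, g (x * b) = g x * b) → ∀ (s : φ.subᵐᵒᵖ), ∀ y ∈ M,
      (o ∘ₗ c) (φ.rightAct s y) = s * (o ∘ₗ c) y := by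
    intro g c hc hg s y hy
    apply MulOpposite.unop_injective
    ext
    change (c (y * (s.unop : G.alg.carrier)) : G.alg.carrier) = c y * (s.unop : G.alg.carrier)
    rw [hc _ (hmulr _ s.unop.2 y hy), hc y hy, hg _ s.unop.2 y hy]
  refine ⟨M, hF, ⟨Fin n ⊕ Fin n, inferInstance, fun i => o ∘ₗ Sum.elim ce co i,
    Sum.elim (fun i => G.alg.proj 0 (m i)) (fun i => -G.alg.proj 1 (m i)), ?_, fun y hy => ?_⟩,
    o ∘ₗ ρ, key hρ fun b hb x hx => rightEven_mul hgr hr hb hx, ?_⟩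
  · rintro (i | i)
    · exact key (hce i) fun b hb x hx => rightEven_mul hgr (hf i) hb hx
    · exact key (hco i) fun b hb x hx => rightOdd_mul hgr (hf i) hb hx
  · rw [Fintype.sum_sum_type]
    refine Eq.trans ?_ (sum_rightEven_rightOdd hgr hsum hy)
    congr 1
    · refine Finset.sum_congr rfl fun i _ => ?_
      change G.alg.proj 0 (m i) * (ce i y : G.alg.carrier) = _
      rw [hce i y hy]
    · refine Finset.sum_congr rfl fun i _ => ?_
      change -G.alg.proj 1 (m i) * (co i y : G.alg.carrier) = _
      rw [hco i y hy]
  · apply MulOpposite.unop_injective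
    ext
    change (ρ 1 : G.alg.carrier) = 1
    rw [hρ 1 h1]
    simp only [rightEven, LinearMap.add_apply, LinearMap.comp_apply,
      SAlg.proj_of_mem SAlg.one_mem_even, SAlg.proj_one_of_even SAlg.one_mem_even, hr1, map_zero,
      add_zero]

/-- The inclusion of the image of `φ^*` into `K[G]`. -/
def Mor.rangeIncl : SAlg.range φ.comorphism ⟶ G.alg where
  toAlgHom := φ.sub.val
  even _ _ h := h

/-- The covering of the image of `φ^*` by `K[G]`. -/
def Mor.cover : (SAlg.range φ.comorphism).Family where
  n := 1
  alg _ := G.alg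
  map _ := φ.rangeIncl

/-- `K[G]` is faithfully flat over the image of `φ^*`. -/
theorem Mor.cover_isFF (hK : (2 : K) ≠ 0) : φ.cover.IsFF := by
  refine IsLocallyProjective.isFaithfullyFlat ?_
  exact (isLocallyProjective_left φ hK).of_equiv
    (LinearEquiv.funUnique (Fin 1) K G.alg.carrier).symm (fun s y => by ext i; rfl)

end AffineSupergroup

end

end Super

namespace Super

noncomputable section

variable {K : Type u} [Field K]

/-! ### The canonical map of the quotient -/

namespace SAlg

variable {A : SAlg K}

theorem parity_parity (a : A.carrier) : A.parity (A.parity a) = a := by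
  rw [parity_apply a, map_sub, parity_even (proj_mem 0 a), parity_odd (proj_mem 1 a),
    sub_neg_eq_add, proj_add_proj]

theorem mul_odd {y : A.carrier} (hy : y ∈ A.gr 1) (b : A.carrier) : b * y = y * A.parity b := by
  rw [odd_mul hy, parity_parity]

end SAlg

namespace AffineSupergroup

variable {G H : AffineSupergroup K} (φ : Mor G H)

/-- The relations `a b ⊗ a' = a ⊗ b a'` for `b` in the image of `φ^*`. -/
def Mor.rel : Submodule K (G.alg.carrier ⊗[K] G.alg.carrier) :=
  Submodule.span K {t | ∃ (a b a' : G.alg.carrier), b ∈ φ.sub ∧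
    t = (a * b) ⊗ₜ[K] a' - a ⊗ₜ[K] (b * a')}

/-- The tensor square of `K[G]` over the image of `φ^*`. -/
abbrev Mor.Square : Type u := (G.alg.carrier ⊗[K] G.alg.carrier) ⧸ φ.rel

/-- Left multiplication on the tensor square. -/
def Mor.squareMul (a : G.alg.carrier) : φ.Square →ₗ[K] φ.Square :=
  Submodule.mapQ _ _ ((LinearMap.mulLeft K a).rTensor G.alg.carrier) (by
    refine Submodule.span_le.2 ?_
    rintro _ ⟨x, b, y, hb, rfl⟩
    refine Submodule.subset_span ⟨a * x, b, y, hb, ?_⟩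
    simp [mul_assoc])

theorem Mor.squareMul_mk (a x y : G.alg.carrier) :
    φ.squareMul a (φ.rel.mkQ (x ⊗ₜ[K] y)) = φ.rel.mkQ ((a * x) ⊗ₜ[K] y) := rfl

theorem Mor.mkQ_mul_tmul (a b a' : G.alg.carrier) (hb : b ∈ φ.sub) :
    φ.rel.mkQ ((a * b) ⊗ₜ[K] a') = φ.rel.mkQ (a ⊗ₜ[K] (b * a')) :=
  (Submodule.Quotient.eq _).2 (Submodule.subset_span ⟨a, b, a', hb, rfl⟩)

theorem Mor.squareMul_mul (a x : G.alg.carrier) (s : φ.Square) :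
    φ.squareMul (a * x) s = φ.squareMul a (φ.squareMul x s) := by
  obtain ⟨s, rfl⟩ := Submodule.mkQ_surjective _ s
  induction s with
  | zero => simp
  | add s s' h h' => simp only [map_add, h, h']
  | tmul y z => rw [φ.squareMul_mk, φ.squareMul_mk, φ.squareMul_mk, mul_assoc]

/-- Left multiplication on the tensor square, as a bilinear map. -/
def Mor.squareLsmul : G.alg.carrier →ₗ[K] φ.Square →ₗ[K] φ.Square where
  toFun := φ.squareMul
  map_add' a b := by
    ext x y
    simp only [LinearMap.comp_apply, TensorProduct.AlgebraTensorModule.curry_apply,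
      TensorProduct.curry_apply, LinearMap.coe_restrictScalars, LinearMap.add_apply]
    rw [φ.squareMul_mk, φ.squareMul_mk, φ.squareMul_mk, add_mul, TensorProduct.add_tmul, map_add]
  map_smul' c a := by
    ext x y
    simp only [LinearMap.comp_apply, TensorProduct.AlgebraTensorModule.curry_apply,
      TensorProduct.curry_apply, LinearMap.coe_restrictScalars, LinearMap.smul_apply]
    rw [φ.squareMul_mk, φ.squareMul_mk, smul_mul_assoc, ← TensorProduct.smul_tmul', map_smul]
    rfl

/-- The map `a ↦ S(a₁) ⊗ a₂`. -/
def Mor.translationLift : G.alg.carrier →ₗ[K] φ.Square :=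
  φ.rel.mkQ ∘ₗ G.antipode.toAlgHom.toLinearMap.rTensor G.alg.carrier ∘ₗ Coalgebra.comul

variable {φ}

/-- The second factor y of t lies in B and can be moved across the tensor sign over B. There it
meets S(x), and the sign of the graded product is exactly what puts it next to S(x). -/
theorem mkQ_antipode_gmul {t : G.alg.carrier ⊗[K] G.alg.carrier}
    (ht : t ∈ Submodule.span K {t | ∃ x ∈ φ.sub, ∃ y ∈ φ.sub, t = x ⊗ₜ[K] y})
    (s : G.alg.carrier ⊗[K] G.alg.carrier) :
    φ.rel.mkQ (G.antipode.toAlgHom.toLinearMap.rTensor G.alg.carrier (gmul t s)) =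
      φ.squareLsmul (LinearMap.mul' K G.alg.carrier
        (G.antipode.toAlgHom.toLinearMap.rTensor G.alg.carrier t))
        (φ.rel.mkQ (G.antipode.toAlgHom.toLinearMap.rTensor G.alg.carrier s)) := by
  induction ht using Submodule.span_induction with
  | zero => simp only [map_zero, LinearMap.zero_apply]
  | add x y _ _ hx hy => simp only [map_add, LinearMap.add_apply, hx, hy]
  | smul a x _ hx => simp only [map_smul, LinearMap.smul_apply, hx]
  | mem t ht =>
    obtain ⟨x, hx, y, hy, rfl⟩ := ht
    induction s with
    | zero => simp only [map_zero]
    | add s s' hs hs' => simp only [map_add, hs, hs']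
    | tmul a c =>
      rw [gmul_tmul]
      simp only [map_add, LinearMap.rTensor_tmul, AlgHom.toLinearMap_apply, map_mul,
        LinearMap.mul'_apply, ← SAlg.parity_map]
      rw [← φ.mkQ_mul_tmul _ _ _ (Mor.sub_proj hy 0), ← φ.mkQ_mul_tmul _ _ _ (Mor.sub_proj hy 1),
        mul_assoc, mul_assoc, ← SAlg.even_comm (SAlg.proj_mem 0 y),
        ← SAlg.odd_mul (SAlg.proj_mem 1 y)]
      change _ = φ.squareMul _ _
      rw [φ.squareMul_mk, ← map_add, ← TensorProduct.add_tmul, ← mul_add, ← add_mul,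
        SAlg.proj_add_proj, mul_assoc]

/-- Because δ(b) lies in B ⊗ B, the factor contributed by b collapses to ∑ S(b₁)b₂ = ε(b). This is
what lets the translation map descend to K[N]. -/
theorem translationLift_sub_mul {b : G.alg.carrier} (hb : b ∈ φ.sub) (a : G.alg.carrier) :
    φ.translationLift (b * a) = Coalgebra.counit (R := K) b • φ.translationLift a := by
  have h := mkQ_antipode_gmul (Mor.sub_comul hb) (Coalgebra.comul (R := K) a)
  rw [← comul_mul_eq_gmul, G.antipode_left] at h
  refine h.trans ?_
  rw [Algebra.algebraMap_eq_smul_one, map_smul, LinearMap.smul_apply]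
  congr 1
  change φ.squareMul 1 _ = φ.translationLift a
  have e : φ.squareMul 1 = LinearMap.id := by
    ext x y
    change φ.squareMul 1 (φ.rel.mkQ (x ⊗ₜ[K] y)) = φ.rel.mkQ (x ⊗ₜ[K] y)
    rw [φ.squareMul_mk, one_mul]
  rw [e]
  rfl

/-- A linear map that is compatible with left multiplication by the image of `φ^*` through the
counit vanishes on the defining ideal of the kernel. -/
theorem kernel_le_ker {P : Type*} [AddCommGroup P] [Module K P] (f : G.alg.carrier →ₗ[K] P)
    (hf : ∀ b ∈ φ.sub, ∀ a, f (b * a) = Coalgebra.counit (R := K) b • f a) :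
    (kernel φ).ideal.restrictScalars K ≤ LinearMap.ker f := by
  intro x hx
  -- The ideal is generated by left multiples, while the hypothesis concerns multiplication by B on
  -- the left. All left multiples are treated at once, and each homogeneous generator is moved to
  -- the left past a, with a parity twist if it is odd.
  have key : ∀ a, f (a * x) = 0 := by
    have hx' : x ∈ Ideal.span
      (φ.comorphism.toAlgHom '' {f | Coalgebra.counit (R := K) f = 0}) := hx
    clear hx
    induction hx' using Submodule.span_induction with
    | mem x hx =>
      obtain ⟨h, hh, rfl⟩ := hx
      intro a
      have h0 : Coalgebra.counit (R := K) (H.alg.proj 0 h) = 0 := (H.counit_proj h).trans hh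
      have h1 : Coalgebra.counit (R := K) (H.alg.proj 1 h) = 0 :=
        H.counit_odd _ (SAlg.proj_mem 1 h)
      rw [← SAlg.proj_add_proj h, map_add, mul_add,
        ← SAlg.even_comm (φ.comorphism.even 0 _ (SAlg.proj_mem 0 h)),
        SAlg.mul_odd (φ.comorphism.even 1 _ (SAlg.proj_mem 1 h)), map_add,
        hf (φ.comorphism.toAlgHom (H.alg.proj 0 h)) ⟨_, rfl⟩,
        hf (φ.comorphism.toAlgHom (H.alg.proj 1 h)) ⟨_, rfl⟩]
      change Coalgebra.counit (R := K) (φ.comorphism.toAlgHom (H.alg.proj 0 h)) • _ +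
        Coalgebra.counit (R := K) (φ.comorphism.toAlgHom (H.alg.proj 1 h)) • _ = 0
      rw [φ.counit_comp, φ.counit_comp, h0, h1, zero_smul, zero_smul, add_zero]
    | zero => intro a; rw [mul_zero, map_zero]
    | add x y _ _ hx hy =>
      intro a
      rw [mul_add, map_add, hx a, hy a, add_zero]
    | smul b x _ hx =>
      intro a
      rw [smul_eq_mul, ← mul_assoc]
      exact hx _
  have := key 1
  rwa [one_mul] at this

variable (φ) in
/-- The map `c ↦ S(c₁) ⊗ c₂` on the coordinate superalgebra of the kernel. -/
def Mor.translation : (kernel φ).Coord →ₗ[K] φ.Square :=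
  ((kernel φ).ideal.restrictScalars K).liftQ φ.translationLift
    (kernel_le_ker _ fun _ hb a => translationLift_sub_mul hb a)

theorem Mor.translation_res (a : G.alg.carrier) :
    φ.translation ((kernel φ).res a) = φ.translationLift a := rfl

/-- The element b − ε(b) lies in the defining ideal of N. That ideal is generated on the left, so
the odd part must be moved past a. -/
theorem res_sub_mul {b : G.alg.carrier} (hb : b ∈ φ.sub) (a : G.alg.carrier) :
    (kernel φ).res (b * a) = Coalgebra.counit (R := K) b • (kernel φ).res a := by
  obtain ⟨h, rfl⟩ := hb
  have key : ∀ h : H.alg.carrier, Coalgebra.counit (R := K) h = 0 →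
      φ.comorphism.toAlgHom h * a ∈ (kernel φ).ideal := by
    intro h hh
    have h0 : Coalgebra.counit (R := K) (H.alg.proj 0 h) = 0 := (H.counit_proj h).trans hh
    have h1 : Coalgebra.counit (R := K) (H.alg.proj 1 h) = 0 :=
      H.counit_odd _ (SAlg.proj_mem 1 h)
    rw [← SAlg.proj_add_proj h, map_add, add_mul,
      SAlg.even_comm (φ.comorphism.even 0 _ (SAlg.proj_mem 0 h)),
      SAlg.odd_mul (φ.comorphism.even 1 _ (SAlg.proj_mem 1 h))]
    exact add_mem (Ideal.mul_mem_left _ _ (Ideal.subset_span ⟨_, h0, rfl⟩))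
      (Ideal.mul_mem_left _ _ (Ideal.subset_span ⟨_, h1, rfl⟩))
  change (kernel φ).res (φ.comorphism.toAlgHom h * a) =
    Coalgebra.counit (R := K) (φ.comorphism.toAlgHom h) • (kernel φ).res a
  rw [← map_smul, ← sub_eq_zero, ← map_sub]
  refine (Submodule.Quotient.mk_eq_zero _).2 ?_
  have h2 := key (h - algebraMap K _ (Coalgebra.counit (R := K) h)) (by
    rw [Algebra.algebraMap_eq_smul_one, map_sub, map_smul, H.counit_one, smul_eq_mul, mul_one,
      sub_self])
  rwa [map_sub, AlgHom.commutes, sub_mul, ← Algebra.smul_def, ← φ.counit_comp h] at h2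

/-- Modulo the ideal of N in the second factor, an element of B ⊗ B acts through ε of its second
factor. For t = δ(b) this says that the coaction of K[N] on K[G] is B-linear. -/
theorem lTensor_res_gmul {t : G.alg.carrier ⊗[K] G.alg.carrier}
    (ht : t ∈ Submodule.span K {t | ∃ x ∈ φ.sub, ∃ y ∈ φ.sub, t = x ⊗ₜ[K] y})
    (s : G.alg.carrier ⊗[K] G.alg.carrier) :
    (kernel φ).res.lTensor G.alg.carrier (gmul t s) =
      (LinearMap.mulLeft K (TensorProduct.rid K _ (Coalgebra.counit.lTensor _ t))).rTensor _
        ((kernel φ).res.lTensor G.alg.carrier s) := by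
  induction ht using Submodule.span_induction with
  | zero =>
    simp only [map_zero, LinearMap.zero_apply, LinearMap.mulLeft_zero_eq_zero,
      LinearMap.rTensor_zero]
  | add x y _ _ hx hy =>
    have e : ∀ a b : G.alg.carrier, LinearMap.mulLeft K (a + b) =
      LinearMap.mulLeft K a + LinearMap.mulLeft K b := fun a b => (LinearMap.mul K _).map_add a b
    simp only [map_add, LinearMap.add_apply, hx, hy, e, LinearMap.rTensor_add]
  | smul a x _ hx =>
    have e : ∀ b : G.alg.carrier, LinearMap.mulLeft K (a • b) = a • LinearMap.mulLeft K b :=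
      fun b => (LinearMap.mul K _).map_smul a b
    simp only [map_smul, LinearMap.smul_apply, hx, e, LinearMap.rTensor_smul]
  | mem t ht =>
    obtain ⟨x, hx, y, hy, rfl⟩ := ht
    induction s with
    | zero => simp only [map_zero]
    | add s s' hs hs' => simp only [map_add, hs, hs']
    | tmul a c =>
      rw [gmul_tmul]
      simp only [map_add, LinearMap.lTensor_tmul, LinearMap.rTensor_tmul]
      rw [res_sub_mul (Mor.sub_proj hy 0), res_sub_mul (Mor.sub_proj hy 1),
        G.counit_odd _ (SAlg.proj_mem 1 y)]
      have := G.counit_proj y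
      rw [counitHom_apply, counitHom_apply] at this
      rw [this, TensorProduct.rid_tmul, zero_smul, TensorProduct.tmul_zero, add_zero,
        TensorProduct.tmul_smul, TensorProduct.smul_tmul', LinearMap.mulLeft_apply, smul_mul_assoc]

theorem rightCoact_sub_mul {b : G.alg.carrier} (hb : b ∈ φ.sub) (a : G.alg.carrier) :
    (kernel φ).rightCoact (b * a) =
      (LinearMap.mulLeft K b).rTensor _ ((kernel φ).rightCoact a) := by
  have h := lTensor_res_gmul (Mor.sub_comul hb) (Coalgebra.comul (R := K) a)
  rwa [← comul_mul_eq_gmul, Coalgebra.lTensor_counit_comul, TensorProduct.rid_tmul, one_smul] at h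

variable (φ) in
/-- The map `a ⊗ c ↦ a S(c₁) ⊗ c₂`. -/
def Mor.translationMul : G.alg.carrier ⊗[K] (kernel φ).Coord →ₗ[K] φ.Square :=
  TensorProduct.lift (φ.squareLsmul.compl₂ φ.translation)

theorem Mor.translationMul_tmul (a : G.alg.carrier) (c : (kernel φ).Coord) :
    φ.translationMul (a ⊗ₜ[K] c) = φ.squareMul a (φ.translation c) := rfl

theorem Mor.translationMul_res (t : G.alg.carrier ⊗[K] G.alg.carrier) :
    φ.translationMul ((kernel φ).res.lTensor _ t) =
      φ.rel.mkQ ((LinearMap.mul' K _ ∘ₗ G.antipode.toAlgHom.toLinearMap.lTensor _).rTensor _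
        ((TensorProduct.assoc K _ _ _).symm (Coalgebra.comul.lTensor _ t))) := by
  induction t with
  | zero => simp
  | add x y hx hy => simp only [map_add, hx, hy]
  | tmul x y =>
    rw [LinearMap.lTensor_tmul, φ.translationMul_tmul, φ.translation_res, LinearMap.lTensor_tmul]
    change φ.squareMul x (φ.rel.mkQ (G.antipode.toAlgHom.toLinearMap.rTensor G.alg.carrier
      (Coalgebra.comul (R := K) y))) = _
    generalize Coalgebra.comul (R := K) y = t
    induction t with
    | zero => simp
    | add x y hx hy => simp only [map_add, TensorProduct.tmul_add, hx, hy]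
    | tmul y z => rfl

/-- `a₁ S(a₂) ⊗ a₃ = 1 ⊗ a`. -/
theorem Mor.translationMul_rightCoact (a : G.alg.carrier) :
    φ.translationMul ((kernel φ).rightCoact a) = φ.rel.mkQ (1 ⊗ₜ[K] a) := by
  have h : LinearMap.mul' K G.alg.carrier ∘ₗ G.antipode.toAlgHom.toLinearMap.lTensor _ ∘ₗ
      Coalgebra.comul = Algebra.linearMap K G.alg.carrier ∘ₗ Coalgebra.counit := by
    ext a
    exact G.antipode_right a
  change φ.translationMul ((kernel φ).res.lTensor _ (Coalgebra.comul (R := K) a)) = _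
  rw [φ.translationMul_res, Coalgebra.coassoc_symm_apply, ← LinearMap.comp_apply (LinearMap.rTensor _ _),
    ← LinearMap.rTensor_comp, LinearMap.comp_assoc, h, LinearMap.rTensor_comp,
    LinearMap.comp_apply, Coalgebra.rTensor_counit_comul]
  simp

variable (φ) in
/-- The multiplication of the tensor square. -/
def Mor.squareCounit : φ.Square →ₗ[K] G.alg.carrier :=
  φ.rel.liftQ (LinearMap.mul' K G.alg.carrier) (by
    refine Submodule.span_le.2 ?_
    rintro _ ⟨a, b, a', hb, rfl⟩
    simp [mul_assoc])

/-- `a S(c₁) c₂ = ε(c) a`. -/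
theorem Mor.squareCounit_translationMul (t : G.alg.carrier ⊗[K] (kernel φ).Coord) :
    φ.squareCounit (φ.translationMul t) =
      TensorProduct.rid K _ ((kernel φ).counit.lTensor _ t) := by
  have hmul : ∀ (a : G.alg.carrier) (s : φ.Square),
      φ.squareCounit (φ.squareMul a s) = a * φ.squareCounit s := by
    intro a s
    obtain ⟨s, rfl⟩ := Submodule.mkQ_surjective _ s
    induction s with
    | zero => simp
    | add x y hx hy => simp only [map_add, mul_add, hx, hy]
    | tmul x y => exact mul_assoc a x y
  induction t with
  | zero => simp
  | add x y hx hy => simp only [map_add, hx, hy]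
  | tmul a c =>
    obtain ⟨x, rfl⟩ := Submodule.mkQ_surjective _ c
    rw [φ.translationMul_tmul, hmul, LinearMap.lTensor_tmul, TensorProduct.rid_tmul]
    have h := G.antipode_left x
    change a * LinearMap.mul' K G.alg.carrier (G.antipode.toAlgHom.toLinearMap.rTensor _
      (Coalgebra.comul x)) = Coalgebra.counit (R := K) x • a
    rw [h, Algebra.algebraMap_eq_smul_one, mul_smul_comm, mul_one]

variable (φ) in
/-- The right coaction on the second factor of the tensor square. -/
def Mor.squareCoact : φ.Square →ₗ[K] φ.Square ⊗[K] (kernel φ).Coord :=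
  φ.rel.liftQ (φ.rel.mkQ.rTensor _ ∘ₗ (TensorProduct.assoc K _ _ _).symm.toLinearMap ∘ₗ
    (kernel φ).rightCoact.lTensor _) (by
    refine Submodule.span_le.2 ?_
    rintro _ ⟨a, b, a', hb, rfl⟩
    rw [SetLike.mem_coe, LinearMap.mem_ker, map_sub, sub_eq_zero]
    simp only [LinearMap.comp_apply, LinearMap.lTensor_tmul, rightCoact_sub_mul hb]
    generalize (kernel φ).rightCoact a' = t
    induction t with
    | zero => simp
    | add x y hx hy => simp only [map_add, TensorProduct.tmul_add, hx, hy]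
    | tmul x y =>
      rw [LinearMap.rTensor_tmul, LinearEquiv.coe_coe, TensorProduct.assoc_symm_tmul,
        TensorProduct.assoc_symm_tmul, LinearMap.rTensor_tmul, LinearMap.rTensor_tmul,
        φ.mkQ_mul_tmul _ _ _ hb, LinearMap.mulLeft_apply])

theorem Mor.squareCoact_mk (x y : G.alg.carrier) : φ.squareCoact (φ.rel.mkQ (x ⊗ₜ[K] y)) =
    φ.rel.mkQ.rTensor _ ((TensorProduct.assoc K _ _ _).symm (x ⊗ₜ[K] (kernel φ).rightCoact y)) :=
  rfl

/-- Coassociativity: both sides are a S(c₁) ⊗ c₂ ⊗ c₃. -/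
theorem Mor.squareCoact_translationMul (t : G.alg.carrier ⊗[K] (kernel φ).Coord) :
    φ.squareCoact (φ.translationMul t) =
      φ.translationMul.rTensor _ ((TensorProduct.assoc K _ _ _).symm
        ((kernel φ).comul.lTensor _ t)) := by
  induction t with
  | zero => simp
  | add x y hx hy => simp only [map_add, hx, hy]
  | tmul a c =>
    obtain ⟨x, rfl⟩ := Submodule.mkQ_surjective _ c
    set Ψ : G.alg.carrier ⊗[K] G.alg.carrier →ₗ[K] φ.Square :=
      φ.squareMul a ∘ₗ φ.rel.mkQ ∘ₗ G.antipode.toAlgHom.toLinearMap.rTensor G.alg.carrier with hΨ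
    have h1 : ∀ t : G.alg.carrier ⊗[K] G.alg.carrier, φ.squareCoact (Ψ t) =
        TensorProduct.map Ψ (kernel φ).res ((TensorProduct.assoc K _ _ _).symm
          (Coalgebra.comul.lTensor _ t)) := by
      intro t
      induction t with
      | zero => simp
      | add x y hx hy => simp only [map_add, hx, hy]
      | tmul x y =>
        change φ.squareCoact (φ.rel.mkQ ((a * G.antipode.toAlgHom x) ⊗ₜ[K] y)) = _
        rw [φ.squareCoact_mk, ClosedSub.rightCoact, LinearMap.comp_apply, LinearMap.lTensor_tmul]
        generalize Coalgebra.comul (R := K) y = t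
        induction t with
        | zero => simp
        | add x y hx hy => simp only [map_add, TensorProduct.tmul_add, hx, hy]
        | tmul y z => rfl
    have h2 : ∀ t : G.alg.carrier ⊗[K] G.alg.carrier,
        φ.translationMul.rTensor _ ((TensorProduct.assoc K _ _ _).symm
          (a ⊗ₜ[K] TensorProduct.map (kernel φ).res (kernel φ).res t)) =
        TensorProduct.map Ψ (kernel φ).res (Coalgebra.comul.rTensor _ t) := by
      intro t
      induction t with
      | zero => simp
      | add x y hx hy => simp only [map_add, TensorProduct.tmul_add, hx, hy]
      | tmul x y => rfl
    refine (h1 _).trans (Eq.trans ?_ (h2 _).symm)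
    rw [Coalgebra.coassoc_symm_apply]

end AffineSupergroup

end

end Super

namespace Super

noncomputable section

variable {K : Type u} [Field K]

namespace AffineSupergroup

variable {G H : AffineSupergroup K} (φ : Mor G H)

/-! ### Faithful coflatness -/

section

variable (P : Type u) [AddCommGroup P] [Module K P]

/-- The action of the image of `φ^*` on the first factor of `K[G] ⊗ P`. -/
def Mor.tensorAct : φ.subᵐᵒᵖ →ₗ[K] (G.alg.carrier ⊗[K] P) →ₗ[K] (G.alg.carrier ⊗[K] P) :=
  LinearMap.rTensorHom P ∘ₗ LinearMap.mul K G.alg.carrier ∘ₗ φ.sub.val.toLinearMap ∘ₗ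
    (MulOpposite.opLinearEquiv K).symm.toLinearMap

theorem Mor.tensorAct_apply (s : φ.subᵐᵒᵖ) (t : G.alg.carrier ⊗[K] P) :
    φ.tensorAct P s t = (LinearMap.mulLeft K (s.unop : G.alg.carrier)).rTensor P t := rfl

theorem Mor.tensorAct_mul (s s' : φ.subᵐᵒᵖ) (t : G.alg.carrier ⊗[K] P) :
    φ.tensorAct P (s * s') t = φ.tensorAct P s' (φ.tensorAct P s t) := by
  rw [φ.tensorAct_apply, φ.tensorAct_apply, φ.tensorAct_apply, ← LinearMap.comp_apply,
    ← LinearMap.rTensor_comp, ← LinearMap.mulLeft_mul]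
  rfl

theorem Mor.tensorAct_one (t : G.alg.carrier ⊗[K] P) : φ.tensorAct P 1 t = t := by
  rw [φ.tensorAct_apply]
  change (LinearMap.mulLeft K (1 : G.alg.carrier)).rTensor P t = t
  rw [LinearMap.mulLeft_one, LinearMap.rTensor_id, LinearMap.id_apply]

/-- The rearrangement `(a ⊗ p) ⊗ a' ↦ (a' ⊗ a) ⊗ p`. -/
def rearrange : (G.alg.carrier ⊗[K] P) ⊗[K] G.alg.carrier ≃ₗ[K]
    (G.alg.carrier ⊗[K] G.alg.carrier) ⊗[K] P :=
  TensorProduct.comm K _ _ ≪≫ₗ (TensorProduct.assoc K _ _ _).symm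

/-- The map `(a ⊗ p) ⊗ a' ↦ [a' ⊗ a] ⊗ p`. -/
def Mor.toSquare : (G.alg.carrier ⊗[K] P) ⊗[K] G.alg.carrier →ₗ[K] φ.Square ⊗[K] P :=
  φ.rel.mkQ.rTensor P ∘ₗ (rearrange P).toLinearMap

theorem Mor.toSquare_tmul (a a' : G.alg.carrier) (p : P) :
    φ.toSquare P ((a ⊗ₜ[K] p) ⊗ₜ[K] a') = φ.rel.mkQ (a' ⊗ₜ[K] a) ⊗ₜ[K] p := rfl

theorem Mor.toSquare_surjective : Function.Surjective (φ.toSquare P) :=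
  (LinearMap.rTensor_surjective P (Submodule.mkQ_surjective _)).comp (rearrange P).surjective

/-- Right exactness of − ⊗ P. It identifies (K[G] ⊗_B K[G]) ⊗ P with the balanced tensor product
used in the flatness criterion. -/
theorem Mor.toSquare_eq_zero_iff (t : (G.alg.carrier ⊗[K] P) ⊗[K] G.alg.carrier) :
    φ.toSquare P t = 0 ↔ t ∈ balancedRel (φ.tensorAct P) φ.rightAct := by
  constructor
  · intro ht
    obtain ⟨u, hu⟩ := (rTensor_exact P (LinearMap.exact_subtype_mkQ φ.rel)
      (Submodule.mkQ_surjective _) _).1 ht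
    rw [LinearEquiv.coe_coe, ← LinearEquiv.symm_apply_eq] at hu
    rw [← hu]
    clear hu ht
    induction u with
    | zero => rw [map_zero, map_zero]; exact zero_mem _
    | add x y hx hy => rw [map_add, map_add]; exact add_mem hx hy
    | tmul r p =>
      obtain ⟨r, hr⟩ := r
      change (rearrange P).symm (r ⊗ₜ[K] p) ∈ _
      induction hr using Submodule.span_induction with
      | zero => rw [TensorProduct.zero_tmul, map_zero]; exact zero_mem _
      | add x y _ _ hx hy => rw [TensorProduct.add_tmul, map_add]; exact add_mem hx hy
      | smul c x _ hx =>
        rw [← TensorProduct.smul_tmul', map_smul]; exact Submodule.smul_mem _ c hx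
      | mem r hr =>
        obtain ⟨a, b, a', hb, rfl⟩ := hr
        rw [TensorProduct.sub_tmul, map_sub]
        have h : (rearrange P).symm ((a ⊗ₜ[K] (b * a')) ⊗ₜ[K] p) -
            (rearrange P).symm (((a * b) ⊗ₜ[K] a') ⊗ₜ[K] p) ∈
            balancedRel (φ.tensorAct P) φ.rightAct :=
          Submodule.subset_span ⟨a' ⊗ₜ[K] p, MulOpposite.op ⟨b, hb⟩, a, rfl⟩
        have h' := Submodule.neg_mem (M := (G.alg.carrier ⊗[K] P) ⊗[K] G.alg.carrier)
          (balancedRel (φ.tensorAct P) φ.rightAct) h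
        have e := neg_sub ((rearrange P).symm ((a ⊗ₜ[K] (b * a')) ⊗ₜ[K] p))
          ((rearrange P).symm (((a * b) ⊗ₜ[K] a') ⊗ₜ[K] p))
        exact (congrArg (· ∈ balancedRel (φ.tensorAct P) φ.rightAct) e).mp h'
  · intro ht
    induction ht using Submodule.span_induction with
    | zero => exact map_zero _
    | add x y _ _ hx hy => rw [map_add, hx, hy, add_zero]
    | smul c x _ hx => rw [map_smul, hx, smul_zero]
    | mem t ht =>
      obtain ⟨x, s, y, rfl⟩ := ht
      rw [map_sub, sub_eq_zero]
      induction x with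
      | zero => simp
      | add x x' hx hx' => simp only [map_add, TensorProduct.add_tmul, hx, hx']
      | tmul a p =>
        exact congrArg (· ⊗ₜ[K] p) (φ.mkQ_mul_tmul y s.unop a s.unop.2).symm

/-- Multiplication `(a ⊗ p) ⊗ a' ↦ a' a ⊗ p`. -/
def tensorMul : (G.alg.carrier ⊗[K] P) ⊗[K] G.alg.carrier →ₗ[K] G.alg.carrier ⊗[K] P :=
  (LinearMap.mul' K _).rTensor P ∘ₗ (rearrange P).toLinearMap

theorem squareCounit_toSquare (t : (G.alg.carrier ⊗[K] P) ⊗[K] G.alg.carrier) :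
    φ.squareCounit.rTensor P (φ.toSquare P t) = tensorMul P t := by
  rw [Mor.toSquare, LinearMap.comp_apply, ← LinearMap.comp_apply (LinearMap.rTensor _ _),
    ← LinearMap.rTensor_comp]
  rfl

end

/-! ### The comparison of K[G] ⊗_B (K[G] □ W) with K[G] ⊗ W -/

section

variable {φ} (W : (kernel φ).LeftSupercomodule)

/-- The map `a ⊗ w ↦ a S(c₁) ⊗ c₂ ⊗ w₀` where `c = w₋₁`. -/
def fromTensor : G.alg.carrier ⊗[K] W.carrier →ₗ[K] φ.Square ⊗[K] W.carrier :=
  φ.translationMul.rTensor _ ∘ₗ (TensorProduct.assoc K _ _ _).symm.toLinearMap ∘ₗ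
    W.coact.lTensor _

/-- Multiplying out gives a S(c₁)c₂ = ε(c)a, and the counit axiom of W finishes. In particular
`fromTensor` is injective. -/
theorem squareCounit_fromTensor (t : G.alg.carrier ⊗[K] W.carrier) :
    φ.squareCounit.rTensor _ (fromTensor W t) = t := by
  have h : φ.squareCounit ∘ₗ φ.translationMul =
      (TensorProduct.rid K _).toLinearMap ∘ₗ (kernel φ).counit.lTensor _ :=
    LinearMap.ext Mor.squareCounit_translationMul
  induction t with
  | zero => simp
  | add x y hx hy => simp only [map_add, hx, hy]
  | tmul a w =>
    simp only [fromTensor, LinearMap.comp_apply, LinearMap.lTensor_tmul]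
    rw [← LinearMap.comp_apply (LinearMap.rTensor _ _), ← LinearMap.rTensor_comp, h]
    have h2 : ∀ s : (kernel φ).Coord ⊗[K] W.carrier,
        ((TensorProduct.rid K _).toLinearMap ∘ₗ (kernel φ).counit.lTensor _).rTensor W.carrier
          ((TensorProduct.assoc K G.alg.carrier _ _).symm (a ⊗ₜ[K] s)) =
        a ⊗ₜ[K] (TensorProduct.lid K _ ((kernel φ).counit.rTensor _ s)) := by
      intro s
      induction s with
      | zero => simp
      | add x y hx hy => simp only [map_add, TensorProduct.tmul_add, hx, hy]
      | tmul c w => simp [TensorProduct.smul_tmul]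
    rw [LinearEquiv.coe_coe, h2, W.counit_coact, TensorProduct.lid_tmul, one_smul]

/-- Coassociativity of W: the image of `fromTensor` lies where the coactions of K[N] on K[G] and on
W agree, so that flatness can place it in K[G] ⊗_B (K[G] □ W). -/
theorem squareCoact_fromTensor (t : G.alg.carrier ⊗[K] W.carrier) :
    TensorProduct.assoc K _ _ _ (φ.squareCoact.rTensor _ (fromTensor W t)) =
      W.coact.lTensor _ (fromTensor W t) := by
  have h : φ.squareCoact ∘ₗ φ.translationMul = φ.translationMul.rTensor _ ∘ₗ
      (TensorProduct.assoc K _ _ _).symm.toLinearMap ∘ₗ (kernel φ).comul.lTensor _ :=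
    LinearMap.ext Mor.squareCoact_translationMul
  induction t with
  | zero => simp
  | add x y hx hy => simp only [map_add, hx, hy]
  | tmul a w =>
    simp only [fromTensor, LinearMap.comp_apply, LinearMap.lTensor_tmul]
    rw [← LinearMap.comp_apply (LinearMap.rTensor _ φ.squareCoact), ← LinearMap.rTensor_comp, h]
    have h2 : ∀ s : (kernel φ).Coord ⊗[K] W.carrier,
        TensorProduct.assoc K _ _ _ ((φ.translationMul.rTensor _ ∘ₗ
          (TensorProduct.assoc K _ _ _).symm.toLinearMap ∘ₗ (kernel φ).comul.lTensor _).rTensor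
            W.carrier ((TensorProduct.assoc K G.alg.carrier _ _).symm (a ⊗ₜ[K] s))) =
        φ.translationMul.rTensor _ ((TensorProduct.assoc K _ _ _).symm (a ⊗ₜ[K]
          (TensorProduct.assoc K _ _ _ ((kernel φ).comul.rTensor _ s)))) := by
      intro s
      induction s with
      | zero => simp
      | add x y hx hy => simp only [map_add, TensorProduct.tmul_add, hx, hy]
      | tmul c w =>
        simp only [TensorProduct.assoc_symm_tmul, LinearMap.rTensor_tmul, LinearMap.comp_apply,
          LinearMap.lTensor_tmul]
        generalize (kernel φ).comul c = s
        induction s with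
        | zero => simp
        | add x y hx hy => simp only [map_add, TensorProduct.tmul_add, TensorProduct.add_tmul,
            hx, hy]
        | tmul c c' => rfl
    have h3 : ∀ s : (kernel φ).Coord ⊗[K] W.carrier,
        φ.translationMul.rTensor _ ((TensorProduct.assoc K _ _ _).symm (a ⊗ₜ[K]
          (W.coact.lTensor _ s))) =
        W.coact.lTensor _ (φ.translationMul.rTensor _
          ((TensorProduct.assoc K G.alg.carrier _ _).symm (a ⊗ₜ[K] s))) := by
      intro s
      induction s with
      | zero => simp
      | add x y hx hy => simp only [map_add, TensorProduct.tmul_add, hx, hy]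
      | tmul c w =>
        simp only [TensorProduct.assoc_symm_tmul, LinearMap.rTensor_tmul, LinearMap.lTensor_tmul]
    rw [LinearEquiv.coe_coe, h2, W.coassoc, h3]

theorem fromTensor_mul (a : G.alg.carrier) (t : G.alg.carrier ⊗[K] W.carrier) :
    fromTensor W ((LinearMap.mulLeft K a).rTensor _ t) =
      (φ.squareMul a).rTensor _ (fromTensor W t) := by
  induction t with
  | zero => simp
  | add x y hx hy => simp only [map_add, hx, hy]
  | tmul x w =>
    simp only [fromTensor, LinearMap.comp_apply, LinearMap.lTensor_tmul, LinearMap.rTensor_tmul]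
    generalize W.coact w = s
    induction s with
    | zero => simp
    | add x y hx hy => simp only [map_add, TensorProduct.tmul_add, hx, hy]
    | tmul c w => exact congrArg (· ⊗ₜ[K] w) (φ.squareMul_mul a x _)

/-- On the cotensor product the coaction of W may be traded for the coaction on K[G], after which
a₁S(a₂) ⊗ a₃ = 1 ⊗ a applies. -/
theorem fromTensor_cotensor {d : G.alg.carrier ⊗[K] W.carrier} (hd : d ∈ ClosedSub.cotensor W) :
    fromTensor W d = φ.toSquare _ (d ⊗ₜ[K] 1) := by
  have h : φ.translationMul ∘ₗ (kernel φ).rightCoact =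
      φ.rel.mkQ ∘ₗ TensorProduct.mk K _ _ 1 := LinearMap.ext Mor.translationMul_rightCoact
  have hd' : TensorProduct.assoc K _ _ _ ((kernel φ).rightCoact.rTensor _ d) =
    W.coact.lTensor _ d := hd
  rw [fromTensor, LinearMap.comp_apply, LinearMap.comp_apply, ← hd', LinearEquiv.coe_coe,
    LinearEquiv.symm_apply_apply, ← LinearMap.comp_apply, ← LinearMap.rTensor_comp, h]
  clear hd hd'
  induction d with
  | zero => simp
  | add x y hx hy => simp only [map_add, TensorProduct.add_tmul, hx, hy]
  | tmul a w => rfl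

theorem fromTensor_tensorMul {d : G.alg.carrier ⊗[K] W.carrier} (hd : d ∈ ClosedSub.cotensor W)
    (a : G.alg.carrier) : fromTensor W (tensorMul _ (d ⊗ₜ[K] a)) = φ.toSquare _ (d ⊗ₜ[K] a) := by
  have h : ∀ d : G.alg.carrier ⊗[K] W.carrier,
      tensorMul _ (d ⊗ₜ[K] a) = (LinearMap.mulLeft K a).rTensor _ d := by
    intro d
    induction d with
    | zero => simp
    | add x y hx hy => simp only [map_add, TensorProduct.add_tmul, hx, hy]
    | tmul x w => rfl
  rw [h, fromTensor_mul, fromTensor_cotensor W hd]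
  clear hd
  induction d with
  | zero => simp
  | add x y hx hy => simp only [map_add, TensorProduct.add_tmul, hx, hy]
  | tmul x w =>
    rw [φ.toSquare_tmul, φ.toSquare_tmul, LinearMap.rTensor_tmul, φ.squareMul_mk, mul_one]

/-- The difference of the two coactions on `K[G] ⊗ W`. -/
def coactDiff : G.alg.carrier ⊗[K] W.carrier →ₗ[K]
    G.alg.carrier ⊗[K] ((kernel φ).Coord ⊗[K] W.carrier) :=
  (TensorProduct.assoc K G.alg.carrier (kernel φ).Coord W.carrier).toLinearMap ∘ₗ
      (kernel φ).rightCoact.rTensor W.carrier - W.coact.lTensor G.alg.carrier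

theorem mem_cotensor_iff (d : G.alg.carrier ⊗[K] W.carrier) :
    d ∈ ClosedSub.cotensor W ↔ coactDiff W d = 0 :=
  sub_eq_zero.symm

/-- The coaction on K[G] is B-linear by `rightCoact_sub_mul`, and the coaction on W leaves the first
factor alone. Thus the cotensor product, as the kernel of `coactDiff`, is a B-module. -/
theorem coactDiff_act (s : φ.subᵐᵒᵖ) (t : G.alg.carrier ⊗[K] W.carrier) :
    coactDiff W (φ.tensorAct _ s t) = φ.tensorAct _ s (coactDiff W t) := by
  induction t with
  | zero => simp
  | add x y hx hy => simp only [map_add, hx, hy]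
  | tmul a w =>
    simp only [coactDiff, LinearMap.sub_apply, map_sub, φ.tensorAct_apply, LinearMap.comp_apply,
      LinearMap.rTensor_tmul, LinearMap.lTensor_tmul, LinearMap.mulLeft_apply]
    congr 1
    rw [rightCoact_sub_mul s.unop.2]
    generalize (kernel φ).rightCoact a = t
    induction t with
    | zero => simp
    | add x y hx hy => simp only [map_add, TensorProduct.add_tmul, hx, hy]
    | tmul x w => rfl

theorem toSquare_coactDiff (t : (G.alg.carrier ⊗[K] W.carrier) ⊗[K] G.alg.carrier) :
    φ.toSquare _ ((coactDiff W).rTensor _ t) =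
      TensorProduct.assoc K _ _ _ (φ.squareCoact.rTensor _ (φ.toSquare _ t)) -
        W.coact.lTensor _ (φ.toSquare _ t) := by
  rw [coactDiff, LinearMap.rTensor_sub]
  refine (map_sub (φ.toSquare _) _ _).trans ?_
  congr 1
  · induction t with
    | zero => simp
    | add x y hx hy => simp only [map_add, hx, hy]
    | tmul x a =>
      induction x with
      | zero => simp
      | add x y hx hy => simp only [map_add, TensorProduct.add_tmul, hx, hy]
      | tmul x w =>
        rw [φ.toSquare_tmul, LinearMap.rTensor_tmul, LinearMap.rTensor_tmul, φ.squareCoact_mk,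
          LinearMap.comp_apply, LinearMap.rTensor_tmul]
        generalize (kernel φ).rightCoact x = t
        induction t with
        | zero => simp
        | add x y hx hy => simp only [map_add, TensorProduct.add_tmul, TensorProduct.tmul_add,
            hx, hy]
        | tmul x w => rfl
  · induction t with
    | zero => simp
    | add x y hx hy => simp only [map_add, hx, hy]
    | tmul x a =>
      induction x with
      | zero => simp
      | add x y hx hy => simp only [map_add, TensorProduct.add_tmul, hx, hy]
      | tmul x w =>
        rw [φ.toSquare_tmul, LinearMap.rTensor_tmul, LinearMap.lTensor_tmul,
          LinearMap.lTensor_tmul]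
        generalize W.coact w = t
        induction t with
        | zero => simp
        | add x y hx hy => simp only [map_add, TensorProduct.add_tmul, TensorProduct.tmul_add,
            hx, hy]
        | tmul x w => rfl

/-- The space underlying the cotensor product `K[G] □ W`. -/
def Cotensor : Type u := ClosedSub.cotensor W

instance : AddCommGroup (Cotensor W) := inferInstanceAs (AddCommGroup (ClosedSub.cotensor W))

instance : Module K (Cotensor W) := inferInstanceAs (Module K (ClosedSub.cotensor W))

/-- The inclusion of the cotensor product into the tensor product. -/
def Cotensor.incl : Cotensor W →ₗ[K] G.alg.carrier ⊗[K] W.carrier :=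
  (ClosedSub.cotensor W).subtype

variable {W} in
/-- Functoriality of the cotensor product. -/
def Cotensor.map {V : (kernel φ).LeftSupercomodule} (f : V.Hom W) : Cotensor V →ₗ[K] Cotensor W :=
  ClosedSub.cotensorMap f

/-- The action of the image of `φ^*` on the cotensor product. -/
def cotensorAct : φ.subᵐᵒᵖ →ₗ[K] Cotensor W →ₗ[K] Cotensor W where
  toFun s := ((φ.tensorAct _ s).restrict (fun x hx => by
    rw [mem_cotensor_iff] at hx ⊢
    rw [coactDiff_act, hx, map_zero]) : ClosedSub.cotensor W →ₗ[K] ClosedSub.cotensor W)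
  map_add' s s' := by
    refine LinearMap.ext fun x => Subtype.ext ?_
    exact LinearMap.congr_fun (map_add (φ.tensorAct W.carrier) s s') x.1
  map_smul' c s := by
    refine LinearMap.ext fun x => Subtype.ext ?_
    exact LinearMap.congr_fun (map_smul (φ.tensorAct W.carrier) c s) x.1

/-- The multiplication `(K[G] □ W) ⊗ K[G] → K[G] ⊗ W`. -/
def cotensorMul : Cotensor W ⊗[K] G.alg.carrier →ₗ[K] G.alg.carrier ⊗[K] W.carrier :=
  tensorMul _ ∘ₗ (Cotensor.incl W).rTensor _

theorem fromTensor_cotensorMul (t : Cotensor W ⊗[K] G.alg.carrier) :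
    fromTensor W (cotensorMul W t) =
      φ.toSquare _ ((Cotensor.incl W).rTensor _ t) := by
  induction t with
  | zero => simp
  | add x y hx hy => simp only [map_add, hx, hy]
  | tmul d a => exact fromTensor_tensorMul W d.2 a

/-- K[G] ⊗_B − preserves the kernel of `coactDiff`, so `fromTensor` of any y comes from K[G] ⊗_B
(K[G] □ W). Applying `squareCounit` returns y. -/
theorem cotensorMul_surjective (hK : (2 : K) ≠ 0) : Function.Surjective (cotensorMul W) := by
  intro y
  obtain ⟨t, ht⟩ := φ.toSquare_surjective W.carrier (fromTensor W y)
  have hex : Function.Exact (Cotensor.incl W) (coactDiff W) := fun x => by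
    rw [← mem_cotensor_iff]
    exact ⟨fun h => ⟨⟨x, h⟩, rfl⟩, fun ⟨z, hz⟩ => hz ▸ z.2⟩
  have h1 := ((isLocallyProjective_right φ hK).exact_iff (X' := Cotensor W)
    (X := G.alg.carrier ⊗[K] W.carrier) (cotensorAct W) (φ.tensorAct W.carrier)
    (φ.tensorAct _) (φ.tensorAct_mul _) (φ.tensorAct_mul _) (φ.tensorAct_one _)
    (φ.tensorAct_one _) (Cotensor.incl W) (coactDiff W) (fun _ _ => rfl)
    (coactDiff_act W)).1 hex t
  obtain ⟨t', ht'⟩ := h1.1 (by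
    rw [← φ.toSquare_eq_zero_iff, toSquare_coactDiff, ht, squareCoact_fromTensor, sub_self])
  refine ⟨t', ?_⟩
  rw [← φ.toSquare_eq_zero_iff, map_sub, sub_eq_zero, ht] at ht'
  rw [cotensorMul, LinearMap.comp_apply, ← squareCounit_toSquare φ, ← ht', squareCounit_fromTensor]

/-- By flatness the inclusion of the cotensor product stays injective after K[G] ⊗_B −. This
injection factors as `fromTensor` after `cotensorMul`, and `fromTensor` is injective. -/
theorem cotensorMul_eq_zero_iff (hK : (2 : K) ≠ 0)
    (t : Cotensor W ⊗[K] G.alg.carrier) :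
    cotensorMul W t = 0 ↔ t ∈ balancedRel (X := Cotensor W) (cotensorAct W) φ.rightAct := by
  have hmul : ∀ (s s' : φ.subᵐᵒᵖ) (x : Cotensor W),
      cotensorAct W (s * s') x = cotensorAct W s' (cotensorAct W s x) := fun s s' x =>
    Subtype.ext (φ.tensorAct_mul _ s s' x.1)
  have hone : ∀ x : Cotensor W, cotensorAct W 1 x = x := fun x =>
    Subtype.ext (φ.tensorAct_one _ x.1)
  have hex : Function.Exact (0 : PUnit.{u + 1} →ₗ[K] Cotensor W)
      (Cotensor.incl W) := fun x =>
    ⟨fun h => ⟨0, Subtype.ext h.symm⟩, fun ⟨_, h⟩ => h ▸ rfl⟩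
  have h1 := ((isLocallyProjective_right φ hK).exact_iff (X' := PUnit.{u + 1})
    (X := Cotensor W) 0 (cotensorAct W)
    (φ.tensorAct W.carrier) hmul (φ.tensorAct_mul _) hone (φ.tensorAct_one _) 0
    (Cotensor.incl W) (fun s x => by simp) (fun _ _ => rfl)).1 hex t
  have h2 : t ∈ balancedRel (X := Cotensor W) (cotensorAct W) φ.rightAct ↔
      ∃ t' : PUnit.{u + 1} ⊗[K] G.alg.carrier, t - (0 : PUnit.{u + 1} →ₗ[K]
        Cotensor W).rTensor _ t' ∈ balancedRel (X := Cotensor W) (cotensorAct W) φ.rightAct := by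
    simp only [LinearMap.rTensor_zero, LinearMap.zero_apply, sub_zero]
    exact ⟨fun h => ⟨0, h⟩, fun ⟨_, h⟩ => h⟩
  rw [h2, ← h1, ← φ.toSquare_eq_zero_iff, ← fromTensor_cotensorMul]
  refine ⟨fun h => by rw [h, map_zero], fun h => ?_⟩
  rw [← squareCounit_fromTensor W (cotensorMul W t), h, map_zero]

theorem cotensorMul_map {V W : (kernel φ).LeftSupercomodule} (f : V.Hom W)
    (t : Cotensor V ⊗[K] G.alg.carrier) :
    cotensorMul W ((Cotensor.map f).rTensor _ t) =
      f.lin.lTensor _ (cotensorMul V t) := by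
  have h : ∀ s : (G.alg.carrier ⊗[K] V.carrier) ⊗[K] G.alg.carrier,
      tensorMul _ ((f.lin.lTensor _).rTensor _ s) = f.lin.lTensor _ (tensorMul _ s) := by
    intro s
    induction s with
    | zero => simp
    | add x y hx hy => simp only [map_add, hx, hy]
    | tmul x a =>
      induction x with
      | zero => simp
      | add x y hx hy => simp only [map_add, TensorProduct.add_tmul, hx, hy]
      | tmul x w => rfl
  induction t with
  | zero => simp
  | add x y hx hy => simp only [map_add, hx, hy]
  | tmul d a => exact h (d.1 ⊗ₜ[K] a)

end

/-- The kernel of a morphism of affine supergroups is faithfully exact. -/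
theorem kernel_isFaithfullyExact (hK : (2 : K) ≠ 0) : (kernel φ).IsFaithfullyExact := by
  intro V' V V'' f g
  change Function.Exact f.lin g.lin ↔ Function.Exact (Cotensor.map f) (Cotensor.map g)
  have hmul : ∀ (W : (kernel φ).LeftSupercomodule) (s s' : φ.subᵐᵒᵖ) (x : Cotensor W),
      cotensorAct W (s * s') x = cotensorAct W s' (cotensorAct W s x) := fun W s s' x =>
    Subtype.ext (φ.tensorAct_mul _ s s' x.1)
  have hone : ∀ (W : (kernel φ).LeftSupercomodule) (x : Cotensor W),
      cotensorAct W 1 x = x := fun W x => Subtype.ext (φ.tensorAct_one _ x.1)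
  have hact : ∀ {V W : (kernel φ).LeftSupercomodule} (f : V.Hom W) (s : φ.subᵐᵒᵖ)
      (x : Cotensor V), Cotensor.map f (cotensorAct V s x) =
        cotensorAct W s (Cotensor.map f x) := fun {V W} f s x =>
    Subtype.ext (LinearMap.congr_fun ((LinearMap.lTensor_comp_rTensor _ _ _).trans
      (LinearMap.rTensor_comp_lTensor _ _ _).symm) x.1)
  -- Exactness of the cotensor sequence is tested after K[G] ⊗_B −. There `cotensorMul` turns it
  -- into the sequence K[G] ⊗ V' → K[G] ⊗ V → K[G] ⊗ V'', whose exactness is that of the original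
  -- one since K[G] ≠ 0 and K is a field.
  rw [(isLocallyProjective_right φ hK).exact_iff (X' := Cotensor V')
    (X := Cotensor V) (X'' := Cotensor V'') (cotensorAct V') (cotensorAct V)
    (cotensorAct V'') (hmul V) (hmul V'') (hone V) (hone V'') (Cotensor.map f)
    (Cotensor.map g) (hact f) (hact g)]
  have : Nontrivial G.alg.carrier := ⟨1, 0, fun h => by
    have := G.counit_one
    rw [h, map_zero] at this
    exact zero_ne_one this⟩
  rw [← Module.FaithfullyFlat.lTensor_exact_iff_exact K G.alg.carrier f.lin g.lin]
  have key : ∀ t : Cotensor V ⊗[K] G.alg.carrier,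
      (∃ t', cotensorMul V (t - (Cotensor.map f).rTensor _ t') = 0) ↔
      cotensorMul V t ∈ Set.range (f.lin.lTensor G.alg.carrier) := by
    intro t
    simp only [map_sub, sub_eq_zero, cotensorMul_map]
    constructor
    · rintro ⟨t', h⟩
      exact ⟨_, h.symm⟩
    · rintro ⟨w, h⟩
      obtain ⟨t', rfl⟩ := cotensorMul_surjective V' hK w
      exact ⟨t', h.symm⟩
  simp only [← cotensorMul_eq_zero_iff _ hK, cotensorMul_map, key]
  constructor
  · intro h t
    exact h _
  · intro h w
    obtain ⟨t, rfl⟩ := cotensorMul_surjective V hK w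
    exact h t

end AffineSupergroup

end

end Super

namespace Super

noncomputable section

variable {K : Type u} [Field K]

/-! ### Constructions of commutative superalgebras -/

namespace SAlg

section Involution

variable {T : Type u} [Ring T] [Algebra K T] (σ : T →ₐ[K] T)

/-- The eigenspaces of an involution, as a `ZMod 2`-grading. -/
def involutionGr (i : ZMod 2) : Submodule K T :=
  LinearMap.eqLocus σ.toLinearMap (if i = 0 then LinearMap.id else -LinearMap.id)

theorem mem_involutionGr_zero {x : T} : x ∈ involutionGr σ 0 ↔ σ x = x := Iff.rfl

theorem mem_involutionGr_one {x : T} : x ∈ involutionGr σ 1 ↔ σ x = -x := by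
  change σ x = (if (1 : ZMod 2) = 0 then LinearMap.id else -LinearMap.id : T →ₗ[K] T) x ↔ _
  rw [if_neg one_ne_zero]
  rfl

theorem zmod_two_cases (i : ZMod 2) : i = 0 ∨ i = 1 := by revert i; decide

theorem involutionGr_isInternal (hK : (2 : K) ≠ 0) (hσ : ∀ x, σ (σ x) = x) :
    DirectSum.IsInternal (involutionGr σ) := by
  refine (DirectSum.isInternal_submodule_iff_isCompl (involutionGr σ) (i := 0) (j := 1)
    zero_ne_one (by ext i; revert i; decide)).2 ⟨?_, ?_⟩
  · rw [Submodule.disjoint_def]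
    intro x h0 h1
    rw [mem_involutionGr_zero] at h0
    rw [mem_involutionGr_one, h0] at h1
    have h2 : (2 : K) • x = 0 := by rw [two_smul]; nth_rw 1 [h1]; exact neg_add_cancel x
    exact (smul_eq_zero.1 h2).resolve_left hK
  · rw [codisjoint_iff, Submodule.eq_top_iff']
    intro x
    refine Submodule.mem_sup.2 ⟨(2⁻¹ : K) • (x + σ x), ?_, (2⁻¹ : K) • (x - σ x), ?_, ?_⟩
    · rw [mem_involutionGr_zero, map_smul, map_add, hσ, add_comm]
    · rw [mem_involutionGr_one, map_smul, map_sub, hσ, ← smul_neg, neg_sub]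
    · rw [← smul_add, add_add_sub_cancel, ← two_smul K, smul_smul, inv_mul_cancel₀ hK, one_smul]

/-- The commutative superalgebra given by an algebra with an involution. -/
def ofInvolution (hK : (2 : K) ≠ 0) (hσ : ∀ x, σ (σ x) = x)
    (hcomm : ∀ x y : T, (2 : K) • (x * y) = y * x + σ y * x + y * σ x - σ y * σ x) : SAlg K where
  carrier := T
  gr := involutionGr σ
  graded :=
    { one_mem := map_one σ
      mul_mem := fun i j x y hx hy => by
        obtain rfl | rfl := zmod_two_cases i <;> obtain rfl | rfl := zmod_two_cases j
        · rw [mem_involutionGr_zero] at hx hy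
          change σ (x * y) = x * y
          rw [map_mul, hx, hy]
        · rw [mem_involutionGr_zero] at hx
          rw [mem_involutionGr_one] at hy
          rw [zero_add, mem_involutionGr_one, map_mul, hx, hy, mul_neg]
        · rw [mem_involutionGr_zero] at hy
          rw [mem_involutionGr_one] at hx
          rw [add_zero, mem_involutionGr_one, map_mul, hx, hy, neg_mul]
        · rw [mem_involutionGr_one] at hx hy
          change σ (x * y) = x * y
          rw [map_mul, hx, hy, neg_mul_neg]
      toDecomposition := (involutionGr_isInternal σ hK hσ).chooseDecomposition }
  supercomm i j x y hx hy := by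
    -- On eigenvectors of σ the identity reads 2xy = ±2yx with the supercommutative sign.
    have h := hcomm x y
    have h2 : ∀ u v : T, (2 : K) • u = v + v → u = v := fun u v e => by
      rw [← two_smul K v] at e
      exact smul_right_injective T hK e
    obtain rfl | rfl := zmod_two_cases i <;> obtain rfl | rfl := zmod_two_cases j
    · rw [mem_involutionGr_zero] at hx hy
      rw [mul_zero, uzpow_zero, one_smul]
      refine h2 _ _ (h.trans ?_)
      rw [hx, hy]; abel
    · rw [mem_involutionGr_zero] at hx
      rw [mem_involutionGr_one] at hy
      rw [zero_mul, uzpow_zero, one_smul]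
      refine h2 _ _ (h.trans ?_)
      rw [hx, hy, neg_mul]; abel
    · rw [mem_involutionGr_zero] at hy
      rw [mem_involutionGr_one] at hx
      rw [mul_zero, uzpow_zero, one_smul]
      refine h2 _ _ (h.trans ?_)
      rw [hx, hy, mul_neg]; abel
    · rw [mem_involutionGr_one] at hx hy
      rw [mul_one, uzpow_one, Units.neg_smul, one_smul]
      refine h2 _ _ (h.trans ?_)
      rw [hx, hy, neg_mul_neg, mul_neg, neg_mul]; abel

theorem ofInvolution_parity (hK : (2 : K) ≠ 0) (hσ : ∀ x, σ (σ x) = x)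
    (hcomm : ∀ x y : T, (2 : K) • (x * y) = y * x + σ y * x + y * σ x - σ y * σ x) (x : T) :
    (ofInvolution σ hK hσ hcomm).parity x = σ x := by
  let A := ofInvolution σ hK hσ hcomm
  have h0 : σ (A.proj 0 x) = A.proj 0 x := A.proj_mem 0 x
  have h1 : σ (A.proj 1 x) = -A.proj 1 x := (mem_involutionGr_one σ).1 (A.proj_mem 1 x)
  have h2 : A.proj 0 x + A.proj 1 x = x := proj_add_proj (A := A) x
  have h3 : σ (A.proj 0 x) + σ (A.proj 1 x) = σ x := (map_add σ _ _).symm.trans (congrArg σ h2)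
  rw [h0, h1] at h3
  rw [← h3]
  exact sub_eq_add_neg _ _

end Involution

variable {A B C : SAlg K}

theorem mem_gr_zero_of_parity (hK : (2 : K) ≠ 0) {a : A.carrier} (h : A.parity a = a) :
    a ∈ A.gr 0 := by
  have h1 := proj_add_proj a
  rw [parity_apply, ← h1] at h
  have h2 : (2 : K) • A.proj 1 a = 0 := by
    have e : A.proj 1 a = -A.proj 1 a := by
      rw [h1] at h
      nth_rw 3 [← h1] at h
      rw [sub_eq_add_neg] at h
      exact (add_left_cancel h).symm
    rw [two_smul]; nth_rw 1 [e]; exact neg_add_cancel _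
  have h3 := (smul_eq_zero.1 h2).resolve_left hK
  rw [← h1, h3, add_zero]
  exact proj_mem 0 a

theorem mem_gr_one_of_parity (hK : (2 : K) ≠ 0) {a : A.carrier} (h : A.parity a = -a) :
    a ∈ A.gr 1 := by
  have h1 := proj_add_proj a
  have h2 : (2 : K) • A.proj 0 a = 0 := by
    have e : A.proj 0 a - A.proj 1 a = -(A.proj 0 a + A.proj 1 a) := by
      rw [h1, ← h, parity_apply]
    have e2 : A.proj 0 a + A.proj 0 a = 0 := by
      have := congrArg (· + (A.proj 0 a + A.proj 1 a)) e
      simp only [neg_add_cancel] at this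
      rw [← this]; abel
    rw [two_smul, e2]
  have h3 := (smul_eq_zero.1 h2).resolve_left hK
  rw [← h1, h3, zero_add]
  exact proj_mem 1 a

/-- Algebra maps that commute with the parity involutions are even. -/
def homOfParity (hK : (2 : K) ≠ 0) (f : A.carrier →ₐ[K] B.carrier)
    (hf : ∀ a, B.parity (f a) = f (A.parity a)) : A ⟶ B where
  toAlgHom := f
  even i a ha := by
    obtain rfl | rfl := zmod_two_cases i
    · exact mem_gr_zero_of_parity hK (by rw [hf, parity_even ha])
    · exact mem_gr_one_of_parity hK (by rw [hf, parity_odd ha, map_neg])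

variable (A) in
/-- The parity involution as an algebra map. -/
def parityHom : A.carrier →ₐ[K] A.carrier :=
  AlgHom.ofLinearMap A.parity (parity_even one_mem_even) parity_mul

theorem parityHom_apply (a : A.carrier) : A.parityHom a = A.parity a := rfl

theorem parity_mem {i : ZMod 2} {a : A.carrier} (ha : a ∈ A.gr i) : A.parity a ∈ A.gr i := by
  obtain rfl | rfl := zmod_two_cases i
  · rwa [parity_even ha]
  · rw [parity_odd ha]; exact neg_mem ha

/-- Supercommutativity as a bilinear identity, without homogeneous components: write 2a = (a + σa) +
(a − σa), where the first summand commutes with b and the second passes b at the cost of replacing b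
by σb. In this form it is inherited by quotients and products, and can be imposed on a free algebra.
-/
theorem two_smul_mul (a b : A.carrier) : (2 : K) • (a * b) =
    b * a + A.parity b * a + b * A.parity a - A.parity b * A.parity a := by
  have h0 : A.proj 0 a * b = b * A.proj 0 a := even_comm (proj_mem 0 a) b
  have h1 : A.proj 1 a * b = A.parity b * A.proj 1 a := odd_mul (proj_mem 1 a) b
  have ha := (proj_add_proj a).symm
  rw [parity_apply a]
  generalize A.proj 0 a = p at *
  generalize A.proj 1 a = q at *
  subst ha
  rw [add_mul, h0, h1, two_smul]
  noncomm_ring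

theorem parity_of_mem {i : ZMod 2} {a : A.carrier} (ha : a ∈ A.gr i) :
    A.parity a = ((-1 : ℤˣ) ^ i) • a := by
  obtain rfl | rfl := zmod_two_cases i
  · rw [parity_even ha, uzpow_zero, one_smul]
  · rw [parity_odd ha, uzpow_one, Units.neg_smul, one_smul]

/-! ### Tensor products -/

variable (A B) in
/-- The parity involution of the graded tensor product. -/
def tensorParity : GradedTensorProduct K A.gr B.gr →ₐ[K] GradedTensorProduct K A.gr B.gr :=
  GradedTensorProduct.lift A.gr B.gr ((GradedTensorProduct.includeLeft A.gr B.gr).comp A.parityHom)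
    ((GradedTensorProduct.includeRight A.gr B.gr).comp B.parityHom) (fun _ _ a b =>
      ((GradedTensorProduct.liftEquiv A.gr B.gr).symm (AlgHom.id K _)).2
        ⟨_, parity_mem a.2⟩ ⟨_, parity_mem b.2⟩)

theorem tensorParity_tmul (a : A.carrier) (b : B.carrier) :
    tensorParity A B (GradedTensorProduct.of K A.gr B.gr (a ⊗ₜ b)) =
      GradedTensorProduct.of K A.gr B.gr (A.parity a ⊗ₜ B.parity b) :=
  GradedTensorProduct.tmul_one_mul_one_tmul A.gr B.gr (A.parity a) (B.parity b)

theorem tensorParity_tensorParity (t : GradedTensorProduct K A.gr B.gr) :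
    tensorParity A B (tensorParity A B t) = t := by
  obtain ⟨t, rfl⟩ := (GradedTensorProduct.of K A.gr B.gr).surjective t
  induction t with
  | zero => simp
  | add x y hx hy => simp only [map_add, hx, hy]
  | tmul a b => rw [tensorParity_tmul, tensorParity_tmul, parity_parity, parity_parity]

/-- Both sides are bilinear, which reduces the claim to homogeneous pure tensors; there it is a sign
check in the sixteen parity cases. -/
theorem tensor_two_smul_mul (s t : GradedTensorProduct K A.gr B.gr) :
    (2 : K) • (s * t) = t * s + tensorParity A B t * s + t * tensorParity A B s -
      tensorParity A B t * tensorParity A B s := by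
  obtain ⟨s, rfl⟩ := (GradedTensorProduct.of K A.gr B.gr).surjective s
  obtain ⟨t, rfl⟩ := (GradedTensorProduct.of K A.gr B.gr).surjective t
  induction s with
  | zero => simp
  | add x y hx hy => simp only [map_add, add_mul, mul_add, smul_add, hx, hy]; abel
  | tmul x y =>
    induction t with
    | zero => simp
    | add x y hx hy => simp only [map_add, add_mul, mul_add, smul_add, hx, hy]; abel
    | tmul a b =>
      induction x using DirectSum.Decomposition.inductionOn A.gr with
      | zero => simp
      | add x y hx hy =>
        simp only [map_add, TensorProduct.add_tmul, add_mul, mul_add, smul_add, hx, hy]; abel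
      | @homogeneous i x =>
      induction y using DirectSum.Decomposition.inductionOn B.gr with
      | zero => simp
      | add x y hx hy =>
        simp only [map_add, TensorProduct.tmul_add, add_mul, mul_add, smul_add, hx, hy]; abel
      | @homogeneous j y =>
      induction a using DirectSum.Decomposition.inductionOn A.gr with
      | zero => simp
      | add x y hx hy =>
        simp only [map_add, TensorProduct.add_tmul, add_mul, mul_add, smul_add, hx, hy]; abel
      | @homogeneous k a =>
      induction b using DirectSum.Decomposition.inductionOn B.gr with
      | zero => simp
      | add x y hx hy =>
        simp only [map_add, TensorProduct.tmul_add, add_mul, mul_add, smul_add, hx, hy]; abel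
      | @homogeneous l b =>
      have e1 := GradedTensorProduct.tmul_coe_mul_coe_tmul (R := K) A.gr B.gr (x : A.carrier) y a b
      have e2 := GradedTensorProduct.tmul_coe_mul_coe_tmul (R := K) A.gr B.gr (a : A.carrier) b x y
      rw [A.supercomm i k _ _ x.2 a.2, B.supercomm j l _ _ y.2 b.2] at e1
      have px := parity_of_mem x.2
      have py := parity_of_mem y.2
      have pa := parity_of_mem a.2
      have pb := parity_of_mem b.2
      simp only [tensorParity_tmul, px, py, pa, pb, two_smul]
      change _ = ((-1 : ℤˣ) ^ (j * k)) • GradedTensorProduct.of K A.gr B.gr (_ ⊗ₜ[K] _) at e1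
      change _ = ((-1 : ℤˣ) ^ (l * i)) • GradedTensorProduct.of K A.gr B.gr (_ ⊗ₜ[K] _) at e2
      change GradedTensorProduct.of K A.gr B.gr (_ ⊗ₜ[K] _) *
        GradedTensorProduct.of K A.gr B.gr (_ ⊗ₜ[K] _) = _ at e1 e2
      obtain rfl | rfl := zmod_two_cases i <;> obtain rfl | rfl := zmod_two_cases j <;>
        obtain rfl | rfl := zmod_two_cases k <;> obtain rfl | rfl := zmod_two_cases l <;>
        simp only [mul_zero, mul_one, uzpow_zero, uzpow_one, Units.neg_smul, one_smul, neg_tmul,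
          tmul_neg, map_neg, neg_neg, neg_mul, mul_neg] at e1 e2 ⊢ <;>
        rw [e1, e2] <;> abel

variable (A B) in
/-- The tensor product of commutative superalgebras. -/
def tensor (hK : (2 : K) ≠ 0) : SAlg K :=
  ofInvolution (tensorParity A B) hK tensorParity_tensorParity tensor_two_smul_mul

variable (A B) in
/-- The inclusion of the first factor. -/
def tensorInl (hK : (2 : K) ≠ 0) : A ⟶ tensor A B hK :=
  homOfParity hK (GradedTensorProduct.includeLeft A.gr B.gr) (fun a => by
    refine (ofInvolution_parity _ hK _ _ _).trans ?_
    refine (tensorParity_tmul a 1).trans ?_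
    rw [parity_even one_mem_even]
    rfl)

variable (A B) in
/-- The inclusion of the second factor. -/
def tensorInr (hK : (2 : K) ≠ 0) : B ⟶ tensor A B hK :=
  homOfParity hK (GradedTensorProduct.includeRight A.gr B.gr) (fun b => by
    refine (ofInvolution_parity _ hK _ _ _).trans ?_
    refine (tensorParity_tmul 1 b).trans ?_
    rw [parity_even one_mem_even]
    rfl)

/-- The universal property of the tensor product, as an algebra map. -/
def tensorLiftHom (f : A ⟶ C) (g : B ⟶ C) : GradedTensorProduct K A.gr B.gr →ₐ[K] C.carrier :=
  GradedTensorProduct.lift A.gr B.gr f.toAlgHom g.toAlgHom (fun i j a b => by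
    rw [mul_comm j i]
    exact C.supercomm i j _ _ (f.even i _ a.2) (g.even j _ b.2))

theorem tensorLiftHom_parity (f : A ⟶ C) (g : B ⟶ C) (t : GradedTensorProduct K A.gr B.gr) :
    C.parity (tensorLiftHom f g t) = tensorLiftHom f g (tensorParity A B t) := by
  obtain ⟨t, rfl⟩ := (GradedTensorProduct.of K A.gr B.gr).surjective t
  induction t with
  | zero => simp
  | add x y hx hy => simp only [map_add, hx, hy]
  | tmul a b =>
    rw [tensorParity_tmul]
    change C.parity (f.toAlgHom a * g.toAlgHom b) =
      f.toAlgHom (A.parity a) * g.toAlgHom (B.parity b)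
    rw [parity_mul, parity_map, parity_map]

/-- The universal property of the tensor product. -/
def tensorLift (hK : (2 : K) ≠ 0) (f : A ⟶ C) (g : B ⟶ C) : tensor A B hK ⟶ C :=
  homOfParity hK (tensorLiftHom f g) (fun t => by
    rw [show (tensor A B hK).parity t = tensorParity A B t from ofInvolution_parity _ hK _ _ t]
    exact tensorLiftHom_parity f g t)

theorem tensorInl_lift (hK : (2 : K) ≠ 0) (f : A ⟶ C) (g : B ⟶ C) :
    tensorInl A B hK ≫ tensorLift hK f g = f := by
  ext a
  change f.toAlgHom a * g.toAlgHom 1 = f.toAlgHom a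
  rw [map_one, mul_one]

theorem tensorInr_lift (hK : (2 : K) ≠ 0) (f : A ⟶ C) (g : B ⟶ C) :
    tensorInr A B hK ≫ tensorLift hK f g = g := by
  ext b
  change f.toAlgHom 1 * g.toAlgHom b = g.toAlgHom b
  rw [map_one, one_mul]

theorem tensor_hom_ext {hK : (2 : K) ≠ 0} {f g : tensor A B hK ⟶ C}
    (hl : tensorInl A B hK ≫ f = tensorInl A B hK ≫ g)
    (hr : tensorInr A B hK ≫ f = tensorInr A B hK ≫ g) : f = g := by
  have h : f.toAlgHom = g.toAlgHom :=
    GradedTensorProduct.algHom_ext A.gr B.gr (congrArg SAlg.Hom.toAlgHom hl)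
      (congrArg SAlg.Hom.toAlgHom hr)
  exact SAlg.Hom.ext h

/-! ### Quotients -/

/-- By `two_smul_mul`, 2ab is a combination of left multiples of a and of its parity image. -/
theorem isTwoSided_of_parity (hK : (2 : K) ≠ 0) {I : Ideal A.carrier}
    (hI : ∀ x ∈ I, A.parity x ∈ I) : I.IsTwoSided := by
  refine ⟨fun {a} b ha => ?_⟩
  have h : (2 : K) • (a * b) ∈ I := by
    rw [two_smul_mul]
    exact I.sub_mem (I.add_mem (I.add_mem (I.mul_mem_left _ ha) (I.mul_mem_left _ ha))
      (I.mul_mem_left _ (hI _ ha))) (I.mul_mem_left _ (hI _ ha))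
  have h2 := I.mul_mem_left (algebraMap K A.carrier 2⁻¹) h
  rwa [← Algebra.smul_def, smul_smul, inv_mul_cancel₀ hK, one_smul] at h2

variable (A) in
/-- The quotient of a commutative superalgebra by a left ideal stable under parity. -/
def quot (hK : (2 : K) ≠ 0) (I : Ideal A.carrier) (hI : ∀ x ∈ I, A.parity x ∈ I) : SAlg K :=
  haveI := isTwoSided_of_parity hK hI
  ofInvolution (T := A.carrier ⧸ I)
    (Ideal.Quotient.liftₐ I ((Ideal.Quotient.mkₐ K I).comp A.parityHom) (fun x hx =>
      Ideal.Quotient.eq_zero_iff_mem.2 (hI x hx))) hK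
    (fun x => by
      obtain ⟨x, rfl⟩ := Ideal.Quotient.mk_surjective x
      exact congrArg (Ideal.Quotient.mk I) (parity_parity x))
    (fun x y => by
      obtain ⟨x, rfl⟩ := Ideal.Quotient.mk_surjective x
      obtain ⟨y, rfl⟩ := Ideal.Quotient.mk_surjective y
      exact congrArg (Ideal.Quotient.mkₐ K I) (two_smul_mul x y))

variable (A) in
/-- The projection onto a quotient. -/
def quotMk (hK : (2 : K) ≠ 0) (I : Ideal A.carrier) (hI : ∀ x ∈ I, A.parity x ∈ I) :
    A ⟶ A.quot hK I hI :=
  haveI := isTwoSided_of_parity hK hI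
  homOfParity hK (Ideal.Quotient.mkₐ K I) (fun _ => ofInvolution_parity _ hK _ _ _)

theorem quotMk_eq_iff (hK : (2 : K) ≠ 0) (I : Ideal A.carrier) (hI : ∀ x ∈ I, A.parity x ∈ I)
    (a b : A.carrier) :
    (quotMk A hK I hI).toAlgHom a = (quotMk A hK I hI).toAlgHom b ↔ a - b ∈ I :=
  haveI := isTwoSided_of_parity hK hI
  Ideal.Quotient.mk_eq_mk_iff_sub_mem a b

/-! ### Products -/

/-- The parity involution of a product. -/
def piParity {n : ℕ} (A : Fin n → SAlg K) : (∀ i, (A i).carrier) →ₐ[K] (∀ i, (A i).carrier) :=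
  AlgHom.pi fun i => (A i).parityHom.comp (Pi.evalAlgHom K _ i)

/-- The product of a finite family of commutative superalgebras. -/
def pi (hK : (2 : K) ≠ 0) {n : ℕ} (A : Fin n → SAlg K) : SAlg K :=
  ofInvolution (T := ∀ i, (A i).carrier) (piParity A) hK
    (fun x => funext fun i => parity_parity (x i))
    (fun x y => funext fun i => two_smul_mul (x i) (y i))

/-- The morphism into a product given by its components. -/
def piLift (hK : (2 : K) ≠ 0) {n : ℕ} {A : Fin n → SAlg K} (f : ∀ i, B ⟶ A i) : B ⟶ pi hK A :=
  homOfParity hK (AlgHom.pi fun i => (f i).toAlgHom) (fun b =>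
    (ofInvolution_parity _ hK _ _ _).trans (funext fun i => parity_map (f i) b))

end SAlg

end

end Super

namespace Super

noncomputable section

variable {K : Type u} [Field K]

/-! ### Faithfully flat descent -/

section Descent

variable {R S : SAlg K}

/-- The right module structure on a subspace of an `R`-superalgebra that is stable under right
multiplication by `R`. -/
abbrev subModule (f : R ⟶ S) (P : Submodule K S.carrier)
    (hmul : ∀ p ∈ P, ∀ r, p * f.toAlgHom r ∈ P) : Module R.carrierᵐᵒᵖ P where
  smul r p := ⟨p.1 * f.toAlgHom r.unop, hmul p.1 p.2 _⟩
  one_smul p := Subtype.ext (by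
    change p.1 * f.toAlgHom 1 = p.1
    rw [map_one, mul_one])
  mul_smul r s p := Subtype.ext (by
    change p.1 * f.toAlgHom (s.unop * r.unop) = p.1 * f.toAlgHom s.unop * f.toAlgHom r.unop
    rw [map_mul, mul_assoc])
  smul_zero r := Subtype.ext (zero_mul _)
  smul_add r p q := Subtype.ext (add_mul _ _ _)
  add_smul r s p := Subtype.ext (by
    change p.1 * f.toAlgHom (r.unop + s.unop) = _
    rw [map_add, mul_add]
    rfl)
  zero_smul p := Subtype.ext (by
    change p.1 * f.toAlgHom 0 = 0
    rw [map_zero, mul_zero])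

/-- A graded subspace of an `R`-superalgebra stable under right multiplication by `R`, as a right
supermodule. -/
def RightSupermodule.ofSub (f : R ⟶ S) (P : Submodule K S.carrier)
    (hmul : ∀ p ∈ P, ∀ r, p * f.toAlgHom r ∈ P) (hgr : ∀ i, ∀ p ∈ P, S.proj i p ∈ P) :
    RightSupermodule R where
  carrier := P
  module := subModule f P hmul
  tower := by
    let _ := subModule f P hmul
    refine ⟨fun c r p => Subtype.ext ?_⟩
    change p.1 * f.toAlgHom (c • r.unop) = c • (p.1 * f.toAlgHom r.unop)
    rw [map_smul, mul_smul_comm]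
  gr i := (S.gr i).comap P.subtype
  decomposition := by
    refine DirectSum.IsInternal.chooseDecomposition _ ?_
    refine (DirectSum.isInternal_submodule_iff_isCompl _ (i := 0) (j := 1)
      zero_ne_one (by ext i; revert i; decide)).2 ⟨?_, ?_⟩
    · rw [Submodule.disjoint_def]
      intro x h0 h1
      exact Subtype.ext ((SAlg.proj_of_mem h0).symm.trans (SAlg.proj_zero_of_odd h1))
    · rw [codisjoint_iff, Submodule.eq_top_iff']
      rintro ⟨x, hx⟩
      exact Submodule.mem_sup.2 ⟨⟨S.proj 0 x, hgr 0 x hx⟩, SAlg.proj_mem 0 x,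
        ⟨S.proj 1 x, hgr 1 x hx⟩, SAlg.proj_mem 1 x, Subtype.ext (SAlg.proj_add_proj x)⟩
  smul_mem i j r x hr hx := by
    rw [add_comm]
    exact SAlg.mul_mem hx (f.even i r hr)

/-- The zero supermodule. -/
def RightSupermodule.zero (f : R ⟶ S) : RightSupermodule R :=
  RightSupermodule.ofSub f ⊥ (fun p hp r => by
    rw [Submodule.mem_bot] at hp ⊢; rw [hp, zero_mul]) (fun i p hp => by
    rw [Submodule.mem_bot] at hp ⊢; rw [hp, map_zero])

/-- The inclusion of subspaces of an `R`-superalgebra. -/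
def RightSupermodule.incl (f : R ⟶ S) {P Q : Submodule K S.carrier}
    (hP : ∀ p ∈ P, ∀ r, p * f.toAlgHom r ∈ P) (hP' : ∀ i, ∀ p ∈ P, S.proj i p ∈ P)
    (hQ : ∀ p ∈ Q, ∀ r, p * f.toAlgHom r ∈ Q) (hQ' : ∀ i, ∀ p ∈ Q, S.proj i p ∈ Q) (h : P ≤ Q) :
    (RightSupermodule.ofSub f P hP hP').Hom (RightSupermodule.ofSub f Q hQ hQ') where
  lin := Submodule.inclusion h
  map_smul _ _ := rfl
  even _ _ hx := hx

/-- The zero map of supermodules. -/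
def RightSupermodule.zeroHom (X Y : RightSupermodule R) : X.Hom Y where
  lin := 0
  map_smul r x := by rw [LinearMap.zero_apply, LinearMap.zero_apply, smul_zero]
  even i x _ := zero_mem _

variable {Y : Type u} [AddCommGroup Y] [Module K Y] {act : R.carrier →ₐ[K] Module.End K Y}

variable (act) in
/-- The relations defining the tensor product of a subspace of an `R`-superalgebra with a
module. -/
def subRel (f : R ⟶ S) (P : Submodule K S.carrier) (hP : ∀ p ∈ P, ∀ r, p * f.toAlgHom r ∈ P) :
    Submodule K (P ⊗[K] Y) :=
  Submodule.span K {t | ∃ (p : P) (r : R.carrier) (y : Y),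
    t = (⟨p.1 * f.toAlgHom r, hP p.1 p.2 r⟩ : P) ⊗ₜ[K] y - p ⊗ₜ[K] act r y}

theorem subsingleton_zero_tensor (f : R ⟶ S) :
    Subsingleton (((RightSupermodule.zero f).carrier ⊗[K] Y) ⧸
      tensorRel (RightSupermodule.zero f) act) := by
  refine ⟨fun x y => ?_⟩
  have h : ∀ x : ((RightSupermodule.zero f).carrier ⊗[K] Y) ⧸
      tensorRel (RightSupermodule.zero f) act, x = 0 := by
    intro x
    obtain ⟨t, rfl⟩ := Submodule.mkQ_surjective _ x
    have ht : t = 0 := by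
      induction t with
      | zero => rfl
      | add x y hx hy => rw [hx, hy, add_zero]
      | tmul a b =>
        have : a = 0 := Subtype.ext ((Submodule.mem_bot K).1 a.2)
        rw [this, TensorProduct.zero_tmul]
    rw [ht, map_zero]
  rw [h x, h y]

/-- Flat modules preserve inclusions. -/
theorem IsFaithfullyFlat.injective_incl (hff : IsFaithfullyFlat act) (f : R ⟶ S)
    {P Q : Submodule K S.carrier}
    (hP : ∀ p ∈ P, ∀ r, p * f.toAlgHom r ∈ P) (hP' : ∀ i, ∀ p ∈ P, S.proj i p ∈ P)
    (hQ : ∀ p ∈ Q, ∀ r, p * f.toAlgHom r ∈ Q) (hQ' : ∀ i, ∀ p ∈ Q, S.proj i p ∈ Q) (h : P ≤ Q)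
    (t : P ⊗[K] Y)
    (ht : (Submodule.inclusion h).rTensor Y t ∈ subRel act f Q hQ) :
    t ∈ subRel act f P hP := by
  -- Injectivity is encoded as exactness of 0 → P → Q.
  have hex := (hff (RightSupermodule.zero f) _ _ (RightSupermodule.zeroHom _ _)
    (RightSupermodule.incl f hP hP' hQ hQ' h)).1 (fun x =>
      ⟨fun hx => ⟨0, Subtype.ext (show (0 : S.carrier) = x.1 from
        (congrArg Subtype.val hx).symm)⟩, by rintro ⟨_, rfl⟩; rfl⟩)
  obtain ⟨z, hz⟩ := (hex (Submodule.mkQ _ t)).1 ((Submodule.Quotient.mk_eq_zero _).2 ht)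
  have := subsingleton_zero_tensor (act := act) f
  rw [Subsingleton.elim z 0, map_zero] at hz
  exact (Submodule.Quotient.mk_eq_zero _).1 hz.symm

/-- Faithfully flat modules reflect equality of subspaces. -/
theorem IsFaithfullyFlat.le_of_forall (hff : IsFaithfullyFlat act) (f : R ⟶ S)
    {P Q : Submodule K S.carrier}
    (hP : ∀ p ∈ P, ∀ r, p * f.toAlgHom r ∈ P) (hP' : ∀ i, ∀ p ∈ P, S.proj i p ∈ P)
    (hQ : ∀ p ∈ Q, ∀ r, p * f.toAlgHom r ∈ Q) (hQ' : ∀ i, ∀ p ∈ Q, S.proj i p ∈ Q) (h : P ≤ Q)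
    (hsurj : ∀ (q : Q) (y : Y), ∃ t : P ⊗[K] Y,
      q ⊗ₜ[K] y - (Submodule.inclusion h).rTensor Y t ∈
        subRel act f Q hQ) : Q ≤ P := by
  have hs : Function.Surjective (tensorMap (RightSupermodule.incl f hP hP' hQ hQ' h) act) := by
    intro x
    obtain ⟨x, rfl⟩ := Submodule.mkQ_surjective _ x
    induction x with
    | zero => exact ⟨0, by rw [map_zero, map_zero]⟩
    | add x y hx hy =>
      obtain ⟨a, ha⟩ := hx
      obtain ⟨b, hb⟩ := hy
      exact ⟨a + b, by rw [map_add, map_add, ha, hb]⟩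
    | tmul q y =>
      obtain ⟨t, ht⟩ := hsurj q y
      exact ⟨Submodule.mkQ _ t, ((Submodule.Quotient.eq _).2 ht).symm⟩
  have hex := (hff _ _ (RightSupermodule.zero f) (RightSupermodule.incl f hP hP' hQ hQ' h)
    (RightSupermodule.zeroHom _ _)).2 (fun x => by
      have := subsingleton_zero_tensor (act := act) f
      exact ⟨fun _ => hs x, fun _ => Subsingleton.elim _ _⟩)
  intro q hq
  obtain ⟨p, hp⟩ := (hex ⟨q, hq⟩).1 rfl
  have hp' : (show P from p).1 = q := congrArg Subtype.val hp
  rw [← hp']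
  exact (show P from p).2

variable (f : R ⟶ S)

/-- The action of `R` on an `R`-superalgebra. -/
abbrev SAlg.Hom.lact : R.carrier →ₐ[K] Module.End K S.carrier :=
  (Algebra.lmul K S.carrier).comp f.toAlgHom

/-- Faithfully flat morphisms are injective. -/
theorem IsFaithfullyFlat.injective (hff : IsFaithfullyFlat f.lact) :
    Function.Injective f.toAlgHom := by
  let J : Submodule K R.carrier := LinearMap.ker f.toAlgHom.toLinearMap
  have hJ : ∀ p ∈ J, ∀ r, p * (SAlg.Hom.toAlgHom (𝟙 R)) r ∈ J := by
    intro p hp r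
    change f.toAlgHom (p * r) = 0
    rw [map_mul, show f.toAlgHom p = 0 from hp, zero_mul]
  have hJ' : ∀ i, ∀ p ∈ J, R.proj i p ∈ J := by
    intro i p hp
    change f.toAlgHom (R.proj i p) = 0
    rw [← SAlg.proj_map, show f.toAlgHom p = 0 from hp, map_zero]
  rw [← AlgHom.coe_toLinearMap, ← LinearMap.ker_eq_bot, ← le_bot_iff]
  refine hff.le_of_forall (𝟙 R) (P := ⊥) (Q := J) (fun p hp r => by
    rw [Submodule.mem_bot] at hp ⊢; rw [hp, zero_mul]) (fun i p hp => by
    rw [Submodule.mem_bot] at hp ⊢; rw [hp, map_zero]) hJ hJ' bot_le (fun q y => ⟨0, ?_⟩)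
  rw [map_zero]
  refine (congrArg (· ∈ subRel f.lact (𝟙 R) J hJ) (sub_zero (q ⊗ₜ[K] y))).mpr ?_
  refine hff.injective_incl (𝟙 R) hJ hJ' (Q := ⊤) (fun _ _ _ => trivial) (fun _ _ _ => trivial)
    le_top _ ?_
  -- For q in the kernel of f, q ⊗ y = 1 ⊗ f(q)y = 0 in R ⊗_R S. Flatness pulls this back to J ⊗_R
  -- S, and faithfulness gives J = 0.
  have h : (Submodule.inclusion (le_top : J ≤ ⊤)).rTensor S.carrier (q ⊗ₜ[K] y) =
      (⟨1 * q.1, trivial⟩ : (⊤ : Submodule K R.carrier)) ⊗ₜ[K] y -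
        (⟨1, trivial⟩ : (⊤ : Submodule K R.carrier)) ⊗ₜ[K] f.lact q.1 y := by
    have h1 : f.lact q.1 y = 0 := by
      change f.toAlgHom q.1 * y = 0
      rw [show f.toAlgHom q.1 = 0 from q.2, zero_mul]
    rw [h1, TensorProduct.tmul_zero, LinearMap.rTensor_tmul]
    refine Eq.trans ?_ (sub_zero ((⟨1 * q.1, trivial⟩ : (⊤ : Submodule K R.carrier)) ⊗ₜ[K] y)).symm
    congr 1
    exact Subtype.ext (one_mul _).symm
  rw [h]
  exact Submodule.subset_span ⟨⟨1, trivial⟩, q.1, y, rfl⟩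

/-- The relations defining the tensor square of an `R`-superalgebra. -/
def descentRel : Submodule K (S.carrier ⊗[K] S.carrier) :=
  Submodule.span K {t | ∃ (x : S.carrier) (r : R.carrier) (y : S.carrier),
    t = (x * f.toAlgHom r) ⊗ₜ[K] y - x ⊗ₜ[K] (f.toAlgHom r * y)}

theorem add_sub_add_eq {M : Type*} [AddCommGroup M] (x p q r : M) :
    x + p - (x + r) = p - q + (q - r) := by abel

/-- Faithfully flat descent for elements. -/
theorem IsFaithfullyFlat.mem_range (hff : IsFaithfullyFlat f.lact) {i : ZMod 2} {s : S.carrier}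
    (hs : s ∈ S.gr i) (h : s ⊗ₜ[K] 1 - 1 ⊗ₜ[K] s ∈ descentRel f) : s ∈ f.toAlgHom.range := by
  let P : Submodule K S.carrier := LinearMap.range f.toAlgHom.toLinearMap
  -- `P` is the image of R and `Q` = P + sP. Homogeneity of s makes `Q` a graded right R-submodule,
  -- to which the flatness hypothesis on supermodules applies. It suffices to see that P ⊗_R S → Q
  -- ⊗_R S is onto.
  let Q : Submodule K S.carrier := P ⊔ P.map (LinearMap.mulLeft K s)
  have hP : ∀ p ∈ P, ∀ r, p * f.toAlgHom r ∈ P := by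
    rintro _ ⟨x, rfl⟩ r
    exact ⟨x * r, map_mul f.toAlgHom _ _⟩
  have hP' : ∀ j, ∀ p ∈ P, S.proj j p ∈ P := by
    rintro j _ ⟨x, rfl⟩
    exact ⟨R.proj j x, (SAlg.proj_map f j x).symm⟩
  have hPQ : P ≤ Q := le_sup_left
  have hsP : ∀ p ∈ P, s * p ∈ Q := fun p hp => Submodule.mem_sup_right ⟨p, hp, rfl⟩
  have hQ : ∀ p ∈ Q, ∀ r, p * f.toAlgHom r ∈ Q := by
    intro p hp r
    obtain ⟨a, ha, _, ⟨b, hb, rfl⟩, rfl⟩ := Submodule.mem_sup.1 hp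
    rw [add_mul, LinearMap.mulLeft_apply, mul_assoc]
    exact add_mem (hPQ (hP a ha r)) (hsP _ (hP b hb r))
  have hQ' : ∀ j, ∀ p ∈ Q, S.proj j p ∈ Q := by
    intro j p hp
    obtain ⟨a, ha, _, ⟨b, hb, rfl⟩, rfl⟩ := Submodule.mem_sup.1 hp
    rw [map_add, LinearMap.mulLeft_apply]
    refine add_mem (hPQ (hP' j a ha)) ?_
    obtain rfl | rfl := SAlg.zmod_two_cases i
    · rw [AffineSupergroup.proj_mul_even hs]
      exact hsP _ (hP' _ b hb)
    · rw [AffineSupergroup.proj_mul_odd hs]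
      exact hsP _ (hP' _ b hb)
  have h1 : (1 : S.carrier) ∈ P := ⟨1, map_one f.toAlgHom⟩
  have hsQ : s ∈ Q := by simpa using hsP 1 h1
  have key : Q ≤ P := by
    refine hff.le_of_forall f hP hP' hQ hQ' hPQ (fun q y => ?_)
    obtain ⟨q, hq⟩ := q
    obtain ⟨a, ha, _, ⟨_, ⟨r, rfl⟩, rfl⟩, rfl⟩ := Submodule.mem_sup.1 hq
    -- In Q ⊗_R S one has s f(r) ⊗ y = s ⊗ f(r)y = 1 ⊗ s f(r)y. The last equality is checked in S
    -- ⊗_R S, into which Q ⊗_R S embeds by flatness.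
    refine ⟨⟨a, ha⟩ ⊗ₜ[K] y + ⟨1, h1⟩ ⊗ₜ[K] (s * (f.toAlgHom r * y)), ?_⟩
    have e : (⟨a + LinearMap.mulLeft K s (f.toAlgHom.toLinearMap r), hq⟩ : Q) =
        ⟨a, hPQ ha⟩ + ⟨s * f.toAlgHom r, hsP _ ⟨r, rfl⟩⟩ := rfl
    rw [e, TensorProduct.add_tmul, map_add, LinearMap.rTensor_tmul, LinearMap.rTensor_tmul]
    have e2 : (Submodule.inclusion hPQ) ⟨a, ha⟩ = ⟨a, hPQ ha⟩ := rfl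
    have e3 : (Submodule.inclusion hPQ) ⟨1, h1⟩ = ⟨1, hPQ h1⟩ := rfl
    rw [e2, e3]
    have e4 : (⟨a, hPQ ha⟩ : Q) ⊗ₜ[K] y + (⟨s * f.toAlgHom r, hsP _ ⟨r, rfl⟩⟩ : Q) ⊗ₜ[K] y -
        ((⟨a, hPQ ha⟩ : Q) ⊗ₜ[K] y + (⟨1, hPQ h1⟩ : Q) ⊗ₜ[K] (s * (f.toAlgHom r * y))) =
        ((⟨s * f.toAlgHom r, hsP _ ⟨r, rfl⟩⟩ : Q) ⊗ₜ[K] y -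
          (⟨s, hsQ⟩ : Q) ⊗ₜ[K] (f.toAlgHom r * y)) +
        ((⟨s, hsQ⟩ : Q) ⊗ₜ[K] (f.toAlgHom r * y) -
          (⟨1, hPQ h1⟩ : Q) ⊗ₜ[K] (s * (f.toAlgHom r * y))) :=
      add_sub_add_eq ((⟨a, hPQ ha⟩ : Q) ⊗ₜ[K] y) _ _ _
    refine (congrArg (· ∈ subRel f.lact f Q hQ) e4).mpr ?_
    refine Submodule.add_mem _ (Submodule.subset_span ⟨⟨s, hsQ⟩, r, y, rfl⟩) ?_
    generalize f.toAlgHom r * y = y'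
    refine hff.injective_incl f hQ hQ' (Q := ⊤) (fun _ _ _ => trivial) (fun _ _ _ => trivial)
      le_top _ ?_
    -- The descent hypothesis s ⊗ 1 = 1 ⊗ s, multiplied by y' on the right of the second factor.
    let m : S.carrier ⊗[K] S.carrier →ₗ[K] (⊤ : Submodule K S.carrier) ⊗[K] S.carrier :=
      TensorProduct.map (Submodule.topEquiv (R := K) (M := S.carrier)).symm.toLinearMap
        (LinearMap.mulRight K y')
    have hm : descentRel f ≤ (subRel f.lact f ⊤ (fun _ _ _ => trivial)).comap m := by
      refine Submodule.span_le.2 ?_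
      rintro _ ⟨x, r, y, rfl⟩
      refine Submodule.subset_span ⟨⟨x, trivial⟩, r, y * y', ?_⟩
      rw [map_sub]
      change _ ⊗ₜ[K] (y * y') - _ ⊗ₜ[K] (f.toAlgHom r * y * y') = _ ⊗ₜ[K] (y * y') -
        _ ⊗ₜ[K] (f.toAlgHom r * (y * y'))
      rw [mul_assoc]
      rfl
    have h2 : m (s ⊗ₜ[K] 1 - 1 ⊗ₜ[K] s) ∈ subRel f.lact f ⊤ (fun _ _ _ => trivial) := hm h
    rw [map_sub] at h2
    have e5 : m (s ⊗ₜ[K] 1) = (⟨s, trivial⟩ : (⊤ : Submodule K S.carrier)) ⊗ₜ[K] y' := by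
      change _ ⊗ₜ[K] (1 * y') = _
      rw [one_mul]
      rfl
    rw [e5] at h2
    refine Eq.mp (congrArg (· ∈ subRel f.lact f ⊤ (fun _ _ _ => trivial)) ?_) h2
    exact (map_sub ((Submodule.inclusion (le_top : Q ≤ ⊤)).rTensor S.carrier)
      ((⟨s, hsQ⟩ : Q) ⊗ₜ[K] y') ((⟨1, hPQ h1⟩ : Q) ⊗ₜ[K] (s * y'))).symm
  exact key hsQ

end Descent

end

end Super

namespace Super

noncomputable section

variable {K : Type u} [Field K]

/-! ### Pushouts -/

section Pushout

variable {R A B : SAlg K} (f : R ⟶ A) (g : R ⟶ B)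

/-- The relations defining the tensor product of two `R`-superalgebras. -/
def pushoutRel : Submodule K (A.carrier ⊗[K] B.carrier) :=
  Submodule.span K {t | ∃ (x : A.carrier) (r : R.carrier) (y : B.carrier),
    t = (x * f.toAlgHom r) ⊗ₜ[K] y - x ⊗ₜ[K] (g.toAlgHom r * y)}

/-- Multiplying a relation for r by a ⊗ b gives a relation for r from the even part of b and one for
the parity image of r from the odd part. Hence the relations form a left ideal of the graded tensor
product. -/
theorem pushoutRel_mul (t u : A.carrier ⊗[K] B.carrier) (hu : u ∈ pushoutRel f g) :
    (GradedTensorProduct.of K A.gr B.gr).symm (GradedTensorProduct.of K A.gr B.gr t *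
      GradedTensorProduct.of K A.gr B.gr u) ∈ pushoutRel f g := by
  induction hu using Submodule.span_induction with
  | zero => rw [map_zero, mul_zero, map_zero]; exact zero_mem _
  | add x y _ _ hx hy => rw [map_add, mul_add, map_add]; exact add_mem hx hy
  | smul c x _ hx => rw [map_smul, mul_smul_comm, map_smul]; exact Submodule.smul_mem _ c hx
  | mem u hu =>
    obtain ⟨x, r, y, rfl⟩ := hu
    induction t with
    | zero => rw [map_zero, zero_mul, map_zero]; exact zero_mem _
    | add x y hx hy => rw [map_add, add_mul, map_add]; exact add_mem hx hy
    | tmul a b =>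
      rw [map_sub, mul_sub, SAlg.tmul_mul_tmul, SAlg.tmul_mul_tmul, map_sub,
        LinearEquiv.symm_apply_apply, LinearEquiv.symm_apply_apply]
      have e : (a * (x * f.toAlgHom r)) ⊗ₜ[K] (B.proj 0 b * y) +
          (a * A.parity (x * f.toAlgHom r)) ⊗ₜ[K] (B.proj 1 b * y) -
          ((a * x) ⊗ₜ[K] (B.proj 0 b * (g.toAlgHom r * y)) +
            (a * A.parity x) ⊗ₜ[K] (B.proj 1 b * (g.toAlgHom r * y))) =
          ((a * x * f.toAlgHom r) ⊗ₜ[K] (B.proj 0 b * y) -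
            (a * x) ⊗ₜ[K] (g.toAlgHom r * (B.proj 0 b * y))) +
          ((a * A.parity x * f.toAlgHom (R.parity r)) ⊗ₜ[K] (B.proj 1 b * y) -
            (a * A.parity x) ⊗ₜ[K] (g.toAlgHom (R.parity r) * (B.proj 1 b * y))) := by
        rw [← mul_assoc (B.proj 0 b), SAlg.even_comm (SAlg.proj_mem 0 b) (g.toAlgHom r), mul_assoc (g.toAlgHom r),
          ← mul_assoc (B.proj 1 b), SAlg.odd_mul (SAlg.proj_mem 1 b) (g.toAlgHom r), SAlg.parity_map,
          mul_assoc (g.toAlgHom (R.parity r)), SAlg.parity_mul, SAlg.parity_map,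
          ← mul_assoc a, ← mul_assoc a]
        abel
      rw [e]
      exact add_mem (Submodule.subset_span ⟨_, _, _, rfl⟩) (Submodule.subset_span ⟨_, _, _, rfl⟩)

theorem pushoutRel_parity (u : A.carrier ⊗[K] B.carrier) (hu : u ∈ pushoutRel f g) :
    (GradedTensorProduct.of K A.gr B.gr).symm (SAlg.tensorParity A B
      (GradedTensorProduct.of K A.gr B.gr u)) ∈ pushoutRel f g := by
  induction hu using Submodule.span_induction with
  | zero => rw [map_zero, map_zero, map_zero]; exact zero_mem _
  | add x y _ _ hx hy => rw [map_add, map_add, map_add]; exact add_mem hx hy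
  | smul c x _ hx => rw [map_smul, map_smul, map_smul]; exact Submodule.smul_mem _ c hx
  | mem u hu =>
    obtain ⟨x, r, y, rfl⟩ := hu
    rw [map_sub, map_sub, SAlg.tensorParity_tmul, SAlg.tensorParity_tmul, map_sub,
      LinearEquiv.symm_apply_apply, LinearEquiv.symm_apply_apply, SAlg.parity_mul, SAlg.parity_mul,
      SAlg.parity_map, SAlg.parity_map]
    exact Submodule.subset_span ⟨_, _, _, rfl⟩

/-- The ideal of the tensor product defining the pushout. -/
def pushoutIdeal (hK : (2 : K) ≠ 0) : Ideal (SAlg.tensor A B hK).carrier where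
  carrier := {t | (GradedTensorProduct.of K A.gr B.gr).symm t ∈ pushoutRel f g}
  add_mem' hx hy := Submodule.add_mem (pushoutRel f g) hx hy
  zero_mem' := zero_mem (pushoutRel f g)
  smul_mem' c x hx := pushoutRel_mul f g ((GradedTensorProduct.of K A.gr B.gr).symm c)
    ((GradedTensorProduct.of K A.gr B.gr).symm x) hx

theorem pushoutIdeal_parity (hK : (2 : K) ≠ 0) (x : (SAlg.tensor A B hK).carrier)
    (hx : x ∈ pushoutIdeal f g hK) : (SAlg.tensor A B hK).parity x ∈ pushoutIdeal f g hK := by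
  rw [show (SAlg.tensor A B hK).parity x = SAlg.tensorParity A B x from
    SAlg.ofInvolution_parity _ hK _ _ x]
  exact pushoutRel_parity f g ((GradedTensorProduct.of K A.gr B.gr).symm x) hx

/-- Elements that agree in all common superalgebras agree in the tensor product over `R`. -/
theorem sub_mem_pushoutRel (hK : (2 : K) ≠ 0) {a : A.carrier} {b : B.carrier}
    (h : ∀ (T : SAlg K) (p : A ⟶ T) (q : B ⟶ T), f ≫ p = g ≫ q →
      p.toAlgHom a = q.toAlgHom b) : a ⊗ₜ[K] 1 - 1 ⊗ₜ[K] b ∈ pushoutRel f g := by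
  -- Test on the universal common superalgebra, the quotient of A ⊗ B by the relations.
  refine (SAlg.quotMk_eq_iff hK _ (pushoutIdeal_parity f g hK) _ _).1
    (h (SAlg.quot _ hK _ (pushoutIdeal_parity f g hK))
      (SAlg.tensorInl A B hK ≫ SAlg.quotMk _ hK _ (pushoutIdeal_parity f g hK))
      (SAlg.tensorInr A B hK ≫ SAlg.quotMk _ hK _ (pushoutIdeal_parity f g hK)) ?_)
  ext r
  refine (SAlg.quotMk_eq_iff hK _ (pushoutIdeal_parity f g hK) _ _).2 ?_
  have h1 : f.toAlgHom r ⊗ₜ[K] 1 - 1 ⊗ₜ[K] g.toAlgHom r ∈ pushoutRel f g :=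
    Submodule.subset_span ⟨1, r, 1, by rw [one_mul, mul_one]⟩
  exact h1

end Pushout

/-! ### Affine superschemes are sheaves -/

/-- The algebra map into the product of a family. -/
def SAlg.Family.toPi {R : SAlg K} (F : R.Family) (hK : (2 : K) ≠ 0) : R ⟶ SAlg.pi hK F.alg :=
  SAlg.piLift hK F.map

/-- The tensor square of the product is the sum of the blocks Rᵢ ⊗ Rⱼ. Decomposing s and 1 along the
factors puts one matching condition into each block. -/
theorem SAlg.Family.sub_mem_descentRel {R : SAlg K} (F : R.Family) (hK : (2 : K) ≠ 0)
    (s : ∀ i, (F.alg i).carrier)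
    (hs : ∀ i j, s i ⊗ₜ[K] 1 - 1 ⊗ₜ[K] s j ∈ pushoutRel (F.map i) (F.map j)) :
    (show (SAlg.pi hK F.alg).carrier from s) ⊗ₜ[K] (1 : (SAlg.pi hK F.alg).carrier) -
      (1 : (SAlg.pi hK F.alg).carrier) ⊗ₜ[K] (show (SAlg.pi hK F.alg).carrier from s) ∈
      descentRel (F.toPi hK) := by
  classical
  let ι : ∀ i, (F.alg i).carrier →ₗ[K] (SAlg.pi hK F.alg).carrier := fun i =>
    LinearMap.single K (fun i => (F.alg i).carrier) i
  have hι : ∀ s : ∀ i, (F.alg i).carrier, ∑ i, ι i (s i) = s := fun s =>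
    Finset.univ_sum_single s
  have hl : ∀ i (x : (F.alg i).carrier) (r : R.carrier),
      ι i (x * (F.map i).toAlgHom r) = ι i x * (F.toPi hK).toAlgHom r := by
    intro i x r
    refine funext fun j => ?_
    change (Pi.single i (x * (F.map i).toAlgHom r) : ∀ j, (F.alg j).carrier) j =
      (Pi.single i x : ∀ j, (F.alg j).carrier) j * (F.map j).toAlgHom r
    by_cases h : j = i
    · subst h; rw [Pi.single_eq_same, Pi.single_eq_same]
    · rw [Pi.single_eq_of_ne h, Pi.single_eq_of_ne h, zero_mul]
  have hr : ∀ i (x : (F.alg i).carrier) (r : R.carrier),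
      ι i ((F.map i).toAlgHom r * x) = (F.toPi hK).toAlgHom r * ι i x := by
    intro i x r
    refine funext fun j => ?_
    change (Pi.single i ((F.map i).toAlgHom r * x) : ∀ j, (F.alg j).carrier) j =
      (F.map j).toAlgHom r * (Pi.single i x : ∀ j, (F.alg j).carrier) j
    by_cases h : j = i
    · subst h; rw [Pi.single_eq_same, Pi.single_eq_same]
    · rw [Pi.single_eq_of_ne h, Pi.single_eq_of_ne h, mul_zero]
  have key : ∀ i j, ι i (s i) ⊗ₜ[K] ι j 1 - ι i 1 ⊗ₜ[K] ι j (s j) ∈ descentRel (F.toPi hK) := by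
    intro i j
    have h1 : pushoutRel (F.map i) (F.map j) ≤
        (descentRel (F.toPi hK)).comap (TensorProduct.map (ι i) (ι j)) := by
      refine Submodule.span_le.2 ?_
      rintro _ ⟨x, r, y, rfl⟩
      refine Submodule.subset_span ⟨ι i x, r, ι j y, ?_⟩
      rw [map_sub, TensorProduct.map_tmul, TensorProduct.map_tmul, hl, hr]
    have h2 := h1 (hs i j)
    rwa [Submodule.mem_comap, map_sub, TensorProduct.map_tmul, TensorProduct.map_tmul] at h2
  have e1 : (show (SAlg.pi hK F.alg).carrier from s) = ∑ i, ι i (s i) := (hι s).symm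
  have e2 : (1 : (SAlg.pi hK F.alg).carrier) = ∑ i, ι i 1 := (hι 1).symm
  rw [e1, e2]
  simp only [TensorProduct.sum_tmul, TensorProduct.tmul_sum]
  rw [← Finset.sum_sub_distrib]
  refine sum_mem fun i _ => ?_
  rw [← Finset.sum_sub_distrib]
  exact sum_mem fun j _ => key _ _

/-- Affine superschemes are dur sheaves. -/
theorem isDurSheaf_SSp (hK : (2 : K) ≠ 0) (X : SAlg K) : IsDurSheaf (SSp X) := by
  intro R F hF x hx
  have hff : IsFaithfullyFlat (SAlg.Hom.lact (F.toPi hK)) := hF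
  have hinj := hff.injective
  let x' : X ⟶ SAlg.pi hK F.alg := SAlg.piLift hK x
  have hr : ∀ a, x'.toAlgHom a ∈ (F.toPi hK).toAlgHom.range := by
    -- Descent is available for homogeneous elements only; the general case follows by splitting
    -- into parities.
    have hhom : ∀ i, ∀ a ∈ X.gr i, x'.toAlgHom a ∈ (F.toPi hK).toAlgHom.range := by
      intro i a ha
      refine hff.mem_range _ (x'.even i a ha) ?_
      refine F.sub_mem_descentRel hK (fun i => (x i).toAlgHom a) (fun i j => ?_)
      refine sub_mem_pushoutRel _ _ hK (fun T p q hpq => ?_)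
      have h := hx i j T p q hpq
      exact congrArg (fun f : X ⟶ T => f.toAlgHom a) h
    intro a
    rw [← SAlg.proj_add_proj a, map_add]
    exact add_mem (hhom 0 _ (SAlg.proj_mem 0 a)) (hhom 1 _ (SAlg.proj_mem 1 a))
  let y : X.carrier →ₐ[K] R.carrier :=
    (AlgEquiv.ofInjective (F.toPi hK).toAlgHom hinj).symm.toAlgHom.comp
      (x'.toAlgHom.codRestrict _ hr)
  have hy : ∀ a, (F.toPi hK).toAlgHom (y a) = x'.toAlgHom a := fun a =>
    congrArg Subtype.val ((AlgEquiv.ofInjective (F.toPi hK).toAlgHom hinj).apply_symm_apply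
      ⟨x'.toAlgHom a, hr a⟩)
  let y' : X ⟶ R := SAlg.homOfParity hK y (fun a => hinj (by
    rw [← SAlg.parity_map, hy, hy, SAlg.parity_map]))
  refine ⟨y', fun i => ?_, fun z hz => ?_⟩
  · refine SAlg.hom_ext fun a => ?_
    exact congrFun (hy a) i
  · refine SAlg.hom_ext fun a => hinj ?_
    refine Eq.trans ?_ (hy a).symm
    refine funext fun i => ?_
    exact congrArg (fun f : X ⟶ F.alg i => f.toAlgHom a) (hz i)

end

end Super

namespace Super

noncomputable section

variable {K : Type u} [Field K]

/-! ### The image of a morphism as an associated sheaf -/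

/-- Factorization through a surjective morphism. -/
theorem SAlg.exists_factor {A B C : SAlg K} (p : A ⟶ B) (hp : Function.Surjective p.toAlgHom)
    (f : A ⟶ C) (h : ∀ a, p.toAlgHom a = 0 → f.toAlgHom a = 0) : ∃ g : B ⟶ C, p ≫ g = f := by
  choose s hs using hp
  have key : ∀ a b, p.toAlgHom a = p.toAlgHom b → f.toAlgHom a = f.toAlgHom b := fun a b e => by
    rw [← sub_eq_zero, ← map_sub] at e ⊢
    exact h _ e
  refine ⟨⟨AlgHom.ofLinearMap
    { toFun := fun b => f.toAlgHom (s b)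
      map_add' := fun a b => by
        rw [← map_add]
        exact key _ _ (by rw [map_add, hs, hs, hs])
      map_smul' := fun c b => by
        rw [RingHom.id_apply, ← map_smul]
        exact key _ _ (by rw [map_smul, hs, hs]) } ?_ ?_, ?_⟩, ?_⟩
  · change f.toAlgHom (s 1) = 1
    rw [← map_one f.toAlgHom]
    exact key _ _ (by rw [hs, map_one])
  · intro a b
    change f.toAlgHom (s (a * b)) = f.toAlgHom (s a) * f.toAlgHom (s b)
    rw [← map_mul]
    exact key _ _ (by rw [map_mul, hs, hs, hs])
  · intro i b hb
    change f.toAlgHom (s b) ∈ _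
    rw [key (s b) (A.proj i (s b)) (by rw [← SAlg.proj_map, hs, SAlg.proj_of_mem hb])]
    exact f.even i _ (SAlg.proj_mem i _)
  · ext a
    exact key _ _ (hs _)

theorem IsDurSheaf.isFppfSheaf {X : SAlg K ⥤ Type u} (h : IsDurSheaf X) : IsFppfSheaf X :=
  fun R F hF => h R F hF.1

/-- The sheaf condition is invariant under isomorphisms. -/
theorem SheafCondition.of_iso {X Y : SAlg K ⥤ Type u} (e : X ≅ Y) {R : SAlg K} {F : R.Family}
    (h : SheafCondition X F) : SheafCondition Y F := by
  intro y hy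
  have nat : ∀ {A B : SAlg K} (f : A ⟶ B) (a : Y.obj A),
      X.map f (e.inv.app A a) = e.inv.app B (Y.map f a) := fun f a =>
    (ConcreteCategory.congr_hom (e.inv.naturality f) a).symm
  have nat' : ∀ {A B : SAlg K} (f : A ⟶ B) (a : X.obj A),
      Y.map f (e.hom.app A a) = e.hom.app B (X.map f a) := fun f a =>
    (ConcreteCategory.congr_hom (e.hom.naturality f) a).symm
  have hie : ∀ (A : SAlg K) (a : Y.obj A), e.hom.app A (e.inv.app A a) = a := fun A a =>
    ConcreteCategory.congr_hom (e.inv_hom_id_app A) a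
  have hei : ∀ (A : SAlg K) (a : X.obj A), e.inv.app A (e.hom.app A a) = a := fun A a =>
    ConcreteCategory.congr_hom (e.hom_inv_id_app A) a
  obtain ⟨x, hx, hx'⟩ := h (fun i => e.inv.app _ (y i)) (fun i j T g h hgh => by
    rw [nat, nat, hy i j T g h hgh])
  refine ⟨e.hom.app _ x, fun i => ?_, fun z hz => ?_⟩
  · rw [nat', hx i, hie]
  · rw [← hx' (e.inv.app _ z) (fun i => by rw [nat, hz i]), hie]

/-! ### The image as the superscheme of Im φ^*, and its universal property -/

namespace AffineSupergroup

variable {G H : AffineSupergroup K} (φ : Mor G H)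

theorem toRange_surjective : Function.Surjective (SAlg.toRange φ.comorphism).toAlgHom :=
  φ.comorphism.toAlgHom.rangeRestrict_surjective

theorem toRange_comp_injective {R : SAlg K} {f g : SAlg.range φ.comorphism ⟶ R}
    (h : SAlg.toRange φ.comorphism ≫ f = SAlg.toRange φ.comorphism ≫ g) : f = g := by
  ext b
  obtain ⟨a, rfl⟩ := toRange_surjective φ b
  exact congrArg (fun f : H.alg ⟶ R => f.toAlgHom a) h

/-- Points of the image of `φ`, as morphisms defined on the image of `φ^*`. -/
def imageEquiv (R : SAlg K) : (SAlg.range φ.comorphism ⟶ R) ≃ (image φ).pt R :=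
  Equiv.ofBijective (fun f => ⟨SAlg.toRange φ.comorphism ≫ f, fun a ha => by
    have h : (SAlg.toRange φ.comorphism).toAlgHom a = 0 := Subtype.ext ha
    change f.toAlgHom ((SAlg.toRange φ.comorphism).toAlgHom a) = 0
    rw [h, map_zero]⟩)
    ⟨fun f g h => toRange_comp_injective φ (congrArg Subtype.val h), fun g => by
      obtain ⟨f, hf⟩ := SAlg.exists_factor (SAlg.toRange φ.comorphism) (toRange_surjective φ)
        (show H.alg ⟶ R from g.1) (fun a ha => g.2 a (congrArg Subtype.val ha))
      exact ⟨f, Subtype.ext hf⟩⟩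

/-- The superscheme of the image of `φ^*` is the image of `φ`. -/
def imageIso : SSp (SAlg.range φ.comorphism) ≅ (image φ).points ⋙ forget GrpCat :=
  NatIso.ofComponents (fun R => (imageEquiv φ R).toIso) (fun _ => rfl)

/-- The morphism from the naive quotient by the kernel to the image. -/
def toImage : (kernel φ).naiveQuotient ⟶ (image φ).points where
  app R := GrpCat.ofHom (QuotientGroup.lift ((kernel φ).pt R)
    ((φ.onPt R).codRestrict ((image φ).pt R) (fun g a ha => by
      change (SAlg.Hom.toAlgHom g) (φ.comorphism.toAlgHom a) = 0
      rw [show φ.comorphism.toAlgHom a = 0 from ha, map_zero]))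
    (fun g hg => Subtype.ext (by rw [kernel_pt] at hg; exact hg)))
  naturality R S f := by
    ext x
    induction x using QuotientGroup.induction_on with
    | H g => rfl

theorem proj_toImage_incl : (kernel φ).proj ≫ toImage φ ≫ (image φ).incl = φ.points := rfl

/-- The universal property of the image. -/
theorem existsUnique_desc {Z : SAlg K ⥤ Type u} (hZ : SheafCondition Z φ.cover)
    (h : (kernel φ).naiveQuotient ⋙ forget GrpCat ⟶ Z) :
    ∃! v : (image φ).points ⋙ forget GrpCat ⟶ Z,
      Functor.whiskerRight (toImage φ) (forget GrpCat) ≫ v = h := by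
  let q : ∀ {R : SAlg K}, (G.alg ⟶ R) → ((kernel φ).naiveQuotient ⋙ forget GrpCat).obj R :=
    fun {R} g => QuotientGroup.mk' ((kernel φ).pt R) g
  have hq : ∀ {R : SAlg K} (g : G.alg ⟶ R), Z.map g (h.app G.alg (q (𝟙 G.alg))) = h.app R (q g) :=
    fun g => (ConcreteCategory.congr_hom (h.naturality g) (q (𝟙 G.alg))).symm
  -- Two points of G that agree on B have the same image in H, so they differ by a point of N and
  -- agree in the naive quotient. This is the descent datum for the class of the generic point.
  have hqq : ∀ {T : SAlg K} (g g' : G.alg ⟶ T), φ.rangeIncl ≫ g = φ.rangeIncl ≫ g' →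
      q g = q g' := fun {T} g g' e => by
    refine QuotientGroup.eq.2 ?_
    have e' : φ.onPt T g = φ.onPt T g' := congrArg (fun f => SAlg.toRange φ.comorphism ≫ f) e
    have key : ∀ a b : G.Pt T, φ.onPt T a = φ.onPt T b → a⁻¹ * b ∈ (kernel φ).pt T :=
      fun a b hab => by
        rw [kernel_pt, MonoidHom.mem_ker, map_mul, map_inv, hab, inv_mul_cancel]
    exact key g g' e'
  obtain ⟨y, hy, hy'⟩ := hZ (fun _ => h.app G.alg (q (𝟙 G.alg))) (fun _ _ T g g' e =>
    (hq g).trans ((congrArg (h.app T) (hqq g g' e)).trans (hq g').symm))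
  have hy0 : Z.map φ.rangeIncl y = h.app G.alg (q (𝟙 G.alg)) := hy (0 : Fin 1)
  let w : SSp (SAlg.range φ.comorphism) ⟶ Z :=
    { app := fun R => TypeCat.ofHom (fun f : SAlg.range φ.comorphism ⟶ R => Z.map f y)
      naturality := fun R S f => by
        ext g
        exact ConcreteCategory.congr_hom (Z.map_comp (show SAlg.range φ.comorphism ⟶ R from g) f) y }
  have hinv : ∀ {R : SAlg K} (f : SAlg.range φ.comorphism ⟶ R),
      (imageIso φ).inv.app R ((imageIso φ).hom.app R f) = f := fun {R} f =>
    ConcreteCategory.congr_hom ((imageIso φ).hom_inv_id_app R) f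
  have hhom : ∀ {R : SAlg K} (f : ((image φ).points ⋙ forget GrpCat).obj R),
      (imageIso φ).hom.app R ((imageIso φ).inv.app R f) = f := fun {R} f =>
    ConcreteCategory.congr_hom ((imageIso φ).inv_hom_id_app R) f
  refine ⟨(imageIso φ).inv ≫ w, ?_, fun v hv => ?_⟩
  · ext R x
    induction x using QuotientGroup.induction_on with
    | H g =>
      have key : ∀ g : G.alg ⟶ R, w.app R ((imageIso φ).inv.app R ((imageIso φ).hom.app R
          (φ.rangeIncl ≫ g))) = h.app R (q g) := fun g =>
        (congrArg (w.app R) (hinv _)).trans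
          ((ConcreteCategory.congr_hom (Z.map_comp φ.rangeIncl g) y).trans
            ((congrArg (Z.map g) hy0).trans (hq g)))
      exact key g
  -- Uniqueness by Yoneda: v is determined by its value at the generic point `b` of the image, and
  -- that value restricts to the given section over K[G].
  · let b : ((image φ).points ⋙ forget GrpCat).obj (SAlg.range φ.comorphism) :=
      (imageIso φ).hom.app _ (𝟙 (SAlg.range φ.comorphism))
    have hb : ∀ {R : SAlg K} (f : SAlg.range φ.comorphism ⟶ R),
        ((image φ).points ⋙ forget GrpCat).map f b = (imageIso φ).hom.app R f := fun f => rfl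
    have nat : ∀ {A B : SAlg K} (f : A ⟶ B) (a : ((image φ).points ⋙ forget GrpCat).obj A),
        v.app B (((image φ).points ⋙ forget GrpCat).map f a) = Z.map f (v.app A a) :=
      fun f a => ConcreteCategory.congr_hom (v.naturality f) a
    have hv' : ∀ {R : SAlg K} (f : SAlg.range φ.comorphism ⟶ R),
        v.app R ((imageIso φ).hom.app R f) = Z.map f (v.app _ b) := fun {R} f =>
      (congrArg (v.app R) (hb f)).symm.trans (nat f b)
    have e : v.app _ b = y := by
      refine hy' _ (fun _ => ?_)
      have e1 : (imageIso φ).hom.app G.alg φ.rangeIncl =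
          (Functor.whiskerRight (toImage φ) (forget GrpCat)).app G.alg (q (𝟙 G.alg)) := rfl
      have e2 : ∀ x, v.app G.alg
          ((Functor.whiskerRight (toImage φ) (forget GrpCat)).app G.alg x) = h.app G.alg x :=
        fun x => by rw [← hv]; rfl
      exact (hv' φ.rangeIncl).symm.trans ((congrArg (v.app G.alg) e1).trans (e2 _))
    ext R x
    have e2 := hv' ((imageIso φ).inv.app R x)
    rw [hhom, e] at e2
    exact e2

end AffineSupergroup

end

end Super

namespace Super

noncomputable section

variable {K : Type u} [Field K]

/-! ### Finitely generated superalgebras -/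

namespace SAlg

/-- Finitely generated commutative superalgebras are noetherian. -/
theorem isNoetherianRing_of_finiteType (A : SAlg K)
    [hA : Algebra.FiniteType K A.carrier] : IsNoetherianRing A.carrier := by
  obtain ⟨s, hs⟩ := hA.out
  -- Even components of the generators and products of two odd components are central, so a
  -- polynomial ring acts on A through them. A product of two odd generators is then a scalar, so 1
  -- and the odd components already span A as a module over it.
  let c : s ⊕ s × s → A.evenPart := Sum.elim (fun x => ⟨A.proj 0 x, proj_mem 0 _⟩)
    (fun x => ⟨A.proj 1 x.1 * A.proj 1 x.2, odd_mul_odd (proj_mem 1 _) (proj_mem 1 _)⟩)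
  let f : MvPolynomial (s ⊕ s × s) K →ₐ[K] A.carrier :=
    A.evenPart.val.comp (MvPolynomial.aeval c)
  have hf : ∀ e a, f e * a = a * f e := fun e a => even_comm (MvPolynomial.aeval c e).2 a
  have hX : ∀ i, f (MvPolynomial.X i) = c i := fun i =>
    congrArg Subtype.val (MvPolynomial.aeval_X c i)
  let _ : Module (MvPolynomial (s ⊕ s × s) K) A.carrier := Module.compHom _ f.toRingHom
  have hsmul : ∀ (e : MvPolynomial (s ⊕ s × s) K) (a : A.carrier), e • a = f e * a :=
    fun _ _ => rfl
  have : IsScalarTower (MvPolynomial (s ⊕ s × s) K) A.carrier A.carrier :=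
    ⟨fun e a b => mul_assoc (f e) a b⟩
  let M : Submodule (MvPolynomial (s ⊕ s × s) K) A.carrier :=
    Submodule.span _ (insert 1 (Set.range fun x : s => A.proj 1 (x : A.carrier)))
  have h1 : (1 : A.carrier) ∈ M := Submodule.subset_span (Set.mem_insert _ _)
  have hy : ∀ x : s, A.proj 1 (x : A.carrier) ∈ M := fun x =>
    Submodule.subset_span (Set.mem_insert_of_mem _ ⟨x, rfl⟩)
  have hodd : ∀ (x : s), ∀ m ∈ M, A.proj 1 (x : A.carrier) * m ∈ M := by
    intro x m hm
    induction hm using Submodule.span_induction with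
    | mem m hm =>
      obtain rfl | ⟨y, rfl⟩ := hm
      · rw [mul_one]; exact hy x
      · have := M.smul_mem (MvPolynomial.X (Sum.inr (x, y))) h1
        rwa [hsmul, hX, mul_one] at this
    | zero => rw [mul_zero]; exact M.zero_mem
    | add a b _ _ ha hb => rw [mul_add]; exact M.add_mem ha hb
    | smul e a _ ha =>
      rw [hsmul, ← mul_assoc, ← hf, mul_assoc, ← hsmul]
      exact M.smul_mem e ha
  have hgen : ∀ x : s, ∀ m ∈ M, (x : A.carrier) * m ∈ M := fun x m hm => by
    rw [← proj_add_proj (x : A.carrier), add_mul]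
    refine M.add_mem ?_ (hodd x m hm)
    have := M.smul_mem (MvPolynomial.X (Sum.inl x)) hm
    rwa [hsmul, hX] at this
  have hall : ∀ a : A.carrier, ∀ m ∈ M, a * m ∈ M := by
    intro a
    have ha : a ∈ Algebra.adjoin K (s : Set A.carrier) := hs ▸ Algebra.mem_top
    induction ha using Algebra.adjoin_induction with
    | mem x hx => exact hgen ⟨x, hx⟩
    | algebraMap r =>
      intro m hm
      rw [← f.commutes r]
      exact M.smul_mem _ hm
    | add a b _ _ ha hb => intro m hm; rw [add_mul]; exact M.add_mem (ha m hm) (hb m hm)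
    | mul a b _ _ ha hb => intro m hm; rw [mul_assoc]; exact ha _ (hb m hm)
  have htop : M = ⊤ := eq_top_iff.2 fun a _ => by
    have := hall a 1 h1
    rwa [mul_one] at this
  have : Module.Finite (MvPolynomial (s ⊕ s × s) K) A.carrier :=
    ⟨htop ▸ Submodule.fg_span ((Set.finite_range _).insert _)⟩
  exact isNoetherian_of_tower (MvPolynomial (s ⊕ s × s) K) inferInstance

theorem finiteType_of_surjective {A B : SAlg K} (f : A ⟶ B) (hf : Function.Surjective f.toAlgHom)
    (hA : Algebra.FiniteType K A.carrier) : Algebra.FiniteType K B.carrier :=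
  hA.of_surjective f.toAlgHom hf

/-- The tensor product of finitely generated superalgebras is finitely generated. -/
theorem tensor_finiteType (hK : (2 : K) ≠ 0) {A B : SAlg K} (hA : Algebra.FiniteType K A.carrier)
    (hB : Algebra.FiniteType K B.carrier) : Algebra.FiniteType K (tensor A B hK).carrier := by
  obtain ⟨s, hs⟩ := hA.out
  obtain ⟨t, ht⟩ := hB.out
  let S := Algebra.adjoin K ((tensorInl A B hK).toAlgHom '' s ∪ (tensorInr A B hK).toAlgHom '' t)
  have hl : ∀ a, (tensorInl A B hK).toAlgHom a ∈ S := fun a => by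
    have h : (tensorInl A B hK).toAlgHom a ∈ (Algebra.adjoin K (s : Set A.carrier)).map
        (tensorInl A B hK).toAlgHom := ⟨a, hs ▸ Algebra.mem_top, rfl⟩
    rw [AlgHom.map_adjoin] at h
    exact Algebra.adjoin_mono Set.subset_union_left h
  have hr : ∀ b, (tensorInr A B hK).toAlgHom b ∈ S := fun b => by
    have h : (tensorInr A B hK).toAlgHom b ∈ (Algebra.adjoin K (t : Set B.carrier)).map
        (tensorInr A B hK).toAlgHom := ⟨b, ht ▸ Algebra.mem_top, rfl⟩
    rw [AlgHom.map_adjoin] at h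
    exact Algebra.adjoin_mono Set.subset_union_right h
  have htop : S = ⊤ := eq_top_iff.2 fun x _ => by
    obtain ⟨x, rfl⟩ := (GradedTensorProduct.of K A.gr B.gr).surjective x
    induction x with
    | zero => exact (congrArg (· ∈ S) (map_zero (GradedTensorProduct.of K A.gr B.gr))).mpr S.zero_mem
    | add x y hx hy =>
      exact (congrArg (· ∈ S) (map_add (GradedTensorProduct.of K A.gr B.gr) x y)).mpr
        (S.add_mem (hx trivial) (hy trivial))
    | tmul a b =>
      have h := S.mul_mem (hl a) (hr b)
      exact (congrArg (· ∈ S) (GradedTensorProduct.tmul_one_mul_one_tmul A.gr B.gr a b)).mp h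
  exact ⟨Subalgebra.fg_def.2 ⟨_, (s.finite_toSet.image _).union (t.finite_toSet.image _), htop⟩⟩

/-! ### Free superalgebras -/

section Free

variable (K) (m n : ℕ)

/-- The parity involution of the free algebra on even and odd generators. -/
def freeParity : FreeAlgebra K (Fin m ⊕ Fin n) →ₐ[K] FreeAlgebra K (Fin m ⊕ Fin n) :=
  FreeAlgebra.lift K (Sum.elim (fun i => FreeAlgebra.ι K (Sum.inl i))
    (fun j => -FreeAlgebra.ι K (Sum.inr j)))

theorem freeParity_freeParity (x : FreeAlgebra K (Fin m ⊕ Fin n)) :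
    freeParity K m n (freeParity K m n x) = x := by
  have h : (freeParity K m n).comp (freeParity K m n) = AlgHom.id K _ := by
    refine FreeAlgebra.hom_ext (funext fun i => ?_)
    rcases i with i | i <;> simp [freeParity]
  exact congrArg (fun f => f x) h

/-- The supercommutation relations. -/
inductive FreeRel : FreeAlgebra K (Fin m ⊕ Fin n) → FreeAlgebra K (Fin m ⊕ Fin n) → Prop
  | comm (x y : FreeAlgebra K (Fin m ⊕ Fin n)) : FreeRel ((2 : K) • (x * y))
      (y * x + freeParity K m n y * x + y * freeParity K m n x -
        freeParity K m n y * freeParity K m n x)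

/-- The free commutative superalgebra, as an algebra. -/
abbrev FreeCarrier : Type u := RingQuot (FreeRel K m n)

/-- The projection from the free algebra. -/
def freeMk : FreeAlgebra K (Fin m ⊕ Fin n) →ₐ[K] FreeCarrier K m n :=
  RingQuot.mkAlgHom K (FreeRel K m n)

theorem freeMk_surjective : Function.Surjective (freeMk K m n) :=
  RingQuot.mkAlgHom_surjective K (FreeRel K m n)

theorem freeMk_rel (x y : FreeAlgebra K (Fin m ⊕ Fin n)) :
    freeMk K m n ((2 : K) • (x * y)) = freeMk K m n
      (y * x + freeParity K m n y * x + y * freeParity K m n x -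
        freeParity K m n y * freeParity K m n x) :=
  RingQuot.mkAlgHom_rel K (FreeRel.comm x y)

/-- The parity involution of the free commutative superalgebra. -/
def freeInvolution : FreeCarrier K m n →ₐ[K] FreeCarrier K m n :=
  RingQuot.liftAlgHom K ⟨(freeMk K m n).comp (freeParity K m n), by
    rintro _ _ ⟨x, y⟩
    simpa only [AlgHom.comp_apply, map_smul, map_mul, map_add, map_sub] using
      freeMk_rel K m n (freeParity K m n x) (freeParity K m n y)⟩

theorem freeInvolution_mk (x : FreeAlgebra K (Fin m ⊕ Fin n)) :
    freeInvolution K m n (freeMk K m n x) = freeMk K m n (freeParity K m n x) :=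
  RingQuot.liftAlgHom_mkAlgHom_apply _ _ _ _

/-- The free commutative superalgebra over `K` on `m` even and `n` odd generators. -/
def free (hK : (2 : K) ≠ 0) : SAlg K :=
  ofInvolution (freeInvolution K m n) hK
    (fun x => by
      obtain ⟨x, rfl⟩ := freeMk_surjective K m n x
      rw [freeInvolution_mk, freeInvolution_mk, freeParity_freeParity])
    (fun x y => by
      obtain ⟨x, rfl⟩ := freeMk_surjective K m n x
      obtain ⟨y, rfl⟩ := freeMk_surjective K m n y
      simpa only [freeInvolution_mk, map_smul, map_mul, map_add, map_sub] using
        freeMk_rel K m n x y)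

theorem free_finiteType (hK : (2 : K) ≠ 0) : Algebra.FiniteType K (free K m n hK).carrier :=
  Algebra.FiniteType.of_surjective (freeMk K m n) (freeMk_surjective K m n)

variable {K m n}

/-- The generators of the free commutative superalgebra. -/
def freeGen (hK : (2 : K) ≠ 0) (i : Fin m ⊕ Fin n) : (free K m n hK).carrier :=
  freeMk K m n (FreeAlgebra.ι K i)

theorem freeGen_inl_mem (hK : (2 : K) ≠ 0) (i : Fin m) :
    freeGen hK (Sum.inl i : Fin m ⊕ Fin n) ∈ (free K m n hK).gr 0 := by
  refine (mem_involutionGr_zero (freeInvolution K m n)).2 ?_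
  refine (freeInvolution_mk K m n _).trans ?_
  rw [freeParity, FreeAlgebra.lift_ι_apply]
  rfl

theorem freeGen_inr_mem (hK : (2 : K) ≠ 0) (j : Fin n) :
    freeGen hK (Sum.inr j : Fin m ⊕ Fin n) ∈ (free K m n hK).gr 1 := by
  refine (mem_involutionGr_one (freeInvolution K m n)).2 ?_
  refine (freeInvolution_mk K m n _).trans ?_
  rw [freeParity, FreeAlgebra.lift_ι_apply]
  exact map_neg _ _

theorem free_hom_ext {hK : (2 : K) ≠ 0} {S : SAlg K} {f g : free K m n hK ⟶ S}
    (h : ∀ i, f.toAlgHom (freeGen hK i) = g.toAlgHom (freeGen hK i)) : f = g := by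
  have h1 : (show FreeCarrier K m n →ₐ[K] S.carrier from f.toAlgHom) = g.toAlgHom :=
    RingQuot.ringQuot_ext' K _ _ (FreeAlgebra.hom_ext (funext h))
  exact SAlg.Hom.ext h1

theorem exists_free_hom (hK : (2 : K) ≠ 0) {S : SAlg K} (t : Fin m → S.carrier)
    (z : Fin n → S.carrier) (ht : ∀ i, t i ∈ S.gr 0) (hz : ∀ j, z j ∈ S.gr 1) :
    ∃ f : free K m n hK ⟶ S, (∀ i, f.toAlgHom (freeGen hK (Sum.inl i)) = t i) ∧
      ∀ j, f.toAlgHom (freeGen hK (Sum.inr j)) = z j := by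
  let F : FreeAlgebra K (Fin m ⊕ Fin n) →ₐ[K] S.carrier := FreeAlgebra.lift K (Sum.elim t z)
  have hF : ∀ x, F (freeParity K m n x) = S.parity (F x) := by
    -- Since F intertwines the involutions, the imposed relations are sent to instances of
    -- `two_smul_mul` in S.
    have h : F.comp (freeParity K m n) = S.parityHom.comp F := by
      refine FreeAlgebra.hom_ext (funext fun i => ?_)
      rcases i with i | i
      · simp [freeParity, F, parityHom_apply, parity_even (ht i)]
      · simp [freeParity, F, parityHom_apply, parity_odd (hz i)]
    exact fun x => congrArg (fun f => f x) h
  let F' : FreeCarrier K m n →ₐ[K] S.carrier := RingQuot.liftAlgHom K ⟨F, by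
    rintro _ _ ⟨x, y⟩
    simp only [map_smul, map_mul, map_add, map_sub, hF]
    exact two_smul_mul _ _⟩
  have hF' : ∀ x, F' (freeMk K m n x) = F x := fun x =>
    RingQuot.liftAlgHom_mkAlgHom_apply _ _ _ _
  refine ⟨homOfParity hK F' (fun x => ?_), fun i => ?_, fun j => ?_⟩
  · obtain ⟨x, rfl⟩ := freeMk_surjective K m n x
    rw [show (free K m n hK).parity (freeMk K m n x) = freeInvolution K m n (freeMk K m n x) from
      ofInvolution_parity _ hK _ _ _, freeInvolution_mk]
    exact (congrArg S.parity (hF' x)).trans ((hF x).symm.trans (hF' _).symm)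
  · exact (hF' _).trans (FreeAlgebra.lift_ι_apply _ _)
  · exact (hF' _).trans (FreeAlgebra.lift_ι_apply _ _)

end Free

/-- The free commutative superalgebra over `R`. -/
theorem isFreeSuperalgebra_tensor (hK : (2 : K) ≠ 0) (R : SAlg K) (m n : ℕ) :
    IsFreeSuperalgebra (tensorInl R (free K m n hK) hK)
      (fun i => (tensorInr R (free K m n hK) hK).toAlgHom (freeGen hK (Sum.inl i)))
      (fun j => (tensorInr R (free K m n hK) hK).toAlgHom (freeGen hK (Sum.inr j))) := by
  refine ⟨fun i => (tensorInr R (free K m n hK) hK).even 0 _ (freeGen_inl_mem hK i),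
    fun j => (tensorInr R (free K m n hK) hK).even 1 _ (freeGen_inr_mem hK j), ?_⟩
  intro S f t z ht hz
  obtain ⟨g, hgt, hgz⟩ := exists_free_hom hK t z ht hz
  have hr : ∀ x, (tensorLift hK f g).toAlgHom ((tensorInr R (free K m n hK) hK).toAlgHom x) =
      g.toAlgHom x := fun x => congrArg (fun k : free K m n hK ⟶ S => k.toAlgHom x)
    (tensorInr_lift hK f g)
  refine ⟨tensorLift hK f g, ⟨tensorInl_lift hK f g, fun i => (hr _).trans (hgt i),
    fun j => (hr _).trans (hgz j)⟩, ?_⟩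
  rintro k ⟨hk, hkt, hkz⟩
  refine tensor_hom_ext (hk.trans (tensorInl_lift hK f g).symm) (free_hom_ext ?_)
  rintro (i | j)
  · exact (hkt i).trans ((hr _).trans (hgt i)).symm
  · exact (hkz j).trans ((hr _).trans (hgz j)).symm

/-- Morphisms between finitely generated superalgebras are finitely presented. -/
theorem isFinitelyPresented_of_finiteType (hK : (2 : K) ≠ 0) {R S : SAlg K} (f : R ⟶ S)
    (hR : Algebra.FiniteType K R.carrier) (hS : Algebra.FiniteType K S.carrier) :
    IsFinitelyPresented f := by
  obtain ⟨s, hs⟩ := hS.out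
  let e := s.equivFin
  let t : Fin s.card → S.carrier := fun i => S.proj 0 (e.symm i : S.carrier)
  let z : Fin s.card → S.carrier := fun i => S.proj 1 (e.symm i : S.carrier)
  have hP := isFreeSuperalgebra_tensor hK R s.card s.card
  obtain ⟨p, ⟨hp, hpt, hpz⟩, -⟩ := hP.2.2 S f t z (fun i => proj_mem 0 _) (fun i => proj_mem 1 _)
  have := tensor_finiteType hK hR (free_finiteType K s.card s.card hK)
  have := isNoetherianRing_of_finiteType (tensor R (free K s.card s.card hK) hK)
  -- Each generator of S contributes its even and its odd part as separate generators. The kernel is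
  -- finitely generated because the free superalgebra R[m|n] is noetherian.
  refine ⟨_, _, _, _, _, _, p, hP, hp, ?_, IsNoetherian.noetherian _⟩
  rw [← AlgHom.range_eq_top, eq_top_iff, ← hs, Algebra.adjoin_le_iff]
  intro x hx
  have h := p.toAlgHom.range.add_mem ⟨_, hpt (e ⟨x, hx⟩)⟩ ⟨_, hpz (e ⟨x, hx⟩)⟩
  simp only [t, z, Equiv.symm_apply_apply, proj_add_proj] at h
  exact h

end SAlg

/-- For algebraic supergroups, the covering of the image by `K[G]` is an fppf-covering. -/
theorem AffineSupergroup.Mor.cover_isFppf {G H : AffineSupergroup K} (φ : Mor G H)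
    (hK : (2 : K) ≠ 0) (hG : G.IsAlgebraic) (hH : H.IsAlgebraic) : φ.cover.IsFppf :=
  ⟨φ.cover_isFF hK, fun _ => SAlg.isFinitelyPresented_of_finiteType hK φ.rangeIncl
    (SAlg.finiteType_of_surjective _ (toRange_surjective φ) hH) hG⟩

end

end Super

/-! ### The theorem -/

theorem theorem6p1 {K : Type u} [Field K] (hK : (2 : K) ≠ 0) (G H : Super.AffineSupergroup K)
    (φ : Super.AffineSupergroup.Mor G H) :
    (∃ e : Super.SSp (Super.SAlg.range φ.comorphism) ≅
        (Super.AffineSupergroup.image φ).points ⋙ forget GrpCat,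
      ∀ (R : Super.SAlg K) (f : Super.SAlg.range φ.comorphism ⟶ R),
        (Super.AffineSupergroup.image φ).incl.app R (e.hom.app R f) =
          Super.SAlg.toRange φ.comorphism ≫ f) ∧
    (∃ α : (Super.AffineSupergroup.kernel φ).naiveQuotient ⟶
        (Super.AffineSupergroup.image φ).points,
      (Super.AffineSupergroup.kernel φ).proj ≫ α ≫ (Super.AffineSupergroup.image φ).incl =
        φ.points ∧
      Super.IsAssociatedDurSheaf (Functor.whiskerRight α (forget GrpCat)) ∧
      (G.IsAlgebraic → H.IsAlgebraic →
        Super.IsAssociatedFppfSheaf (Functor.whiskerRight α (forget GrpCat)))) ∧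
    (Super.AffineSupergroup.kernel φ).IsFaithfullyExact := by
  open Super AffineSupergroup in
  have hsheaf : IsDurSheaf ((image φ).points ⋙ forget GrpCat) := fun R F hF =>
    SheafCondition.of_iso (imageIso φ) (isDurSheaf_SSp hK _ R F hF)
  exact ⟨⟨imageIso φ, fun R f => rfl⟩,
    ⟨toImage φ, proj_toImage_incl φ,
      ⟨hsheaf, fun Z hZ h => existsUnique_desc φ (hZ _ _ (φ.cover_isFF hK)) h⟩,
      fun hG hH => ⟨hsheaf.isFppfSheaf,
        fun Z hZ h => existsUnique_desc φ (hZ _ _ (φ.cover_isFppf hK hG hH)) h⟩⟩,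
    kernel_isFaithfullyExact φ hK⟩
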